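/- **Model.** Let $\mathcal X$ be a finite set, $(X_t)_{t\ge1}$ i.i.d. with values in $\mathcal X$, and $(Z_i)_{i\ge1}$ i.i.d. positive integers with $E[Z_1^2]<\infty$, independent of $(X_t)$. Put $\mu=E[Z_1]$, $T_0=0$, $T_i=Z_1+\dots+Z_i$. Let $d:\mathcal X\times(\mathcal X\cup\{?\})\to\mathbb R_{\ge0}$ with $d(x,x)=0$, $v(x)=d(x,?)$, $V_t=v(X_t)$, $\mathcal V=\{v(x):x\in\mathcal X\}$, $v_{\min}=\min\mathcal V$, $v_{\max}=\max\mathcal V$; assume that $|\mathcal V|\ge2$ and that $V_1$ takes every value in $\mathcal V$ with positive probability. A *selection process* is $\mathbf S=(S_i)_{i\ge0}$ with $S_0=0$ and, almost surely, $S_{i-1}<S_i\le T_i$, where $S_i$ is a function of $T_1,\dots,T_i$ and $V_1,\dots,V_{T_i}$. Let $Y_j(t)=X_j$ if $S_i=j$ for some $i\ge1$ with $T_i<t$, and $Y_j(t)=\,?$ otherwise. Put $$D^{(\mathbf S)}=E\Big[\limsup_{t\to\infty}\tfrac1t\sum_{j=1}^t d(X_j,Y_j(t))\Big],\qquad \Delta_e^{(\mathbf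 S)}=E\Big[\tfrac1\mu\limsup_{i\to\infty}\tfrac1i\sum_{j=1}^i(T_j-S_j)Z_{j+1}\Big].$$ Let $\mathcal S_2'$ be the class of selection processes with $\sup_iE[(T_i-S_i)^2]<\infty$ such that, almost surely, $V_{S_i}=v_{\min}$ implies $S_i=T_i$ for all $i\ge1$. For $\eta>0$ put $$J(\eta)^{(\mathbf S)}=\limsup_{i\to\infty}\tfrac1i\,E\Big[\sum_{j=1}^i\Big(\tfrac1\mu\sum_{t=S_{j-1}+1}^{S_j-1}V_t+\eta(T_j-S_j)\Big)\Big],\qquad J^*(\eta)=\inf_{\mathbf S\in\mathcal S_2'}J(\eta)^{(\mathbf S)},\qquad K(\eta)=\Big\lceil\frac{v_{\max}-v_{\min}}{\mu\,\eta}\Big\rceil .$$ **Policy iteration with buffer size $K$.** The states are the words $\mathbf b$ over $\mathcal V$ of length $1\le l(\mathbf b)\le K$. The actions in $\mathbf b$ are the $s\in\{1,\dots,l(\mathbf b)\}$ such that $b_s\ne v_{\min}$ if $s<l(\mathbf b)$. A stationary policy is a map $s(\cdot)$ choosing an action in every state. Its selection process is $S_i=T_i-l(\mathbf b)+s(\mathbf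 b)$, where $\mathbf b=[V_t]_{\max(S_{i-1}+1,\,T_i-K+1)\le t\le T_i}$. For a function $h$ on states let $$C_h(\mathbf b,s)=\tfrac1\mu\sum_{k<s}b_k+\eta(l(\mathbf b)-s)+E\big[\tfrac1\mu\Sigma(\mathbf u)+h(\mathbf u')\big],$$ where $\mathbf u=[b_{s+1},\dots,b_{l(\mathbf b)},V_1,\dots,V_{Z_1}]$, $\mathbf u'$ is the word of the last $\min(K,l(\mathbf u))$ entries of $\mathbf u$, and $\Sigma(\mathbf u)$ is the sum of the other entries of $\mathbf u$. Evaluating a policy $s$ means solving $h(\mathbf b)+\lambda=C_h(\mathbf b,s(\mathbf b))$ for all states $\mathbf b$, with $h([v_{\min}])=0$, for $(h,\lambda)$. Policy iteration starts with $s^{(0)}(\mathbf b)=l(\mathbf b)$, evaluates $s^{(n)}$ to get $(h^{(n)},\lambda^{(n)})$, takes for $s^{(n+1)}(\mathbf b)$ a minimizer of $C_{h^{(n)}}(\mathbf b,\cdot)$ over the actions in $\mathbf b$, and stops when $s^{(n+1)}=s^{(n)}$; it then outputs $s^{(n)}$ and $\lambda^{(n)}$. **Corollary 1.** (a) Let $\eta>0$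 and $K=K(\eta)$. Every stationary policy has exactly one evaluation. Policy iteration can be run, and it stops after finitely many rounds if ties among minimizers are broken consistently (equal $h^{(n)}$ in two successive rounds lead to equal new policies; this holds for a fixed preference among minimizers, and also if the current action is kept whenever it is a minimizer). Whenever it stops, however ties were broken, it outputs $\lambda^{(n)}=J^*(\eta)$ and a policy whose selection process $\mathbf S^*$ lies in $\mathcal S_2'$ and satisfies $$J(\eta)^{(\mathbf S^*)}=J^*(\eta)=D^{(\mathbf S^*)}+\eta\,\Delta_e^{(\mathbf S^*)}.$$ In particular the infimum $J^*(\eta)$ over the untruncated problem is attained by a stationary policy with buffer size $K(\eta)$. (b) Let $\mathcal A$ be the achievable region, i.e. the set of $(x,y)\in\mathbb R_{\ge0}^2$ such that $\Delta_e^{(\mathbf S)}\le x$ and $D^{(\mathbf S)}\le y$ for some selection process $\mathbf S$. Then $f(x):=\sup_{\eta>0}\,(J^*(\eta)-\eta x)$ is finite for every $x\ge0$, $f(x)=\inf\{y:(x,y)\in\mathcal A\}$, and the topological boundary of $\mathcal A$ consists of the curve $\{(x,f(x)):x\ge0\}$ and the vertical ray $\{(0,y):y\ge f(0)\}$. -/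

import Mathlib

open MeasureTheory ProbabilityTheory Filter

noncomputable section

namespace AgeDistortion

/-- The data of the problem. `X t` (`t ≥ 1`) is the payload of the packet that arrives at time `t`;
`Z i` (`i ≥ 1`) is the `i`-th interspeaking time; `d x none` is the penalty for not reconstructing
`x`. The values `X 0` and `Z 0` are never used. -/
structure Model {Ω : Type*} [MeasurableSpace Ω] (P : Measure Ω)
    (𝒳 : Type*) [MeasurableSpace 𝒳] where
  X : ℕ → Ω → 𝒳
  Z : ℕ → Ω → ℕ
  d : 𝒳 → Option 𝒳 → ℝ
  measurable_X : ∀ t, 1 ≤ t → Measurable (X t)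
  measurable_Z : ∀ i, 1 ≤ i → Measurable (Z i)
  /-- the payloads are i.i.d. -/
  indep_X : iIndepFun (fun t : ℕ => X (t + 1)) P
  ident_X : ∀ t, 1 ≤ t → IdentDistrib (X t) (X 1) P P
  /-- the interspeaking times are i.i.d., strictly positive and square integrable -/
  indep_Z : iIndepFun (fun i : ℕ => Z (i + 1)) P
  ident_Z : ∀ i, 1 ≤ i → IdentDistrib (Z i) (Z 1) P P
  Z_pos : ∀ᵐ ω ∂P, 0 < Z 1 ω
  Z_sq : MemLp (fun ω => (Z 1 ω : ℝ)) 2 P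
  /-- the speaking process is independent of the source -/
  indep_XZ : IndepFun (fun ω (t : ℕ) => X (t + 1) ω) (fun ω (i : ℕ) => Z (i + 1) ω) P
  d_nonneg : ∀ x y, 0 ≤ d x y
  d_self : ∀ x, d x (some x) = 0
  /-- every importance value occurs with positive probability -/
  value_pos : ∀ x, 0 < P {ω | d (X 1 ω) none = d x none}
  /-- there are at least two importance values -/
  nontrivial_values : ∃ x y, d x none ≠ d y none

namespace Model

variable {Ω : Type*} [MeasurableSpace Ω] {P : Measure Ω} {𝒳 : Type*} [MeasurableSpace 𝒳]
variable (M : Model P 𝒳)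

/-- The importance `v x = d(x, ?)` of a payload. -/
def v (x : 𝒳) : ℝ := M.d x none

/-- The smallest importance value. -/
def vMin : ℝ := ⨅ x, M.v x

/-- The largest importance value. -/
def vMax : ℝ := ⨆ x, M.v x

/-- The importance `V_t` of the packet that arrives at time `t`. -/
def V (t : ℕ) (ω : Ω) : ℝ := M.v (M.X t ω)

/-- The speaking times `T_i = Z_1 + ⋯ + Z_i`, with `T_0 = 0`. -/
def T (i : ℕ) (ω : Ω) : ℕ := ∑ j ∈ Finset.Icc 1 i, M.Z j ω

/-- The mean interspeaking time `μ = E[Z]`. -/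
def mu : ℝ := ∫ ω, (M.Z 1 ω : ℝ) ∂P

/-- The word `[V_a, …, V_b]` (empty if `b < a`). -/
def segment (a b : ℕ) (ω : Ω) : List ℝ := (List.range' a (b + 1 - a)).map fun t => M.V t ω

/-! ### Selection processes -/

/-- `S` is a selection process: `S_0 = 0`, `S_{i-1} < S_i ≤ T_i`, and `S_i` is a function of the
speaking times `T_1, …, T_i` and of the importance values `V_1, …, V_{T_i}`. -/
def IsSelection (S : ℕ → Ω → ℕ) : Prop :=
  (∀ ω, S 0 ω = 0) ∧
  (∃ φ : List ℕ → List ℝ → ℕ, ∀ i, 1 ≤ i → ∀ ω,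
    S i ω = φ ((List.range' 1 i).map fun j => M.T j ω) (M.segment 1 (M.T i ω) ω)) ∧
  ∀ᵐ ω ∂P, ∀ i, S i ω < S (i + 1) ω ∧ S (i + 1) ω ≤ M.T (i + 1) ω

/-- The class of selection processes with `sup_i E[(T_i - S_i)²] < ∞`, which moreover select a
packet of minimal importance only if it has just arrived. -/
def IsRestrictedSelection (S : ℕ → Ω → ℕ) : Prop :=
  M.IsSelection S ∧
  (⨆ i, ∫⁻ ω, ENNReal.ofReal (((M.T i ω : ℝ) - S i ω) ^ 2) ∂P) < ⊤ ∧
  ∀ᵐ ω ∂P, ∀ i, 1 ≤ i → M.V (S i ω) ω = M.vMin → S i ω = M.T i ω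

open Classical in
/-- The reconstruction `Y_j(t)` of `X_j` at time `t`; `none` stands for `?`. -/
def Y (S : ℕ → Ω → ℕ) (t j : ℕ) (ω : Ω) : Option 𝒳 :=
  if ∃ i, 1 ≤ i ∧ M.T i ω < t ∧ S i ω = j then some (M.X j ω) else none

/-- The distortion `D = E[limsup_t (1/t) ∑_{j ≤ t} d(X_j, Y_j(t))]`. -/
def distortion (S : ℕ → Ω → ℕ) : ENNReal :=
  ∫⁻ ω, limsup (fun t : ℕ => ENNReal.ofReal
    ((1 / (t : ℝ)) * ∑ j ∈ Finset.Icc 1 t, M.d (M.X j ω) (M.Y S t j ω))) atTop ∂P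

/-- The excess age `Δ_e = E[(1/μ) limsup_i (1/i) ∑_{j ≤ i} (T_j - S_j) Z_{j+1}]`. -/
def excessAge (S : ℕ → Ω → ℕ) : ENNReal :=
  ∫⁻ ω, limsup (fun i : ℕ => ENNReal.ofReal
    ((1 / M.mu) * ((1 / (i : ℝ)) *
      ∑ j ∈ Finset.Icc 1 i, ((M.T j ω : ℝ) - S j ω) * M.Z (j + 1) ω))) atTop ∂P

/-- The penalty `∑_{S_{j-1} < t < S_j} V_t` for the packets skipped at the `j`-th speaking time. -/
def skipped (S : ℕ → Ω → ℕ) (j : ℕ) (ω : Ω) : ℝ :=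
  ∑ t ∈ Finset.Ioo (S (j - 1) ω) (S j ω), M.V t ω

/-- The expected cost accumulated over the first `i` speaking times. -/
def accCost (η : ℝ) (S : ℕ → Ω → ℕ) (i : ℕ) : ENNReal :=
  ∫⁻ ω, ENNReal.ofReal (∑ j ∈ Finset.Icc 1 i,
    ((1 / M.mu) * M.skipped S j ω + η * ((M.T j ω : ℝ) - S j ω))) ∂P

/-- The average cost `J(η)` of a selection process. -/
def avgCost (η : ℝ) (S : ℕ → Ω → ℕ) : ENNReal :=
  limsup (fun i : ℕ => ENNReal.ofReal (1 / (i : ℝ)) * M.accCost η S i) atTop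

/-- The optimal average cost `J*(η)` for the untruncated buffer. -/
def optCost (η : ℝ) : ENNReal :=
  ⨅ (S : ℕ → Ω → ℕ) (_ : M.IsRestrictedSelection S), M.avgCost η S

/-! ### The problem with a buffer of size `K` -/

/-- The states: nonempty words of length at most `K` over the set of importance values. -/
def IsState (K : ℕ) (b : List ℝ) : Prop :=
  b ≠ [] ∧ b.length ≤ K ∧ ∀ w ∈ b, w ∈ Set.range M.v

/-- The actions in state `b`: positions `1 ≤ s ≤ l(b)`, where a packet of minimal importance may
be chosen only at the last position. -/
def actions (b : List ℝ) : Set ℕ :=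
  {s | 1 ≤ s ∧ s ≤ b.length ∧ (s < b.length → b[s - 1]? ≠ some M.vMin)}

/-- A stationary policy on the states of length at most `K`. -/
def IsPolicy (K : ℕ) (s : List ℝ → ℕ) : Prop :=
  ∀ b, M.IsState K b → s b ∈ M.actions b

/-- The selection process of a stationary policy with a buffer of size `K`: at time `T_i` the
buffer is the word from `max (S_{i-1} + 1) (T_i - K + 1)` to `T_i`. -/
def inducedSelection (K : ℕ) (s : List ℝ → ℕ) : ℕ → Ω → ℕ
  | 0, _ => 0
  | i + 1, ω =>
    let t := M.T (i + 1) ω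
    let b := M.segment (max (inducedSelection K s i ω + 1) (t + 1 - K)) t ω
    t + s b - b.length

/-- `C_h(b, s)`: the one-step cost of action `s` in state `b`, plus the expectation of the penalty
for the packets that the buffer of size `K` then forgets and of the relative value of the next
state. The word `u` is `b_{≥ s+1} ‖ V^Z`; all but its last `K` entries are forgotten. -/
def stepValue (η : ℝ) (K : ℕ) (h : List ℝ → ℝ) (b : List ℝ) (s : ℕ) : ℝ :=
  (1 / M.mu) * (b.take (s - 1)).sum + η * ((b.length : ℝ) - s) +
    ∫ ω, (let u := b.drop s ++ M.segment 1 (M.Z 1 ω) ω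
          (1 / M.mu) * (u.take (u.length - K)).sum + h (u.drop (u.length - K))) ∂P

/-- Policy evaluation: `h` and `lam` solve the linear system of the policy `s`, normalized by
`h(v_min) = 0`. -/
def IsEvaluation (η : ℝ) (K : ℕ) (s : List ℝ → ℕ) (h : List ℝ → ℝ) (lam : ℝ) : Prop :=
  h [M.vMin] = 0 ∧ ∀ b, M.IsState K b → h b + lam = M.stepValue η K h b (s b)

/-- A run of policy iteration: `s 0` always selects the most recent packet, `h n` and `lam n`
evaluate `s n`, and `s (n + 1) b` minimizes `C_{h n}(b, ·)` over the actions in `b`. -/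
def IsPolicyIteration (η : ℝ) (K : ℕ) (s : ℕ → List ℝ → ℕ) (h : ℕ → List ℝ → ℝ)
    (lam : ℕ → ℝ) : Prop :=
  (∀ b, M.IsState K b → s 0 b = b.length) ∧
  (∀ n, M.IsEvaluation η K (s n) (h n) (lam n)) ∧
  ∀ n b, M.IsState K b → s (n + 1) b ∈ M.actions b ∧
    ∀ a ∈ M.actions b, M.stepValue η K (h n) b (s (n + 1) b) ≤ M.stepValue η K (h n) b a

/-- Ties in the minimization are broken consistently: the same relative values in two successive
rounds give the same policy. This holds if a fixed preference among the minimizers is used, and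
also if the current action is kept whenever it is a minimizer. -/
def ConsistentTies (K : ℕ) (s : ℕ → List ℝ → ℕ) (h : ℕ → List ℝ → ℝ) : Prop :=
  ∀ n, (∀ b, M.IsState K b → h (n + 1) b = h n b) →
    ∀ b, M.IsState K b → s (n + 2) b = s (n + 1) b

/-- The stopping criterion holds in round `n`. -/
def StopsAt (K : ℕ) (s : ℕ → List ℝ → ℕ) (n : ℕ) : Prop :=
  ∀ b, M.IsState K b → s (n + 1) b = s n b

/-- The buffer size `K(η) = ⌈(v_max - v_min) / (μ η)⌉`. -/
def bufferSize (η : ℝ) : ℕ := ⌈(1 / M.mu) * ((M.vMax - M.vMin) / η)⌉₊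

/-! ### The achievable region -/

/-- The achievable region: the points `(x, y)` for which some selection process has excess age at
most `x` and distortion at most `y`. -/
def achievable : Set (ℝ × ℝ) :=
  {p | 0 ≤ p.1 ∧ 0 ≤ p.2 ∧ ∃ S, M.IsSelection S ∧
    M.excessAge S ≤ ENNReal.ofReal p.1 ∧ M.distortion S ≤ ENNReal.ofReal p.2}

/-- The height at `Δ_e = x` of the line `D + η Δ_e = J*(η)`. -/
def line (η x : ℝ) : ℝ := (M.optCost η).toReal - η * x

end Model

end AgeDistortion

end

/-!
The proof compares three problems: the Markov decision problem with a buffer of size `K`, the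
untruncated selection problem, and the pair of almost sure limits `D`, `Δ_e`.

**Finite problem.** The blocks of packets between successive speaking times are i.i.d.
(`map_hist_block`), so the buffer of a stationary policy is a Markov chain. A long run of packets of
minimal importance drives it, under every policy, to one and the same state, since such packets are
only selected when they are the most recent ones (`reach_reference`). Hence superharmonic functions
are minimal at a reference state (`exists_reference`). This gives uniqueness of the evaluation of a
policy, and existence by a dimension count (`exists_evaluation`); it also shows that `lam n` does
not increase, and that `h n` decreases while `lam n` stays constant, so that policy iteration stops,
with a solution of the optimality equation (`policyIteration_stops`, `optimality_of_stopsAt`).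

**Truncation.** Let `F_n` be the optimal cost over `n` steps from an untruncated word when only the
last `K` packets may be selected (`optValue`). An exchange argument, by induction on `n`, shows that
using a speaking time saves at least the penalty `v_min / μ` (`phantomStep`). As
`v_max / μ ≤ v_min / μ + η K` for `K = K(η)`, selecting a packet of age `K` or more is then never
better than skipping it, even if its age is only charged as `K` (`optValue_succ_le_capped`). A
solution of the optimality equation bounds `F_n` from below by `n * lam - C` (`exists_le_optValue`),
so that every selection process has expected capped cost at least `n * lam - C` over `n` steps
(`exists_le_integral_cost`). This bounds `J(η)` from below, and, as the capped costs are dominated,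
also `D + η Δ_e` by Fatou's lemma (`le_avgCost`, `le_distortion_add`).

**Attainment.** Along a stationary policy the evaluation equation telescopes, which gives its
average cost (`avgCost_inducedSelection`). Its evaluations for the two parts of the cost alone,
and a law of large numbers for martingales, give almost sure limits `δ` and `a` with
`lam = δ + η a`, for every process that eventually follows the policy (`exists_hasRates`).

**Region.** The achievable region lies above all lines by the lower bound. Conversely, let `(x, y)`
be strictly above all of them. If the optimal policies have excess age above `x` for some `η`, then,
because it is zero for large `η`, there are two close weights whose excess ages lie on different
sides of `x`. A process that chooses between the two policies according to the first few packets,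
with suitable probabilities, achieves `(x, y)` (`exists_event_prob`, `exists_mixture`,
`mem_achievable_of_line_le`). The frontier of such a region above a supremum of lines is computed in
`frontier_eq_of_isLUB`.
-/

set_option linter.unusedSectionVars false

noncomputable section

namespace AgeDistortion

/-! ### Blocks of packets and histories -/

/-- Lists carry the discrete σ-algebra; only lists over a countable alphabet are used as values of
random variables. -/
instance listMeasurableSpace {α : Type*} : MeasurableSpace (List α) := ⊤

instance listDiscreteMeasurableSpace {α : Type*} : DiscreteMeasurableSpace (List α) :=
  ⟨fun _ => trivial⟩

/-- The law of an initial piece of an i.i.d. sequence with discrete values. -/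
theorem measure_map_range_eq {Ω β : Type*} [MeasurableSpace Ω] [MeasurableSpace β] [Countable β]
    [MeasurableSingletonClass β] {P : Measure Ω} {f : ℕ → Ω → β}
    (hind : iIndepFun f P) (hid : ∀ t, IdentDistrib (f t) (f 0) P P) (l : List β) :
    P {ω | (List.range l.length).map (fun t => f t ω) = l} =
      (l.map fun x => P {ω | f 0 ω = x}).prod := by
  have h1 : {ω | (List.range l.length).map (fun t => f t ω) = l} =
      ⋂ t ∈ Finset.range l.length, f t ⁻¹' {x | l[t]? = some x} := by
    ext ω
    simp only [Set.mem_ofPred_eq, Set.mem_iInter, Finset.mem_range, Set.mem_preimage]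
    constructor
    · intro h t ht
      rw [List.getElem?_eq_getElem ht]
      conv_lhs => rw [List.getElem_of_eq h.symm ht]
      simp
    · intro h
      apply List.ext_getElem (by simp)
      intro t ht1 ht2
      have := h t ht2
      rw [List.getElem?_eq_getElem ht2] at this
      simp only [List.getElem_map, List.getElem_range]
      exact (Option.some.inj this).symm
  rw [h1, hind.measure_inter_preimage_eq_mul _ (fun i _ => (Set.to_countable _).measurableSet),
    Finset.prod_range, ← Fin.prod_univ_fun_getElem]
  refine Finset.prod_congr rfl fun t _ => ?_
  have h2 : {x | l[(t : ℕ)]? = some x} = {l[t]} := by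
    ext x
    simp [eq_comm]
  rw [h2, (hid t).measure_preimage_eq (measurableSet_singleton _)]
  rfl

theorem measurableSet_map_range_eq {Ω β : Type*} [MeasurableSpace Ω] [MeasurableSpace β]
    [MeasurableSingletonClass β] {f : ℕ → Ω → β} (hf : ∀ t, Measurable (f t)) (l : List β) :
    MeasurableSet {ω | (List.range l.length).map (fun t => f t ω) = l} := by
  have : {ω | (List.range l.length).map (fun t => f t ω) = l} =
      ⋂ t : Fin l.length, {ω | f t ω = l[t]} := by
    ext ω
    simp only [Set.mem_ofPred_eq, Set.mem_iInter]
    constructor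
    · intro h t
      conv_rhs => rw [Fin.getElem_fin, List.getElem_of_eq h.symm t.2]
      simp
    · intro h
      exact List.ext_getElem (by simp) fun t h1 h2 => by simpa using h ⟨t, h2⟩
  rw [this]
  exact MeasurableSet.iInter fun t => hf _ (measurableSet_singleton _)

namespace Model

variable {Ω : Type*} [MeasurableSpace Ω] {P : Measure Ω} {𝒳 : Type*} [MeasurableSpace 𝒳]
variable (M : Model P 𝒳)

/-- The payloads that arrive between the `i`-th and the `(i+1)`-st speaking time. -/
def block (i : ℕ) (ω : Ω) : List 𝒳 :=
  (List.range' (M.T i ω + 1) (M.Z (i + 1) ω)).map fun t => M.X t ω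

/-- The history up to the `i`-th speaking time, as the list of the first `i` blocks. -/
def hist (i : ℕ) (ω : Ω) : List (List 𝒳) := (List.range i).map fun j => M.block j ω

theorem T_zero (ω : Ω) : M.T 0 ω = 0 := by simp [T]

theorem T_succ (i : ℕ) (ω : Ω) : M.T (i + 1) ω = M.T i ω + M.Z (i + 1) ω := by
  simp [T, Finset.sum_Icc_succ_top]

theorem T_mono (ω : Ω) : Monotone fun i => M.T i ω :=
  monotone_nat_of_le_succ fun i => by simp [T_succ]

theorem length_block (i : ℕ) (ω : Ω) : (M.block i ω).length = M.Z (i + 1) ω := by simp [block]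

theorem length_hist (i : ℕ) (ω : Ω) : (M.hist i ω).length = i := by simp [hist]

theorem hist_succ (i : ℕ) (ω : Ω) : M.hist (i + 1) ω = M.hist i ω ++ [M.block i ω] := by
  simp [hist, List.range_succ]

theorem map_length_hist (i : ℕ) (ω : Ω) :
    (M.hist i ω).map List.length = (List.range i).map fun j => M.Z (j + 1) ω := by
  simp [hist, Function.comp_def, length_block]

theorem flatten_hist (i : ℕ) (ω : Ω) :
    (M.hist i ω).flatten = (List.range (M.T i ω)).map fun t => M.X (t + 1) ω := by
  induction i with
  | zero => simp [hist, T_zero]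
  | succ i ih =>
    rw [hist_succ, List.flatten_append, ih, T_succ, List.range_add, List.map_append]
    simp [block, List.range'_eq_map_range, Function.comp_def, add_comm, add_left_comm]

/-- The history prescribes exactly an initial piece of the speaking process and an initial piece, of
matching length, of the source. -/
theorem hist_eq_iff {i : ℕ} {ω : Ω} {a : List (List 𝒳)} (ha : a.length = i) :
    M.hist i ω = a ↔
      (List.range (a.map List.length).length).map (fun j => M.Z (j + 1) ω) = a.map List.length ∧
      (List.range a.flatten.length).map (fun t => M.X (t + 1) ω) = a.flatten := by
  rw [List.eq_iff_flatten_eq, map_length_hist, flatten_hist, List.length_map, ha, and_comm]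
  refine and_congr_right fun h => ?_
  have hT : M.T i ω = a.flatten.length := by
    have := congrArg List.length (M.flatten_hist i ω)
    rw [List.length_flatten, map_length_hist, h] at this
    rw [List.length_flatten, this]
    simp
  rw [hT]

/-- The probability that a block equals `w`. -/
def blockProb (w : List 𝒳) : ENNReal :=
  P {ω | M.Z 1 ω = w.length} * (w.map fun x => P {ω | M.X 1 ω = x}).prod

variable [MeasurableSingletonClass 𝒳]

theorem measurableSet_hist_eq (i : ℕ) (a : List (List 𝒳)) :
    MeasurableSet {ω | M.hist i ω = a} := by
  by_cases ha : a.length = i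
  · simp only [M.hist_eq_iff ha]
    rw [Set.ofPred_and]
    exact (measurableSet_map_range_eq (f := fun j => M.Z (j + 1))
      (fun t => M.measurable_Z _ (by omega)) _).inter
      (measurableSet_map_range_eq (f := fun j => M.X (j + 1))
      (fun t => M.measurable_X _ (by omega)) _)
  · convert MeasurableSet.empty
    ext ω
    simp only [Set.mem_ofPred_eq, Set.mem_empty_iff_false, iff_false]
    rintro rfl
    exact ha (M.length_hist i ω)

variable [Finite 𝒳]

theorem measurable_hist (i : ℕ) : Measurable (M.hist i) :=
  measurable_to_countable' fun a => M.measurableSet_hist_eq i a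

theorem measurable_block (i : ℕ) : Measurable (M.block i) := by
  have : M.block i = (fun l : List (List 𝒳) => l.getLastD []) ∘ M.hist (i + 1) := by
    ext1 ω
    simp [hist_succ]
  rw [this]
  exact Measurable.of_discrete.comp (M.measurable_hist _)

variable [IsProbabilityMeasure P]

/-- The blocks are i.i.d.: product form of the law of the history. -/
theorem measure_hist_eq (i : ℕ) (a : List (List 𝒳)) (ha : a.length = i) :
    P {ω | M.hist i ω = a} = (a.map M.blockProb).prod := by
  simp only [M.hist_eq_iff ha]
  have h1 := M.indep_XZ.measure_inter_preimage_eq_mul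
    {f | (List.range a.flatten.length).map f = a.flatten}
    {f | (List.range (a.map List.length).length).map f = a.map List.length}
    (measurableSet_map_range_eq (f := fun t (g : ℕ → 𝒳) => g t) (fun t => measurable_pi_apply t) _)
    (measurableSet_map_range_eq (f := fun t (g : ℕ → ℕ) => g t) (fun t => measurable_pi_apply t) _)
  · rw [Set.ofPred_and, Set.inter_comm]
    refine h1.trans ?_
    have e1 := measure_map_range_eq M.indep_X (fun t => M.ident_X _ (by omega)) a.flatten
    have e2 := measure_map_range_eq M.indep_Z (fun t => M.ident_Z _ (by omega))
      (a.map List.length)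
    rw [Set.preimage_ofPred_eq, Set.preimage_ofPred_eq, e1, e2]
    clear e1 e2 h1 ha
    induction a with
    | nil => simp
    | cons w a ih =>
      simp only [List.map_cons, List.flatten_cons, List.map_append, List.prod_append,
        List.prod_cons] at ih ⊢
      rw [← ih, blockProb]
      ring

theorem map_block_zero_singleton (w : List 𝒳) : P.map (M.block 0) {w} = M.blockProb w := by
  rw [Measure.map_apply (M.measurable_block 0) (measurableSet_singleton _)]
  have := M.measure_hist_eq 1 [w] rfl
  simpa [hist, Set.preimage] using this

/-- A block is independent of the history before it, and distributed as the first block. -/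
theorem map_hist_block (i : ℕ) :
    P.map (fun ω => (M.hist i ω, M.block i ω)) = (P.map (M.hist i)).prod (P.map (M.block 0)) := by
  refine Measure.ext_of_singleton fun ⟨a, w⟩ => ?_
  have hm : Measurable fun ω => (M.hist i ω, M.block i ω) :=
    (M.measurable_hist i).prodMk (M.measurable_block i)
  rw [Measure.map_apply hm (measurableSet_singleton _), ← Set.singleton_prod_singleton,
    Measure.prod_prod, map_block_zero_singleton,
    Measure.map_apply (M.measurable_hist i) (measurableSet_singleton _)]
  have e : (fun ω => (M.hist i ω, M.block i ω)) ⁻¹' ({a} ×ˢ {w}) =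
      {ω | M.hist (i + 1) ω = a ++ [w]} := by
    ext ω
    simp [hist_succ]
  rw [e]
  by_cases ha : a.length = i
  · rw [M.measure_hist_eq _ _ (by simp [ha])]
    have := M.measure_hist_eq i a ha
    rw [show M.hist i ⁻¹' {a} = {ω | M.hist i ω = a} from rfl, this]
    simp
  · have e1 : {ω | M.hist (i + 1) ω = a ++ [w]} = ∅ := by
      ext ω
      simp only [Set.mem_ofPred_eq, Set.mem_empty_iff_false, iff_false]
      intro h
      have := congrArg List.length h
      rw [length_hist] at this
      simp at this
      omega
    have e2 : M.hist i ⁻¹' {a} = ∅ := by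
      ext ω
      simp only [Set.mem_preimage, Set.mem_singleton_iff, Set.mem_empty_iff_false, iff_false]
      rintro rfl
      exact ha (M.length_hist i ω)
    simp [e1, e2]

/-- The Markov property: given the history, the next block may be replaced by an independent copy
of the first block. -/
theorem integral_hist_block (i : ℕ) (G : List (List 𝒳) → List 𝒳 → ℝ)
    (hG : Integrable (fun ω => G (M.hist i ω) (M.block i ω)) P) :
    ∫ ω, G (M.hist i ω) (M.block i ω) ∂P =
      ∫ ω, ∫ ω', G (M.hist i ω) (M.block 0 ω') ∂P ∂P := by
  have hm : Measurable fun ω => (M.hist i ω, M.block i ω) :=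
    (M.measurable_hist i).prodMk (M.measurable_block i)
  have hG' : Integrable (fun p : List (List 𝒳) × List 𝒳 => G p.1 p.2)
      (P.map fun ω => (M.hist i ω, M.block i ω)) :=
    (integrable_map_measure Measurable.of_discrete.aestronglyMeasurable hm.aemeasurable).2 hG
  have h1 := integral_map (μ := P) hm.aemeasurable
    (f := fun p : List (List 𝒳) × List 𝒳 => G p.1 p.2) hG'.1
  have : IsProbabilityMeasure (P.map (M.block 0)) :=
    Measure.isProbabilityMeasure_map (M.measurable_block 0).aemeasurable
  rw [← h1]
  rw [M.map_hist_block i] at hG' ⊢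
  have : IsProbabilityMeasure (P.map (M.hist i)) :=
    Measure.isProbabilityMeasure_map (M.measurable_hist i).aemeasurable
  rw [integral_prod _ hG', integral_map (M.measurable_hist i).aemeasurable
    Measurable.of_discrete.aestronglyMeasurable]
  refine integral_congr_ae (Eventually.of_forall fun ω => ?_)
  exact integral_map (M.measurable_block 0).aemeasurable
    Measurable.of_discrete.aestronglyMeasurable

end Model
end AgeDistortion

namespace AgeDistortion
namespace Model

variable {Ω : Type*} [MeasurableSpace Ω] {P : Measure Ω} {𝒳 : Type*} [MeasurableSpace 𝒳]
variable (M : Model P 𝒳)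

/-! ### Importance values and words -/

/-- A word over the set of importance values (of any length, possibly empty). -/
def IsWord (u : List ℝ) : Prop := ∀ w ∈ u, w ∈ Set.range M.v

theorem v_nonneg (x : 𝒳) : 0 ≤ M.v x := M.d_nonneg _ _

theorem V_nonneg (t : ℕ) (ω : Ω) : 0 ≤ M.V t ω := M.v_nonneg _

theorem isWord_nil : M.IsWord [] := by simp [IsWord]

variable {M} in
theorem IsWord.append {u w : List ℝ} (hu : M.IsWord u) (hw : M.IsWord w) : M.IsWord (u ++ w) := by
  intro x hx
  rcases List.mem_append.1 hx with h | h
  exacts [hu x h, hw x h]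

variable {M} in
theorem IsWord.drop {u : List ℝ} (hu : M.IsWord u) (n : ℕ) : M.IsWord (u.drop n) :=
  fun x hx => hu x (List.mem_of_mem_drop hx)

variable {M} in
theorem IsWord.take {u : List ℝ} (hu : M.IsWord u) (n : ℕ) : M.IsWord (u.take n) :=
  fun x hx => hu x (List.mem_of_mem_take hx)

theorem isWord_segment (a b : ℕ) (ω : Ω) : M.IsWord (M.segment a b ω) := by
  intro x hx
  obtain ⟨t, _, rfl⟩ := List.mem_map.1 hx
  exact ⟨_, rfl⟩

theorem isWord_map_v (l : List 𝒳) : M.IsWord (l.map M.v) := by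
  intro x hx
  obtain ⟨t, _, rfl⟩ := List.mem_map.1 hx
  exact ⟨_, rfl⟩

theorem length_segment (a b : ℕ) (ω : Ω) : (M.segment a b ω).length = b + 1 - a := by
  simp [segment]

theorem map_block (i : ℕ) (ω : Ω) :
    (M.block i ω).map M.v = M.segment (M.T i ω + 1) (M.T (i + 1) ω) ω := by
  simp [block, segment, V, T_succ, Function.comp_def]

theorem segment_append (a b c : ℕ) (ω : Ω) (h1 : a ≤ b + 1) (h2 : b ≤ c) :
    M.segment a c ω = M.segment a b ω ++ M.segment (b + 1) c ω := by
  simp only [segment, ← List.map_append]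
  congr 1
  rw [show b + 1 = a + 1 * (b + 1 - a) by omega, show a + 1 * (b + 1 - a) - a = b + 1 - a by omega,
    List.range'_append]
  congr 1
  omega

theorem segment_drop (a b n : ℕ) (ω : Ω) :
    (M.segment a b ω).drop n = M.segment (a + n) b ω := by
  simp only [segment, ← List.map_drop, List.drop_range']
  simp only [mul_one]
  congr 2
  omega

section Finite

variable [Finite 𝒳]

theorem vMin_le (x : 𝒳) : M.vMin ≤ M.v x := ciInf_le (Set.finite_range _).bddBelow x

theorem le_vMax (x : 𝒳) : M.v x ≤ M.vMax := le_ciSup (Set.finite_range _).bddAbove x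

theorem exists_v_eq_vMin : ∃ x, M.v x = M.vMin := by
  obtain ⟨x, -, -⟩ := M.nontrivial_values
  have : Nonempty 𝒳 := ⟨x⟩
  exact exists_eq_ciInf_of_finite

theorem vMin_nonneg : 0 ≤ M.vMin := by
  obtain ⟨x, hx⟩ := M.exists_v_eq_vMin
  exact hx ▸ M.v_nonneg x

theorem vMin_lt_vMax : M.vMin < M.vMax := by
  obtain ⟨x, y, h⟩ := M.nontrivial_values
  rcases lt_or_gt_of_ne h with h | h
  · exact (M.vMin_le x).trans_lt (lt_of_lt_of_le h (M.le_vMax y))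
  · exact (M.vMin_le y).trans_lt (lt_of_lt_of_le h (M.le_vMax x))

theorem vMax_nonneg : 0 ≤ M.vMax := M.vMin_nonneg.trans M.vMin_lt_vMax.le

variable {M} in
theorem IsWord.le_vMax {u : List ℝ} (hu : M.IsWord u) {x : ℝ} (hx : x ∈ u) : x ≤ M.vMax := by
  obtain ⟨y, rfl⟩ := hu x hx
  exact M.le_vMax y

variable {M} in
theorem IsWord.vMin_le {u : List ℝ} (hu : M.IsWord u) {x : ℝ} (hx : x ∈ u) : M.vMin ≤ x := by
  obtain ⟨y, rfl⟩ := hu x hx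
  exact M.vMin_le y

variable {M} in
theorem IsWord.nonneg {u : List ℝ} (hu : M.IsWord u) {x : ℝ} (hx : x ∈ u) : 0 ≤ x :=
  M.vMin_nonneg.trans (hu.vMin_le hx)

variable {M} in
theorem IsWord.sum_nonneg {u : List ℝ} (hu : M.IsWord u) : 0 ≤ u.sum :=
  List.sum_nonneg fun _ hx => hu.nonneg hx

variable {M} in
theorem IsWord.sum_le {u : List ℝ} (hu : M.IsWord u) : u.sum ≤ M.vMax * u.length := by
  have := List.sum_le_card_nsmul u M.vMax fun x hx => hu.le_vMax hx
  rw [nsmul_eq_mul] at this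
  linarith

theorem isWord_replicate_vMin (n : ℕ) : M.IsWord (List.replicate n M.vMin) := by
  intro x hx
  rw [List.eq_of_mem_replicate hx]
  exact M.exists_v_eq_vMin

end Finite

/-! ### Speaking times -/

section Times

variable [IsProbabilityMeasure P]

theorem memLp_Z (i : ℕ) : MemLp (fun ω => (M.Z (i + 1) ω : ℝ)) 2 P := by
  have h := (M.ident_Z (i + 1) (by omega)).comp (u := fun n : ℕ => (n : ℝ)) Measurable.of_discrete
  exact (h.memLp_iff (p := 2)).2 M.Z_sq

theorem integrable_Z (i : ℕ) : Integrable (fun ω => (M.Z (i + 1) ω : ℝ)) P :=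
  (M.memLp_Z i).integrable (by norm_num)

theorem integral_Z (i : ℕ) : ∫ ω, (M.Z (i + 1) ω : ℝ) ∂P = M.mu :=
  ((M.ident_Z (i + 1) (by omega)).comp (u := fun n : ℕ => (n : ℝ))
    Measurable.of_discrete).integral_eq

theorem ae_Z_pos : ∀ᵐ ω ∂P, ∀ i, 0 < M.Z (i + 1) ω := by
  rw [ae_all_iff]
  intro i
  exact ((M.ident_Z (i + 1) (by omega)).symm).ae_mem_snd (t := {n | 0 < n})
    (MeasurableSet.of_discrete) M.Z_pos

theorem one_le_mu : 1 ≤ M.mu := by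
  have : ∫ _, (1 : ℝ) ∂P ≤ M.mu := by
    refine integral_mono_ae (integrable_const _) (M.integrable_Z 0) ?_
    filter_upwards [M.ae_Z_pos] with ω h
    exact_mod_cast h 0
  simpa using this

theorem mu_pos : 0 < M.mu := zero_lt_one.trans_le M.one_le_mu

theorem integrable_T (i : ℕ) : Integrable (fun ω => (M.T i ω : ℝ)) P := by
  induction i with
  | zero => simp [T_zero]
  | succ i ih =>
    simp only [T_succ, Nat.cast_add]
    exact ih.add (M.integrable_Z i)

theorem le_T (ω : Ω) (h : ∀ i, 0 < M.Z (i + 1) ω) (n : ℕ) : n ≤ M.T n ω := by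
  induction n with
  | zero => simp
  | succ n ih =>
    have := h n
    rw [T_succ]
    omega

variable [Finite 𝒳]

theorem bufferSize_pos {η : ℝ} (hη : 0 < η) : 0 < M.bufferSize η := by
  have h1 := M.mu_pos
  have h2 := M.vMin_lt_vMax
  exact Nat.ceil_pos.2 (mul_pos (by positivity) (div_pos (by linarith) hη))

theorem le_bufferSize {η : ℝ} (hη : 0 < η) :
    (M.vMax - M.vMin) / M.mu ≤ η * M.bufferSize η := by
  have h := Nat.le_ceil ((1 / M.mu) * ((M.vMax - M.vMin) / η))
  have h1 := M.mu_pos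
  have := mul_le_mul_of_nonneg_left h hη.le
  calc _ = η * ((1 / M.mu) * ((M.vMax - M.vMin) / η)) := by field_simp
    _ ≤ _ := this

end Times

/-! ### Expectation over a fresh block -/

/-- The expectation of a function of the word `[V_1, …, V_Z]`. -/
def blockMean (φ : List ℝ → ℝ) : ℝ := ∫ ω, φ (M.segment 1 (M.Z 1 ω) ω) ∂P

/-- Linear growth in the length of the word, with constant `C`. -/
def Growth (C : ℝ) (φ : List ℝ → ℝ) : Prop := ∀ u, M.IsWord u → |φ u| ≤ C * (1 + u.length)

theorem segment_one_Z (ω : Ω) : M.segment 1 (M.Z 1 ω) ω = (M.block 0 ω).map M.v := by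
  rw [map_block]
  simp [T_zero, T_succ]

theorem length_segment_one_Z (ω : Ω) : (M.segment 1 (M.Z 1 ω) ω).length = M.Z 1 ω := by
  simp [segment]

variable {M}

theorem Growth.nonneg {C : ℝ} {φ : List ℝ → ℝ} (h : M.Growth C φ) : 0 ≤ C := by
  have := h [] M.isWord_nil
  simp at this
  exact (abs_nonneg _).trans this

theorem Growth.append {C : ℝ} {φ : List ℝ → ℝ} (h : M.Growth C φ) {c : List ℝ}
    (hc : M.IsWord c) : M.Growth (C * (1 + c.length)) fun w => φ (c ++ w) := by
  intro u hu
  refine (h _ (hc.append hu)).trans ?_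
  rw [mul_assoc]
  refine mul_le_mul_of_nonneg_left ?_ h.nonneg
  rw [List.length_append]
  push_cast
  nlinarith [mul_nonneg (Nat.cast_nonneg (α := ℝ) c.length) (Nat.cast_nonneg (α := ℝ) u.length)]

theorem Growth.mono {C D : ℝ} {φ : List ℝ → ℝ} (h : M.Growth C φ) (hCD : C ≤ D) :
    M.Growth D φ := fun u hu => (h u hu).trans (by gcongr)

theorem Growth.add {C D : ℝ} {φ ψ : List ℝ → ℝ} (h : M.Growth C φ) (h' : M.Growth D ψ) :
    M.Growth (C + D) fun w => φ w + ψ w := by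
  intro u hu
  rw [add_mul]
  exact (abs_add_le _ _).trans (add_le_add (h u hu) (h' u hu))

theorem Growth.const_mul {C : ℝ} {φ : List ℝ → ℝ} (h : M.Growth C φ) (a : ℝ) :
    M.Growth (|a| * C) fun w => a * φ w := by
  intro u hu
  rw [abs_mul, mul_assoc]
  exact mul_le_mul_of_nonneg_left (h u hu) (abs_nonneg _)

theorem Growth.of_bounded {C : ℝ} {φ : List ℝ → ℝ} (h : ∀ u, M.IsWord u → |φ u| ≤ C) :
    M.Growth C φ := by
  intro u hu
  have h1 := h u hu
  have := (abs_nonneg _).trans h1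
  nlinarith [mul_nonneg this (Nat.cast_nonneg (α := ℝ) u.length)]

variable [IsProbabilityMeasure P] [Finite 𝒳] [MeasurableSingletonClass 𝒳]

theorem Growth.integrable {C : ℝ} {φ : List ℝ → ℝ} (h : M.Growth C φ) :
    Integrable (fun ω => φ (M.segment 1 (M.Z 1 ω) ω)) P := by
  have hi : Integrable (fun ω => C * (1 + (M.Z 1 ω : ℝ))) P :=
    ((integrable_const _).add (M.integrable_Z 0)).const_mul _
  refine hi.mono' ?_ (Eventually.of_forall fun ω => ?_)
  · simp only [segment_one_Z]
    exact ((Measurable.of_discrete (f := fun l : List 𝒳 => φ (l.map M.v))).comp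
      (M.measurable_block 0)).aestronglyMeasurable
  · have := h _ (M.isWord_segment 1 (M.Z 1 ω) ω)
    rwa [length_segment_one_Z] at this

theorem blockMean_mono {C D : ℝ} {φ ψ : List ℝ → ℝ} (hφ : M.Growth C φ) (hψ : M.Growth D ψ)
    (h : ∀ w, M.IsWord w → w ≠ [] → φ w ≤ ψ w) : M.blockMean φ ≤ M.blockMean ψ := by
  refine integral_mono_ae hφ.integrable hψ.integrable ?_
  filter_upwards [M.ae_Z_pos] with ω hω
  refine h _ (M.isWord_segment _ _ _) fun h0 => ?_
  have := congrArg List.length h0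
  rw [length_segment_one_Z] at this
  have := hω 0
  simp at *
  omega

theorem blockMean_congr {φ ψ : List ℝ → ℝ} (h : ∀ w, M.IsWord w → w ≠ [] → φ w = ψ w) :
    M.blockMean φ = M.blockMean ψ := by
  refine integral_congr_ae ?_
  filter_upwards [M.ae_Z_pos] with ω hω
  refine h _ (M.isWord_segment _ _ _) fun h0 => ?_
  have := congrArg List.length h0
  rw [length_segment_one_Z] at this
  have := hω 0
  simp at *
  omega

theorem blockMean_add {C D : ℝ} {φ ψ : List ℝ → ℝ} (hφ : M.Growth C φ) (hψ : M.Growth D ψ) :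
    M.blockMean (fun w => φ w + ψ w) = M.blockMean φ + M.blockMean ψ :=
  integral_add hφ.integrable hψ.integrable

theorem blockMean_const_mul (a : ℝ) (φ : List ℝ → ℝ) :
    M.blockMean (fun w => a * φ w) = a * M.blockMean φ := integral_const_mul _ _

theorem blockMean_const_add {C : ℝ} {φ : List ℝ → ℝ} (hφ : M.Growth C φ) (a : ℝ) :
    M.blockMean (fun w => a + φ w) = a + M.blockMean φ := by
  rw [blockMean, integral_add (integrable_const _) hφ.integrable]
  simp [blockMean]

theorem blockMean_sub {C D : ℝ} {φ ψ : List ℝ → ℝ} (hφ : M.Growth C φ) (hψ : M.Growth D ψ) :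
    M.blockMean (fun w => φ w - ψ w) = M.blockMean φ - M.blockMean ψ :=
  integral_sub hφ.integrable hψ.integrable

theorem abs_blockMean_le {C : ℝ} {φ : List ℝ → ℝ} (hφ : M.Growth C φ) :
    |M.blockMean φ| ≤ C * (1 + M.mu) := by
  refine (abs_integral_le_integral_abs).trans ?_
  have : ∫ ω, C * (1 + (M.Z 1 ω : ℝ)) ∂P = C * (1 + M.mu) := by
    rw [integral_const_mul, integral_add (integrable_const _) (M.integrable_Z 0)]
    simp [mu]
  rw [← this]
  refine integral_mono hφ.integrable.abs
    (((integrable_const _).add (M.integrable_Z 0)).const_mul _) fun ω => ?_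
  have := hφ _ (M.isWord_segment 1 (M.Z 1 ω) ω)
  rwa [length_segment_one_Z] at this

theorem abs_blockMean_append_le {C : ℝ} {φ : List ℝ → ℝ} (hφ : M.Growth C φ) {c : List ℝ}
    (hc : M.IsWord c) : |M.blockMean fun w => φ (c ++ w)| ≤ C * (1 + c.length + M.mu) := by
  have hi : ∀ ω, |φ (c ++ M.segment 1 (M.Z 1 ω) ω)| ≤ C * (1 + c.length + (M.Z 1 ω : ℝ)) := by
    intro ω
    have := hφ _ (hc.append (M.isWord_segment 1 (M.Z 1 ω) ω))
    rwa [List.length_append, length_segment_one_Z, Nat.cast_add, ← add_assoc] at this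
  have hI : Integrable (fun ω => C * (1 + c.length + (M.Z 1 ω : ℝ))) P :=
    ((integrable_const _).add (M.integrable_Z 0)).const_mul _
  refine (abs_integral_le_integral_abs).trans ?_
  have : ∫ ω, C * (1 + c.length + (M.Z 1 ω : ℝ)) ∂P = C * (1 + c.length + M.mu) := by
    rw [integral_const_mul, integral_add (integrable_const _) (M.integrable_Z 0)]
    simp [mu]
  rw [← this]
  exact integral_mono (hφ.append hc).integrable.abs hI hi

end Model
end AgeDistortion

namespace AgeDistortion
namespace Model

variable {Ω : Type*} [MeasurableSpace Ω] {P : Measure Ω} {𝒳 : Type*} [MeasurableSpace 𝒳]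
variable (M : Model P 𝒳)

/-! ### The finite Markov decision problem -/

/-- The buffer of size `K`: the last `K` entries of a word. -/
def cut (K : ℕ) (u : List ℝ) : List ℝ := u.drop (u.length - K)

/-- The sum of the entries that the buffer of size `K` forgets. -/
def lost (K : ℕ) (u : List ℝ) : ℝ := (u.take (u.length - K)).sum

/-- The extension of a function of the buffer to untruncated words: forgotten entries are charged
`α` times their importance. -/
def extend (α : ℝ) (K : ℕ) (h : List ℝ → ℝ) (u : List ℝ) : ℝ := α * lost K u + h (cut K u)

/-- The one-step cost of action `s` in state `b`, with weight `α` for the importance of skipped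
packets and weight `β` for the age. The policy iteration uses `α = 1 / μ` and `β = η`; the weights
`(1, 0)` and `(0, 1)` separate the two costs of a policy. -/
def stepCost (α β : ℝ) (K : ℕ) (h : List ℝ → ℝ) (b : List ℝ) (s : ℕ) : ℝ :=
  α * (b.take (s - 1)).sum + β * ((b.length : ℝ) - s) +
    M.blockMean fun w => extend α K h (b.drop s ++ w)

theorem stepValue_eq (η : ℝ) (K : ℕ) (h : List ℝ → ℝ) (b : List ℝ) (s : ℕ) :
    M.stepValue η K h b s = M.stepCost (1 / M.mu) η K h b s := rfl

theorem length_cut (K : ℕ) (u : List ℝ) : (cut K u).length = min K u.length := by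
  simp only [cut, List.length_drop]
  omega

theorem lost_append_cut (K : ℕ) (u : List ℝ) : u.take (u.length - K) ++ cut K u = u :=
  List.take_append_drop _ _

variable {M} in
theorem IsWord.cut {u : List ℝ} (hu : M.IsWord u) (K : ℕ) : M.IsWord (cut K u) := hu.drop _

variable {M} in
theorem IsWord.isState_cut {u : List ℝ} (hu : M.IsWord u) (h0 : u ≠ []) {K : ℕ} (hK : 0 < K) :
    M.IsState K (Model.cut K u) := by
  have := List.length_pos_iff.2 h0
  refine ⟨fun h => ?_, ?_, hu.cut K⟩
  · have := congrArg List.length h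
    rw [length_cut, List.length_nil] at this
    omega
  · rw [length_cut]
    exact min_le_left _ _

variable {M} in
theorem IsState.isWord {K : ℕ} {b : List ℝ} (hb : M.IsState K b) : M.IsWord b := hb.2.2

section Finite

variable [Finite 𝒳]

theorem finite_words (K : ℕ) : {u | M.IsWord u ∧ u.length ≤ K}.Finite := by
  refine ((List.finite_length_le 𝒳 K).image (List.map M.v)).subset ?_
  rintro u ⟨hu, hl⟩
  choose f hf using hu
  refine ⟨u.attach.map fun x => f x.1 x.2, by simpa using hl, ?_⟩
  rw [List.map_map]
  conv_rhs => rw [← List.attach_map_subtype_val u]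
  exact List.map_congr_left fun x _ => hf x.1 x.2

theorem finite_states (K : ℕ) : {b | M.IsState K b}.Finite :=
  (M.finite_words K).subset fun _ hb => ⟨hb.isWord, hb.2.1⟩

theorem exists_bound (K : ℕ) (h : List ℝ → ℝ) :
    ∃ C, ∀ u, M.IsWord u → u.length ≤ K → |h u| ≤ C := by
  obtain ⟨C, hC⟩ := ((M.finite_words K).image fun u => |h u|).bddAbove
  exact ⟨C, fun u hu hl => hC ⟨u, ⟨hu, hl⟩, rfl⟩⟩

theorem exists_bound_cut (K : ℕ) (h : List ℝ → ℝ) :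
    ∃ C, ∀ u, M.IsWord u → |h (cut K u)| ≤ C := by
  obtain ⟨C, hC⟩ := M.exists_bound K h
  exact ⟨C, fun u hu => hC _ (hu.cut K) (by rw [length_cut]; exact min_le_left _ _)⟩

theorem exists_growth_cut (K : ℕ) (h : List ℝ → ℝ) : ∃ C, M.Growth C fun u => h (cut K u) := by
  obtain ⟨C, hC⟩ := M.exists_bound_cut K h
  exact ⟨C, Growth.of_bounded hC⟩

variable {M} in
theorem IsWord.lost_nonneg {u : List ℝ} (hu : M.IsWord u) (K : ℕ) : 0 ≤ lost K u :=
  (hu.take _).sum_nonneg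

theorem growth_lost (K : ℕ) : M.Growth M.vMax (lost K) := by
  intro u hu
  rw [abs_of_nonneg (hu.lost_nonneg K)]
  refine (hu.take _).sum_le.trans (mul_le_mul_of_nonneg_left ?_ M.vMax_nonneg)
  have : (u.take (u.length - K)).length ≤ u.length := by simp
  have : ((u.take (u.length - K)).length : ℝ) ≤ u.length := by exact_mod_cast this
  linarith

theorem exists_growth_extend (α : ℝ) (K : ℕ) (h : List ℝ → ℝ) :
    ∃ C, M.Growth C (extend α K h) := by
  obtain ⟨C, hC⟩ := M.exists_growth_cut K h
  exact ⟨_, ((M.growth_lost K).const_mul α).add hC⟩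

theorem isState_vMin {K : ℕ} (hK : 0 < K) : M.IsState K [M.vMin] :=
  ⟨by simp, by simpa using Nat.succ_le_of_lt hK, M.isWord_replicate_vMin 1⟩

/-- Under every policy, a long enough run of identical blocks of packets of minimal importance leads
from every state to one and the same state: a policy either clears the buffer or removes a packet
of larger importance. -/
theorem reach_reference {K : ℕ} (hK : 0 < K) {s : List ℝ → ℕ} (hs : M.IsPolicy K s) {z : ℕ}
    {A : List ℝ → Prop}
    (hA : ∀ b, M.IsState K b → A b → A (cut K (b.drop (s b) ++ List.replicate z M.vMin)))
    (b : List ℝ) (hb : M.IsState K b) (h : A b) : A (cut K (List.replicate z M.vMin)) := by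
  classical
  induction hn : b.countP (fun x => x ≠ M.vMin) using Nat.strong_induction_on generalizing b with
  | _ n ih =>
  obtain ⟨h1, h2, h3⟩ := hs b hb
  have hA' := hA b hb h
  rcases h2.eq_or_lt with h2 | h2
  · rwa [h2, List.drop_length, List.nil_append] at hA'
  · have hw : M.IsWord (b.drop (s b) ++ List.replicate z M.vMin) :=
      (hb.isWord.drop _).append (M.isWord_replicate_vMin z)
    refine ih _ ?_ _ (hw.isState_cut (by simp; omega) hK) hA' rfl
    have e1 : (cut K (b.drop (s b) ++ List.replicate z M.vMin)).countP (fun x => x ≠ M.vMin) ≤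
        (b.drop (s b)).countP (fun x => x ≠ M.vMin) := by
      refine (List.Sublist.countP_le (List.drop_sublist _ _)).trans ?_
      rw [List.countP_append, List.countP_replicate]
      simp
    have e2 : (b.drop (s b - 1)).countP (fun x => x ≠ M.vMin) =
        (b.drop (s b)).countP (fun x => x ≠ M.vMin) + 1 := by
      have hlt : s b - 1 < b.length := by omega
      rw [List.drop_eq_getElem_cons hlt, List.countP_cons_of_pos, Nat.sub_add_cancel h1]
      have := h3 h2
      rw [List.getElem?_eq_getElem hlt] at this
      simpa using fun h => this (congrArg some h)
    have e3 := List.Sublist.countP_le (p := fun x => decide (x ≠ M.vMin))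
      (List.drop_sublist (s b - 1) b)
    omega

variable [MeasurableSingletonClass 𝒳] [IsProbabilityMeasure P]

/-- Some block of packets of minimal importance has positive probability. -/
theorem exists_vMin_block : ∃ z, 0 < z ∧
    0 < P {ω | M.segment 1 (M.Z 1 ω) ω = List.replicate z M.vMin} := by
  obtain ⟨z, hz, hz'⟩ : ∃ z, 0 < z ∧ 0 < P {ω | M.Z 1 ω = z} := by
    by_contra! hcon
    have : ∀ᵐ ω ∂P, ∀ z, 0 < z → M.Z 1 ω ≠ z := by
      rw [ae_all_iff]
      intro z
      by_cases hz : 0 < z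
      · have := le_zero_iff.1 (hcon z hz)
        filter_upwards [measure_eq_zero_iff_ae_notMem.1 this] with ω h _ h'
        exact h h'
      · exact Eventually.of_forall fun _ h => absurd h hz
    obtain ⟨ω, h1, h2⟩ := (this.and M.Z_pos).exists
    exact h1 _ h2 rfl
  obtain ⟨x, hx, hx'⟩ : ∃ x, M.v x = M.vMin ∧ 0 < P {ω | M.X 1 ω = x} := by
    by_contra! hcon
    obtain ⟨x0, hx0⟩ := M.exists_v_eq_vMin
    have : ∀ᵐ ω ∂P, ∀ x, M.v x = M.vMin → M.X 1 ω ≠ x := by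
      rw [ae_all_iff]
      intro x
      by_cases hx : M.v x = M.vMin
      · have := le_zero_iff.1 (hcon x hx)
        filter_upwards [measure_eq_zero_iff_ae_notMem.1 this] with ω h _ h'
        exact h h'
      · exact Eventually.of_forall fun _ h => absurd h hx
    have h0 : P {ω | M.d (M.X 1 ω) none = M.d x0 none} = 0 := by
      rw [measure_eq_zero_iff_ae_notMem]
      filter_upwards [this] with ω h h'
      exact h _ (Eq.trans h' hx0) rfl
    exact (M.value_pos x0).ne' h0
  refine ⟨z, hz, ?_⟩
  have h1 : 0 < P.map (M.block 0) {List.replicate z x} := by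
    rw [map_block_zero_singleton, blockProb]
    simp only [List.length_replicate, List.map_replicate, List.prod_replicate]
    exact ENNReal.mul_pos hz'.ne' (pow_ne_zero _ hx'.ne')
  rw [Measure.map_apply (M.measurable_block 0) (measurableSet_singleton _)] at h1
  refine h1.trans_le (measure_mono fun ω hω => ?_)
  have : M.block 0 ω = List.replicate z x := hω
  simp [segment_one_Z, this, hx]

/-- A comparison principle for the chain of a policy `s`: if `g + δ` dominates the expectation of
`g` at the next state, then `δ ≥ 0`; and if `δ = 0`, then `g` is minimal at a reference state that
does not depend on `g` or `s`. -/
theorem exists_reference {K : ℕ} (hK : 0 < K) : ∃ b₀, M.IsState K b₀ ∧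
    ∀ s, M.IsPolicy K s → ∀ (g : List ℝ → ℝ) (δ : ℝ),
      (∀ b, M.IsState K b → (M.blockMean fun w => g (cut K (b.drop (s b) ++ w))) ≤ g b + δ) →
      0 ≤ δ ∧ (δ = 0 → ∀ b, M.IsState K b → g b₀ ≤ g b) := by
  obtain ⟨z, hz, hpos⟩ := M.exists_vMin_block
  refine ⟨cut K (List.replicate z M.vMin),
    (M.isWord_replicate_vMin z).isState_cut (by simp; omega) hK, fun s hs g δ hg => ?_⟩
  obtain ⟨b₁, hb₁, hmin⟩ :=
    Set.exists_min_image _ g (M.finite_states K) ⟨_, M.isState_vMin hK⟩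
  obtain ⟨C, hC⟩ := M.exists_growth_cut K g
  have hgr : ∀ b, M.IsState K b →
      M.Growth (C * (1 + (b.drop (s b)).length)) fun w => g (cut K (b.drop (s b) ++ w)) :=
    fun b hb => hC.append (hb.isWord.drop _)
  have hnext : ∀ b, M.IsState K b → ∀ w, M.IsWord w → w ≠ [] →
      M.IsState K (cut K (b.drop (s b) ++ w)) := fun b hb w hw h0 =>
    ((hb.isWord.drop _).append hw).isState_cut (by simp [h0]) hK
  have hconst : M.blockMean (fun _ => g b₁) = g b₁ := by simp [blockMean]
  have hle : ∀ b, M.IsState K b → g b₁ ≤ M.blockMean fun w => g (cut K (b.drop (s b) ++ w)) := by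
    intro b hb
    rw [← hconst]
    exact blockMean_mono (Growth.of_bounded (C := |g b₁|) fun _ _ => le_rfl) (hgr b hb)
      fun w hw h0 => hmin _ (hnext b hb w hw h0)
  refine ⟨by linarith [hle b₁ hb₁, hg b₁ hb₁], fun hδ => ?_⟩
  subst hδ
  suffices h : g (cut K (List.replicate z M.vMin)) = g b₁ by
    intro b hb
    rw [h]
    exact hmin b hb
  refine M.reach_reference hK hs (A := fun b => g b = g b₁) (fun b hb hbA => ?_) b₁ hb₁ rfl
  have h0 : (fun ω => g (cut K (b.drop (s b) ++ M.segment 1 (M.Z 1 ω) ω)) - g b₁) =ᵐ[P] 0 := by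
    rw [← integral_eq_zero_iff_of_nonneg_ae]
    · rw [integral_sub (hgr b hb).integrable (integrable_const _)]
      have h1 := hle b hb
      have h2 := hg b hb
      rw [hbA, add_zero] at h2
      have h3 := le_antisymm h2 h1
      rw [blockMean] at h3
      simpa [sub_eq_zero] using h3
    · filter_upwards [M.ae_Z_pos] with ω hω
      refine sub_nonneg.2 (hmin _ (hnext b hb _ (M.isWord_segment _ _ _) fun h0 => ?_))
      have h3 := congrArg List.length h0
      rw [length_segment_one_Z] at h3
      have := hω 0
      simp at *
      omega
    · exact (hgr b hb).integrable.sub (integrable_const _)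
  by_contra hne
  refine hpos.ne' (measure_eq_zero_iff_ae_notMem.2 ?_)
  filter_upwards [h0] with ω h1 h2
  have h2' : M.segment 1 (M.Z 1 ω) ω = List.replicate z M.vMin := h2
  simp only [h2', Pi.zero_apply, sub_eq_zero] at h1
  exact hne h1

/-- Step costs for two functions of the buffer differ by the expectation of the difference of the
functions at the next state, so that comparisons reduce to the chain of the policy. -/
theorem stepCost_sub (α β : ℝ) {K : ℕ} (h h' : List ℝ → ℝ) {b : List ℝ} (hb : M.IsWord b)
    (s : ℕ) : M.stepCost α β K h b s - M.stepCost α β K h' b s =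
      M.blockMean fun w => (fun u => h u - h' u) (cut K (b.drop s ++ w)) := by
  obtain ⟨C, hC⟩ := M.exists_growth_extend α K h
  obtain ⟨D, hD⟩ := M.exists_growth_extend α K h'
  rw [stepCost, stepCost, add_sub_add_left_eq_sub,
    ← blockMean_sub (hC.append (hb.drop s)) (hD.append (hb.drop s))]
  simp [extend]

/-- The difference of two solutions of a policy evaluation vanishes. -/
theorem evaluation_unique (α β : ℝ) {K : ℕ} (hK : 0 < K) {s : List ℝ → ℕ} (hs : M.IsPolicy K s)
    {h h' : List ℝ → ℝ} {lam lam' : ℝ} (h0 : h [M.vMin] = h' [M.vMin])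
    (he : ∀ b, M.IsState K b → h b + lam = M.stepCost α β K h b (s b))
    (he' : ∀ b, M.IsState K b → h' b + lam' = M.stepCost α β K h' b (s b)) :
    lam = lam' ∧ ∀ b, M.IsState K b → h b = h' b := by
  obtain ⟨b₀, hb₀, href⟩ := M.exists_reference hK
  have h1 := href s hs (fun b => h b - h' b) (lam - lam') fun b hb => by
    have := M.stepCost_sub α β (K := K) h h' hb.isWord (s b)
    simp only at this
    rw [← this, ← he b hb, ← he' b hb]
    linarith
  have h2 := href s hs (fun b => h' b - h b) (lam' - lam) fun b hb => by
    have := M.stepCost_sub α β (K := K) h' h hb.isWord (s b)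
    simp only at this
    rw [← this, ← he b hb, ← he' b hb]
    linarith
  have hl : lam = lam' := by linarith [h1.1, h2.1]
  refine ⟨hl, fun b hb => ?_⟩
  have hv := M.isState_vMin hK
  have a1 := h1.2 (by linarith) b hb
  have a2 := h2.2 (by linarith) b hb
  have a3 := h1.2 (by linarith) _ hv
  have a4 := h2.2 (by linarith) _ hv
  linarith

/-- Existence of a solution of the policy evaluation, for arbitrary one-step costs `κ`: the system
is square and its homogeneous version has only the trivial solution. -/
theorem exists_poisson {K : ℕ} (hK : 0 < K) {s : List ℝ → ℕ} (hs : M.IsPolicy K s)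
    (κ : List ℝ → ℝ) : ∃ (h : List ℝ → ℝ) (lam : ℝ), h [M.vMin] = 0 ∧ ∀ b, M.IsState K b →
      h b + lam = κ b + M.blockMean fun w => h (cut K (b.drop (s b) ++ w)) := by
  classical
  let St := {b // M.IsState K b}
  have : Finite St := M.finite_states K
  let e : (St → ℝ) → List ℝ → ℝ := fun h b => if hb : M.IsState K b then h ⟨b, hb⟩ else 0
  have hgr : ∀ (g : St → ℝ) (b : St),
      ∃ C, M.Growth C fun w => e g (cut K (b.1.drop (s b.1) ++ w)) :=
    fun g b => ⟨_, (M.exists_growth_cut K (e g)).choose_spec.append (b.2.isWord.drop _)⟩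
  have e_add : ∀ g g' b, e (g + g') b = e g b + e g' b := by
    intro g g' b
    by_cases hb : M.IsState K b <;> simp [e, hb]
  have e_smul : ∀ (c : ℝ) g b, e (c • g) b = c * e g b := by
    intro c g b
    by_cases hb : M.IsState K b <;> simp [e, hb]
  let v₀ : St := ⟨_, M.isState_vMin hK⟩
  let L : ((St → ℝ) × ℝ) →ₗ[ℝ] ((St → ℝ) × ℝ) :=
    { toFun := fun p => (fun b => p.1 b + p.2 -
        M.blockMean fun w => e p.1 (cut K (b.1.drop (s b.1) ++ w)), p.1 v₀)
      map_add' := by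
        intro p q
        ext b
        · obtain ⟨C, hC⟩ := hgr p.1 b
          obtain ⟨D, hD⟩ := hgr q.1 b
          simp only [Prod.fst_add, Prod.snd_add, Pi.add_apply, e_add, blockMean_add hC hD]
          ring
        · simp
      map_smul' := by
        intro c p
        ext b
        · simp only [Prod.smul_fst, Prod.smul_snd, Pi.smul_apply, smul_eq_mul, e_smul,
            blockMean_const_mul, RingHom.id_apply]
          ring
        · simp }
  have hinj : Function.Injective L := by
    rw [injective_iff_map_eq_zero]
    rintro ⟨g, lam⟩ hp
    have hp1 : ∀ b : St, g b + lam -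
        M.blockMean (fun w => e g (cut K (b.1.drop (s b.1) ++ w))) = 0 :=
      fun b => congrFun (congrArg Prod.fst hp) b
    have hp2 : g v₀ = 0 := congrArg Prod.snd hp
    have := M.evaluation_unique 0 0 hK hs (h := e g) (h' := fun _ => 0) (lam := lam) (lam' := 0)
      (by simpa [e, M.isState_vMin hK] using hp2) (fun b hb => by
        have := hp1 ⟨b, hb⟩
        have e1 : e g b = g ⟨b, hb⟩ := by simp [e, hb]
        simp only [stepCost, extend, zero_mul, zero_add, e1]
        linarith) (fun b _ => by simp [stepCost, extend, blockMean])
    ext b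
    · have := this.2 b.1 b.2
      simpa [e, b.2] using this
    · exact this.1
  obtain ⟨⟨g, lam⟩, hp⟩ := (LinearMap.injective_iff_surjective.1 hinj) (fun b => κ b.1, 0)
  have hp1 : ∀ b : St, g b + lam -
      M.blockMean (fun w => e g (cut K (b.1.drop (s b.1) ++ w))) = κ b.1 :=
    fun b => congrFun (congrArg Prod.fst hp) b
  have hp2 : g v₀ = 0 := congrArg Prod.snd hp
  refine ⟨e g, lam, by simpa [e, M.isState_vMin hK] using hp2, fun b hb => ?_⟩
  have e1 : e g b = g ⟨b, hb⟩ := by simp [e, hb]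
  have := hp1 ⟨b, hb⟩
  rw [e1]
  linarith

/-- Existence of the evaluation of a policy; the penalties of forgotten packets are part of the
one-step costs. -/
theorem exists_evaluation (α β : ℝ) {K : ℕ} (hK : 0 < K) {s : List ℝ → ℕ}
    (hs : M.IsPolicy K s) : ∃ (h : List ℝ → ℝ) (lam : ℝ), h [M.vMin] = 0 ∧
      ∀ b, M.IsState K b → h b + lam = M.stepCost α β K h b (s b) := by
  obtain ⟨h, lam, h0, he⟩ := M.exists_poisson hK hs fun b =>
    α * (b.take (s b - 1)).sum + β * ((b.length : ℝ) - s b) +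
      M.blockMean fun w => α * lost K (b.drop (s b) ++ w)
  refine ⟨h, lam, h0, fun b hb => ?_⟩
  obtain ⟨C, hC⟩ := M.exists_growth_cut K h
  have hw := hb.isWord.drop (s b)
  rw [he b hb, stepCost, add_assoc]
  congr 1
  exact (blockMean_add (((M.growth_lost K).const_mul α).append hw) (hC.append hw)).symm

theorem stepCost_congr (α β : ℝ) {K : ℕ} (hK : 0 < K) {h h' : List ℝ → ℝ}
    (hh : ∀ b, M.IsState K b → h b = h' b) {b : List ℝ} (hb : M.IsWord b) (s : ℕ) :
    M.stepCost α β K h b s = M.stepCost α β K h' b s := by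
  rw [← sub_eq_zero, M.stepCost_sub α β h h' hb]
  rw [blockMean_congr (M := M) (ψ := fun _ => 0)]
  · simp [blockMean]
  · intro w hw h0
    have := hh _ (((hb.drop s).append hw).isState_cut (by simp [h0]) hK)
    simp [this]

end Finite

end Model
end AgeDistortion

namespace AgeDistortion
namespace Model

variable {Ω : Type*} [MeasurableSpace Ω] {P : Measure Ω} {𝒳 : Type*} [MeasurableSpace 𝒳]
variable (M : Model P 𝒳)

/-! ### Policy iteration -/

theorem length_mem_actions {b : List ℝ} (hb : b ≠ []) : b.length ∈ M.actions b :=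
  ⟨List.length_pos_iff.2 hb, le_rfl, fun h => absurd h (lt_irrefl _)⟩

theorem finite_actions (b : List ℝ) : (M.actions b).Finite :=
  (Set.finite_Icc 1 b.length).subset fun _ hs => ⟨hs.1, hs.2.1⟩

theorem exists_minimizer (f : ℕ → ℝ) {b : List ℝ} (hb : b ≠ []) :
    ∃ a ∈ M.actions b, ∀ a' ∈ M.actions b, f a ≤ f a' :=
  Set.exists_min_image _ f (M.finite_actions b) ⟨_, M.length_mem_actions hb⟩

open Classical in
/-- A choice of a minimizer of `f` over the actions in `b`, which depends only on `f` and `b`. -/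
def minimizer (f : ℕ → ℝ) (b : List ℝ) : ℕ :=
  if h : ∃ a ∈ M.actions b, ∀ a' ∈ M.actions b, f a ≤ f a' then h.choose else 0

theorem minimizer_spec (f : ℕ → ℝ) {b : List ℝ} (hb : b ≠ []) :
    M.minimizer f b ∈ M.actions b ∧ ∀ a' ∈ M.actions b, f (M.minimizer f b) ≤ f a' := by
  have h := M.exists_minimizer f hb
  rw [minimizer, dif_pos h]
  exact h.choose_spec

theorem isPolicy_length (K : ℕ) : M.IsPolicy K List.length :=
  fun _ hb => M.length_mem_actions hb.1

variable [Finite 𝒳] [MeasurableSingletonClass 𝒳] [IsProbabilityMeasure P]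

theorem exists_isEvaluation (η : ℝ) {K : ℕ} (hK : 0 < K) {s : List ℝ → ℕ}
    (hs : M.IsPolicy K s) : ∃ h lam, M.IsEvaluation η K s h lam ∧
      ∀ h' lam', M.IsEvaluation η K s h' lam' →
        lam' = lam ∧ ∀ b, M.IsState K b → h' b = h b := by
  obtain ⟨h, lam, h0, he⟩ := M.exists_evaluation (1 / M.mu) η hK hs
  refine ⟨h, lam, ⟨h0, he⟩, fun h' lam' h1 => ?_⟩
  exact M.evaluation_unique _ _ hK hs (h1.1.trans h0.symm) h1.2 he

theorem exists_policyIteration (η : ℝ) {K : ℕ} (hK : 0 < K) :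
    ∃ s h lam, M.IsPolicyIteration η K s h lam ∧ M.ConsistentTies K s h := by
  classical
  let ev : (List ℝ → ℕ) → (List ℝ → ℝ) × ℝ := fun s =>
    if hs : M.IsPolicy K s then
      ((M.exists_isEvaluation η hK hs).choose, (M.exists_isEvaluation η hK hs).choose_spec.choose)
    else (fun _ => 0, 0)
  have hev : ∀ s, M.IsPolicy K s → M.IsEvaluation η K s (ev s).1 (ev s).2 := by
    intro s hs
    simp only [ev, dif_pos hs]
    exact (M.exists_isEvaluation η hK hs).choose_spec.choose_spec.1
  let s : ℕ → List ℝ → ℕ := fun n =>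
    Nat.rec List.length (fun _ t b => M.minimizer (M.stepValue η K (ev t).1 b) b) n
  have hsucc : ∀ n b, s (n + 1) b = M.minimizer (M.stepValue η K (ev (s n)).1 b) b :=
    fun n b => rfl
  have hpol : ∀ n, M.IsPolicy K (s n) := by
    rintro (_ | n)
    · exact M.isPolicy_length K
    · exact fun b hb => (M.minimizer_spec _ hb.1).1
  refine ⟨s, fun n => (ev (s n)).1, fun n => (ev (s n)).2,
    ⟨fun _ _ => rfl, fun n => hev _ (hpol n), fun n b hb => ?_⟩, fun n hn b hb => ?_⟩
  · exact M.minimizer_spec (M.stepValue η K (ev (s n)).1 b) hb.1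
  · rw [hsucc (n + 1), hsucc n]
    congr 1
    ext a
    exact M.stepCost_congr _ _ hK hn hb.isWord a

variable {M} in
theorem IsPolicyIteration.isPolicy {η : ℝ} {K : ℕ} {s : ℕ → List ℝ → ℕ} {h : ℕ → List ℝ → ℝ}
    {lam : ℕ → ℝ} (hpi : M.IsPolicyIteration η K s h lam) (n : ℕ) : M.IsPolicy K (s n) := by
  rcases n with _ | n
  · intro b hb
    rw [hpi.1 b hb]
    exact M.length_mem_actions hb.1
  · exact fun b hb => (hpi.2.2 n b hb).1

/-- One round of policy iteration decreases the pair of the average cost and of the relative values,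
normalized at the reference state, in the lexicographic order. -/
theorem policyIteration_step {η : ℝ} {K : ℕ} (hK : 0 < K) : ∃ b₀, M.IsState K b₀ ∧
    ∀ (s : ℕ → List ℝ → ℕ) (h : ℕ → List ℝ → ℝ) (lam : ℕ → ℝ),
      M.IsPolicyIteration η K s h lam → ∀ n, lam (n + 1) ≤ lam n ∧ (lam (n + 1) = lam n →
        ∀ b, M.IsState K b → h (n + 1) b - h (n + 1) b₀ ≤ h n b - h n b₀) := by
  obtain ⟨b₀, hb₀, href⟩ := M.exists_reference hK
  refine ⟨b₀, hb₀, fun s h lam hpi n => ?_⟩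
  have := href _ (hpi.isPolicy (n + 1)) (fun b => h n b - h (n + 1) b) (lam n - lam (n + 1))
    fun b hb => by
      have e := M.stepCost_sub (1 / M.mu) η (K := K) (h n) (h (n + 1)) hb.isWord (s (n + 1) b)
      simp only at e
      have e1 := (hpi.2.1 (n + 1)).2 b hb
      have e2 := (hpi.2.1 n).2 b hb
      have e3 := (hpi.2.2 n b hb).2 _ (hpi.isPolicy n b hb)
      rw [stepValue_eq] at e1 e2
      rw [stepValue_eq, stepValue_eq] at e3
      linarith
  refine ⟨by linarith [this.1], fun hl b hb => ?_⟩
  linarith [this.2 (by linarith) b hb]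

/-- If a policy recurs, then the average cost is constant in between, so that the relative values
decrease; as they return to their initial values, they are constant as well. -/
theorem policyIteration_stops {η : ℝ} {K : ℕ} (hK : 0 < K) {s : ℕ → List ℝ → ℕ}
    {h : ℕ → List ℝ → ℝ} {lam : ℕ → ℝ} (hpi : M.IsPolicyIteration η K s h lam)
    (hties : M.ConsistentTies K s h) : ∃ n, M.StopsAt K s n := by
  obtain ⟨b₀, hb₀, hstep⟩ := M.policyIteration_step (η := η) hK
  have hst := hstep s h lam hpi
  have hanti : Antitone lam := antitone_nat_of_succ_le fun n => (hst n).1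
  -- there are finitely many policies on the states, so that some policy occurs twice
  have hfin : Finite {b // M.IsState K b} := M.finite_states K
  obtain ⟨m, n, hmn, heq⟩ : ∃ m n, m < n ∧ ∀ b, M.IsState K b → s m b = s n b := by
    let f : ℕ → {b // M.IsState K b} → Fin (K + 1) := fun n b =>
      ⟨s n b.1, by have := (hpi.isPolicy n b.1 b.2).2.1; have := b.2.2.1; omega⟩
    obtain ⟨m, n, hne, hf⟩ := Finite.exists_ne_map_eq_of_infinite f
    have hf' : ∀ b, M.IsState K b → s m b = s n b := fun b hb => by
      have := congrFun hf ⟨b, hb⟩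
      simpa [f] using this
    rcases lt_or_gt_of_ne hne with hlt | hlt
    · exact ⟨m, n, hlt, hf'⟩
    · exact ⟨n, m, hlt, fun b hb => (hf' b hb).symm⟩
  obtain ⟨hl, hh⟩ := M.evaluation_unique (1 / M.mu) η hK (hpi.isPolicy m)
    ((hpi.2.1 m).1.trans (hpi.2.1 n).1.symm) (hpi.2.1 m).2
    (fun b hb => by rw [heq b hb]; exact (hpi.2.1 n).2 b hb)
  have hlam : ∀ k, m ≤ k → k ≤ n → lam k = lam m := fun k h1 h2 =>
    le_antisymm (hanti h1) (hl ▸ hanti h2)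
  have hdec : ∀ k, m ≤ k → k + 1 ≤ n → ∀ b, M.IsState K b →
      h (k + 1) b - h (k + 1) b₀ ≤ h k b - h k b₀ := fun k h1 h2 =>
    (hst k).2 ((hlam (k + 1) (by omega) h2).trans (hlam k h1 (by omega)).symm)
  have hchain : ∀ k, m + 1 ≤ k → k ≤ n → ∀ b, M.IsState K b →
      h k b - h k b₀ ≤ h (m + 1) b - h (m + 1) b₀ := by
    intro k hk
    induction k, hk using Nat.le_induction with
    | base => exact fun _ _ _ => le_rfl
    | succ k hk ih =>
      exact fun h2 b hb => (hdec k (by omega) h2 b hb).trans (ih (by omega) b hb)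
  have heq1 : ∀ b, M.IsState K b → h (m + 1) b - h (m + 1) b₀ = h m b - h m b₀ := by
    intro b hb
    refine le_antisymm (hdec m le_rfl hmn b hb) ?_
    rw [hh b hb, hh b₀ hb₀]
    exact hchain n hmn le_rfl b hb
  refine ⟨m + 1, hties m fun b hb => ?_⟩
  have e1 := heq1 b hb
  have e2 := heq1 _ (M.isState_vMin hK)
  rw [(hpi.2.1 (m + 1)).1, (hpi.2.1 m).1] at e2
  linarith

/-- When policy iteration stops, the relative values solve the optimality equation. -/
theorem optimality_of_stopsAt {η : ℝ} {K : ℕ} {s : ℕ → List ℝ → ℕ} {h : ℕ → List ℝ → ℝ}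
    {lam : ℕ → ℝ} (hpi : M.IsPolicyIteration η K s h lam) {n : ℕ} (hn : M.StopsAt K s n)
    {b : List ℝ} (hb : M.IsState K b) {a : ℕ} (ha : a ∈ M.actions b) :
    h n b + lam n ≤ M.stepCost (1 / M.mu) η K (h n) b a := by
  have h1 := (hpi.2.2 n b hb).2 a ha
  rw [hn b hb, ← (hpi.2.1 n).2 b hb] at h1
  exact h1

end Model
end AgeDistortion

namespace AgeDistortion
namespace Model

variable {Ω : Type*} [MeasurableSpace Ω] {P : Measure Ω} {𝒳 : Type*} [MeasurableSpace 𝒳]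
variable (M : Model P 𝒳)

/-! ### Untruncated words: an old packet is never worth selecting -/

/-- The cost of selecting position `a` of the untruncated word `u` when the continuation costs `F`:
like `stepCost`, but nothing is forgotten. -/
def wordCost (α β : ℝ) (F : List ℝ → ℝ) (u : List ℝ) (a : ℕ) : ℝ :=
  α * (u.take (a - 1)).sum + β * ((u.length : ℝ) - a) + M.blockMean fun w => F (u.drop a ++ w)

/-- The actions in the untruncated word `u` that select one of the last `K` packets. -/
def recent (K : ℕ) (u : List ℝ) : Set ℕ := {a | a ∈ M.actions u ∧ u.length < a + K}

/-- The optimal cost over `n` steps from the word `u` when only the last `K` packets may be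
selected, and all packets that are left at the end are lost. -/
def optValue (η : ℝ) (K : ℕ) : ℕ → List ℝ → ℝ
  | 0, u => 1 / M.mu * u.sum
  | n + 1, u => sInf (M.wordCost (1 / M.mu) η (optValue η K n) u '' M.recent K u)

theorem finite_recent (K : ℕ) (u : List ℝ) : (M.recent K u).Finite :=
  (M.finite_actions u).subset fun _ h => h.1

theorem length_mem_recent {K : ℕ} (hK : 0 < K) {u : List ℝ} (hu : u ≠ []) :
    u.length ∈ M.recent K u := ⟨M.length_mem_actions hu, by omega⟩

theorem optValue_succ_le (η : ℝ) {K : ℕ} (n : ℕ) {u : List ℝ} {a : ℕ} (ha : a ∈ M.recent K u) :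
    M.optValue η K (n + 1) u ≤ M.wordCost (1 / M.mu) η (M.optValue η K n) u a :=
  csInf_le ((M.finite_recent K u).image _).bddBelow ⟨a, ha, rfl⟩

theorem exists_optValue_succ_eq (η : ℝ) {K : ℕ} (hK : 0 < K) (n : ℕ) {u : List ℝ} (hu : u ≠ []) :
    ∃ a ∈ M.recent K u,
      M.wordCost (1 / M.mu) η (M.optValue η K n) u a = M.optValue η K (n + 1) u :=
  (Set.Nonempty.image _ ⟨_, M.length_mem_recent hK hu⟩).csInf_mem ((M.finite_recent K u).image _)

theorem recent_append {K : ℕ} {p c : List ℝ} {a : ℕ} (ha : a ∈ M.recent K c) :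
    p.length + a ∈ M.recent K (p ++ c) := by
  obtain ⟨⟨h1, h2, h3⟩, h4⟩ := ha
  refine ⟨⟨by omega, by simpa using h2, fun h => ?_⟩, by rw [List.length_append]; omega⟩
  rw [List.length_append] at h
  rw [List.getElem?_append_right (by omega), show p.length + a - 1 - p.length = a - 1 by omega]
  exact h3 (by omega)

theorem recent_of_append {K : ℕ} {p c : List ℝ} {a : ℕ} (ha : p.length + a ∈ M.recent K (p ++ c))
    (h1 : 1 ≤ a) : a ∈ M.recent K c := by
  obtain ⟨⟨-, h2, h3⟩, h4⟩ := ha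
  rw [List.length_append] at h2 h3 h4
  refine ⟨⟨h1, by omega, fun h => ?_⟩, by omega⟩
  have := h3 (by omega)
  rwa [List.getElem?_append_right (by omega),
    show p.length + a - 1 - p.length = a - 1 by omega] at this

theorem wordCost_append (α β : ℝ) (F : List ℝ → ℝ) (p c : List ℝ) {a : ℕ} (ha : 1 ≤ a) :
    M.wordCost α β F (p ++ c) (p.length + a) = α * p.sum + M.wordCost α β F c a := by
  rw [wordCost, wordCost, show p.length + a - 1 = p.length + (a - 1) by omega,
    List.take_length_add_append, List.drop_length_add_append, List.sum_append, List.length_append]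
  push_cast
  ring

theorem wordCost_split (α β : ℝ) (F : List ℝ → ℝ) (p c : List ℝ) (y : ℝ) :
    M.wordCost α β F (p ++ y :: c) (p.length + 1) =
      α * p.sum + β * c.length + M.blockMean fun w => F (c ++ w) := by
  rw [M.wordCost_append α β F p _ le_rfl]
  simp [wordCost]
  ring

theorem exists_split {u : List ℝ} {a : ℕ} (h1 : 1 ≤ a) (h2 : a ≤ u.length) :
    ∃ p y c, u = p ++ y :: c ∧ a = p.length + 1 := by
  refine ⟨u.take (a - 1), u[a - 1]'(by omega), u.drop a, ?_, by rw [List.length_take]; omega⟩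
  have := List.drop_eq_getElem_cons (l := u) (i := a - 1) (by omega)
  rw [Nat.sub_add_cancel h1] at this
  rw [← this, List.take_append_drop]

variable [Finite 𝒳] [MeasurableSingletonClass 𝒳] [IsProbabilityMeasure P]

variable {M} in
theorem Growth.wordCost {α β C : ℝ} {F : List ℝ → ℝ} (hF : M.Growth C F) {u : List ℝ}
    (hu : M.IsWord u) {a : ℕ} (ha : a ≤ u.length) :
    |M.wordCost α β F u a| ≤ (|α| * M.vMax + |β| + C * (1 + M.mu)) * (1 + u.length) := by
  have hmu := M.mu_pos
  have hC := hF.nonneg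
  have hv := M.vMax_nonneg
  have h1 : |α * (u.take (a - 1)).sum| ≤ |α| * M.vMax * (1 + u.length) := by
    rw [abs_mul, abs_of_nonneg (hu.take _).sum_nonneg, mul_assoc]
    refine mul_le_mul_of_nonneg_left ((hu.take _).sum_le.trans ?_) (abs_nonneg _)
    refine mul_le_mul_of_nonneg_left ?_ hv
    have : ((u.take (a - 1)).length : ℝ) ≤ u.length := by
      exact_mod_cast (List.length_take_le' _ _)
    linarith
  have h2 : |β * ((u.length : ℝ) - a)| ≤ |β| * (1 + u.length) := by
    have : (a : ℝ) ≤ u.length := by exact_mod_cast ha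
    rw [abs_mul, abs_of_nonneg (a := (u.length : ℝ) - a) (by linarith)]
    exact mul_le_mul_of_nonneg_left (by linarith [Nat.cast_nonneg (α := ℝ) a]) (abs_nonneg _)
  have h3 : |M.blockMean fun w => F (u.drop a ++ w)| ≤ C * (1 + M.mu) * (1 + u.length) := by
    refine (abs_blockMean_append_le hF (hu.drop a)).trans ?_
    rw [mul_assoc]
    refine mul_le_mul_of_nonneg_left ?_ hC
    have : ((u.drop a).length : ℝ) ≤ u.length := by
      exact_mod_cast (by simp : (u.drop a).length ≤ u.length)
    nlinarith [mul_nonneg hmu.le (Nat.cast_nonneg (α := ℝ) u.length)]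
  have := abs_add_three (α * (u.take (a - 1)).sum) (β * ((u.length : ℝ) - a))
    (M.blockMean fun w => F (u.drop a ++ w))
  rw [Model.wordCost]
  linarith

theorem exists_growth_optValue (η : ℝ) {K : ℕ} (hK : 0 < K) (n : ℕ) :
    ∃ C, M.Growth C (M.optValue η K n) := by
  induction n with
  | zero =>
    refine ⟨|1 / M.mu| * M.vMax, Growth.const_mul (fun u hu => ?_) _⟩
    rw [abs_of_nonneg hu.sum_nonneg]
    exact hu.sum_le.trans (mul_le_mul_of_nonneg_left (by linarith) M.vMax_nonneg)
  | succ n ih =>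
    obtain ⟨C, hC⟩ := ih
    refine ⟨|1 / M.mu| * M.vMax + |η| + C * (1 + M.mu), fun u hu => ?_⟩
    by_cases h0 : u = []
    · have hr : M.recent K u = ∅ := by
        ext a
        simp only [recent, actions, h0, Set.mem_ofPred_eq, List.length_nil,
          Set.mem_empty_iff_false, iff_false]
        omega
      rw [optValue, hr, Set.image_empty, Real.sInf_empty, abs_zero]
      have := hC.nonneg
      have := M.mu_pos
      have := M.vMax_nonneg
      positivity
    · obtain ⟨a, ha, he⟩ := M.exists_optValue_succ_eq η hK n h0
      rw [← he]
      exact hC.wordCost hu ha.1.2.1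

/-- Skipping a prefix costs its importance. -/
theorem optValue_succ_append_le (η : ℝ) {K : ℕ} (hK : 0 < K) (n : ℕ) (p : List ℝ) {c : List ℝ}
    (hc : c ≠ []) : M.optValue η K (n + 1) (p ++ c) ≤
      1 / M.mu * p.sum + M.optValue η K (n + 1) c := by
  obtain ⟨a, ha, he⟩ := M.exists_optValue_succ_eq η hK n hc
  rw [← he, ← M.wordCost_append _ _ _ _ _ ha.1.1]
  exact M.optValue_succ_le η n (M.recent_append ha)

/-- A selection from the buffer `e`, followed by `n` optimal steps, saves at least the penalty of a
packet of minimal importance, compared to selecting nothing in the first step. -/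
def PhantomStep (η : ℝ) (K n : ℕ) : Prop := ∀ e, M.IsWord e → e ≠ [] →
  M.optValue η K (n + 1) e + 1 / M.mu * M.vMin ≤ M.blockMean fun w => M.optValue η K n (e ++ w)

/-- With `n` steps to go, the packets `p` and `w` in front of the buffer `e` cost at least their
penalties, with `w` counted as `x ≤ w`: the later arrivals make the selection of any of them too
expensive in age, compared to a fresh packet of minimal importance. -/
def PrefixBound (η : ℝ) (K n : ℕ) : Prop := ∀ (p : List ℝ) (w : ℝ) (e : List ℝ) (x : ℝ),
  M.IsWord p → w ∈ Set.range M.v → M.IsWord e → e ≠ [] → x ≤ w →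
  x ≤ M.vMin + M.mu * η * e.length →
  (∀ p₁ y p₂, p = p₁ ++ y :: p₂ → y ≤ M.vMin + M.mu * η * (e.length + 1 + p₂.length)) →
  M.optValue η K n e + 1 / M.mu * (p.sum + x) ≤ M.optValue η K n (p ++ w :: e)

theorem prefixBound_zero (η : ℝ) (K : ℕ) : M.PrefixBound η K 0 := by
  intro p w e x _ _ _ _ hx _ _
  have := M.mu_pos
  simp only [optValue, List.sum_append, List.sum_cons]
  rw [← mul_add]
  exact mul_le_mul_of_nonneg_left (by linarith) (by positivity)

/-- The optimal step from `p ++ w :: e` selects from `p`, or selects `w`, or skips both. -/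
theorem prefixBound_succ {η : ℝ} {K : ℕ} (hK : 0 < K) {n : ℕ}
    (hst : M.PhantomStep η K n) : M.PrefixBound η K (n + 1) := by
  have hmu := M.mu_pos
  have hinv : 1 / M.mu * M.mu = 1 := by field_simp
  have key : ∀ y z : ℝ, y ≤ M.vMin + M.mu * η * z →
      1 / M.mu * y ≤ 1 / M.mu * M.vMin + η * z := by
    intro y z h
    calc 1 / M.mu * y ≤ 1 / M.mu * (M.vMin + M.mu * η * z) :=
          mul_le_mul_of_nonneg_left h (by positivity)
      _ = 1 / M.mu * M.vMin + (1 / M.mu * M.mu) * (η * z) := by ring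
      _ = _ := by rw [hinv, one_mul]
  intro p
  induction hl : p.length using Nat.strong_induction_on generalizing p with
  | _ l ih =>
  intro w e x hp hw he he0 hxw hxe hpy
  obtain ⟨r, hr, hrv⟩ := M.exists_optValue_succ_eq η hK n (u := p ++ w :: e) (by simp)
  rw [← hrv]
  have hxw' : 1 / M.mu * x ≤ 1 / M.mu * w := mul_le_mul_of_nonneg_left hxw (by positivity)
  rcases lt_trichotomy r (p.length + 1) with h | h | h
  · -- the packet `y` of `p` is sent: by `hst` and the bound on `y` it may as well be lost
    obtain ⟨p₁, y, p₂, rfl, rfl⟩ := exists_split (u := p) hr.1.1 (by omega)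
    have hp₂ : M.IsWord p₂ := fun z hz => hp z (by simp [hz])
    have e1 : p₁ ++ y :: p₂ ++ w :: e = p₁ ++ y :: (p₂ ++ w :: e) := by simp
    rw [e1, wordCost_split]
    have h1 := hst (p₂ ++ w :: e) (hp₂.append (fun z hz => by
      rcases List.mem_cons.1 hz with rfl | hz
      exacts [hw, he z hz])) (by simp)
    have h2 := ih p₂.length (by simp at hl; omega) p₂ rfl w e x hp₂ hw he he0 hxw hxe
      fun q₁ z q₂ hq => hpy (p₁ ++ y :: q₁) z q₂ (by simp [hq])
    have h3 := key _ _ (hpy p₁ y p₂ rfl)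
    have h4 : ((p₂ ++ w :: e).length : ℝ) = e.length + 1 + p₂.length := by
      simp
      ring
    rw [h4]
    simp only [List.sum_append, List.sum_cons] at h2 ⊢
    linarith
  · -- the packet `w` is sent
    rw [h, wordCost_split]
    have h1 := hst e he he0
    have h2 := key _ _ hxe
    linarith
  · -- the whole prefix is skipped
    obtain ⟨a, rfl⟩ := Nat.exists_eq_add_of_le h.le
    have e1 : p ++ w :: e = (p ++ [w]) ++ e := by simp
    have e2 : p.length + 1 + a = (p ++ [w]).length + a := by simp
    rw [e1, e2] at hr
    rw [e1, e2, M.wordCost_append _ _ _ _ _ (by omega)]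
    have h1 := M.optValue_succ_le η n (M.recent_of_append hr (by omega))
    simp only [List.sum_append, List.sum_cons, List.sum_nil]
    linarith

/-- Every nonempty word has a first packet that, corrected by its age, is worth more than a fresh
packet of importance `v_min`, or else one can take the last packet. -/
theorem exists_first_worthy (η : ℝ) (e : List ℝ) (he : e ≠ []) : ∃ p w c, e = p ++ w :: c ∧
    (c = [] ∨ M.vMin + M.mu * η * c.length < w) ∧
    ∀ p₁ y p₂, p = p₁ ++ y :: p₂ → y ≤ M.vMin + M.mu * η * (c.length + 1 + p₂.length) := by
  induction e with
  | nil => exact absurd rfl he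
  | cons y e ih =>
    by_cases h : e = [] ∨ M.vMin + M.mu * η * e.length < y
    · exact ⟨[], y, e, rfl, h, fun p₁ y p₂ h => by simp at h⟩
    · push Not at h
      obtain ⟨p, w, c, rfl, hc, hp⟩ := ih h.1
      refine ⟨y :: p, w, c, rfl, hc, fun p₁ z p₂ hz => ?_⟩
      rcases p₁ with _ | ⟨z', p₁⟩
      · simp only [List.nil_append, List.cons.injEq] at hz
        obtain ⟨rfl, rfl⟩ := hz
        refine h.2.trans (le_of_eq ?_)
        simp
        ring_nf
        simp
      · simp only [List.cons_append, List.cons.injEq] at hz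
        exact hp p₁ z p₂ hz.2

/-- Select the first worthy packet of `e`: the packets up to it cost the remaining steps enough by
`PrefixBound` if nothing is selected. -/
theorem phantomStep_of_prefixBound {η : ℝ} (hη : 0 < η) {K : ℕ} (hK : 0 < K)
    (hKη : (M.vMax - M.vMin) / M.mu ≤ η * K) {n : ℕ} (h : M.PrefixBound η K n) :
    M.PhantomStep η K n := by
  intro e he he0
  have hmu := M.mu_pos
  obtain ⟨p, w, c, rfl, hc, hp⟩ := M.exists_first_worthy η e he0
  have hpw : M.IsWord p := fun z hz => he z (by simp [hz])
  have hcw : M.IsWord c := fun z hz => he z (by simp [hz])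
  have hww := he w (by simp)
  have hrec : p.length + 1 ∈ M.recent K (p ++ w :: c) := by
    rcases hc with rfl | hc
    · refine ⟨⟨by simp, by simp, by simp⟩, by simp [hK]⟩
    · refine ⟨⟨by simp, by simp, fun _ => ?_⟩, ?_⟩
      · have : M.vMin < w := lt_of_le_of_lt (le_add_of_nonneg_right (by positivity)) hc
        simp [this.ne']
      · rw [div_le_iff₀ hmu] at hKη
        have h1 := he.le_vMax (x := w) (by simp)
        have h2 : M.mu * η * c.length < M.mu * η * K := by linarith
        have h3 : (c.length : ℝ) < K := lt_of_mul_lt_mul_left h2 (by positivity)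
        have h4 : c.length < K := by exact_mod_cast h3
        simp
        omega
  have h1 := M.optValue_succ_le η n hrec
  rw [wordCost_split] at h1
  obtain ⟨C, hC⟩ := M.exists_growth_optValue η hK n
  have h2 : 1 / M.mu * (p.sum + (M.vMin + M.mu * η * c.length)) +
      M.blockMean (fun w => M.optValue η K n (c ++ w)) ≤
      M.blockMean fun w' => M.optValue η K n (p ++ w :: c ++ w') := by
    rw [← blockMean_const_add (hC.append hcw)]
    refine blockMean_mono ((Growth.of_bounded (fun _ _ => le_rfl)).add (hC.append hcw))
      (hC.append he) fun w' hw' hw0 => ?_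
    have e1 : p ++ w :: c ++ w' = p ++ w :: (c ++ w') := by simp
    have hlen : (c.length : ℝ) ≤ (c ++ w').length := by simp
    rw [e1, add_comm]
    refine h p w (c ++ w') _ hpw hww (hcw.append hw') (by simp [hw0]) ?_ ?_ fun p₁ y p₂ hy => ?_
    · rcases hc with rfl | hc
      · simpa using he.vMin_le (x := w) (by simp)
      · exact hc.le
    · gcongr
    · refine (hp p₁ y p₂ hy).trans ?_
      gcongr
  have h3 : 1 / M.mu * (p.sum + (M.vMin + M.mu * η * c.length)) =
      1 / M.mu * p.sum + 1 / M.mu * M.vMin + η * c.length := by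
    field_simp
    ring
  linarith

theorem phantomStep {η : ℝ} (hη : 0 < η) {K : ℕ} (hK : 0 < K)
    (hKη : (M.vMax - M.vMin) / M.mu ≤ η * K) (n : ℕ) : M.PhantomStep η K n := by
  induction n with
  | zero => exact M.phantomStep_of_prefixBound hη hK hKη (M.prefixBound_zero η K)
  | succ n ih => exact M.phantomStep_of_prefixBound hη hK hKη (M.prefixBound_succ hK ih)

/-- The optimality inequality holds for all selections, also of packets that a buffer of size `K`
has forgotten, and even when ages above `K` are charged as `K`. -/
theorem optValue_succ_le_capped {η : ℝ} (hη : 0 < η) {K : ℕ} (hK : 0 < K)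
    (hKη : (M.vMax - M.vMin) / M.mu ≤ η * K) (n : ℕ) {u : List ℝ} (hu : M.IsWord u) {a : ℕ}
    (h1 : 1 ≤ a) (h2 : a ≤ u.length) :
    M.optValue η K (n + 1) u ≤ 1 / M.mu * (u.take (a - 1)).sum +
      η * (min (u.length - a) K : ℕ) + M.blockMean fun w => M.optValue η K n (u.drop a ++ w) := by
  have hmu := M.mu_pos
  by_cases ha : a ∈ M.recent K u
  · refine (M.optValue_succ_le η n ha).trans (le_of_eq ?_)
    have := ha.2
    rw [wordCost, min_eq_left (by omega), Nat.cast_sub h2]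
  · obtain ⟨p, y, c, rfl, rfl⟩ := exists_split h1 h2
    have hc0 : c ≠ [] := by
      rintro rfl
      refine ha ?_
      have := M.length_mem_recent hK (u := p ++ [y]) (by simp)
      simpa using this
    have hcw : M.IsWord c := fun z hz => hu z (by simp [hz])
    have e1 : p ++ y :: c = (p ++ [y]) ++ c := by simp
    have e2 : (p ++ y :: c).length - (p.length + 1) = c.length := by simp; omega
    have e3 : (p ++ y :: c).drop (p.length + 1) = c := by
      rw [List.drop_length_add_append]
      simp
    have b1 := M.optValue_succ_append_le η hK n (p ++ [y]) hc0
    have b2 := M.phantomStep hη hK hKη n c hcw hc0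
    rw [e2, e3, e1]
    have e4 : ((p ++ [y] ++ c).take (p.length + 1 - 1)).sum = p.sum := by simp
    have e5 : (p ++ [y]).sum = p.sum + y := by simp
    rw [e4]
    rw [e5, mul_add] at b1
    have b3 : 1 / M.mu * y ≤ 1 / M.mu * M.vMin + η * (min c.length K : ℕ) := by
      by_cases hK' : K ≤ c.length
      · rw [min_eq_right hK']
        have := hu.le_vMax (x := y) (by simp)
        have h3 : 1 / M.mu * y ≤ 1 / M.mu * M.vMax := mul_le_mul_of_nonneg_left this (by positivity)
        have h4 : (M.vMax - M.vMin) / M.mu = 1 / M.mu * M.vMax - 1 / M.mu * M.vMin := by ring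
        linarith
      · have hy : y = M.vMin := by
          by_contra hy
          exact ha ⟨⟨by simp, by simp, fun _ => by simpa using hy⟩, by simp; omega⟩
        rw [hy]
        have : 0 ≤ η * (min c.length K : ℕ) := by positivity
        linarith
    linarith

/-- A step on an untruncated word, in terms of the truncated problem. -/
theorem wordCost_extend (α β : ℝ) {K : ℕ} (h : List ℝ → ℝ) (u : List ℝ) {a : ℕ}
    (ha1 : 1 ≤ a) (ha : u.length < a + K) : M.wordCost α β (extend α K h) u a =
      α * lost K u + M.stepCost α β K h (cut K u) (a - (u.length - K)) := by
  obtain ⟨j, hj1, hj⟩ : ∃ j, 1 ≤ j ∧ a = (u.take (u.length - K)).length + j := by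
    refine ⟨a - (u.length - K), by omega, ?_⟩
    rw [List.length_take]
    omega
  have e : a - (u.length - K) = j := by
    rw [List.length_take] at hj
    omega
  conv_lhs => rw [← lost_append_cut K u]
  rw [e, hj, M.wordCost_append _ _ _ _ _ hj1]
  rfl

theorem recent_cut {K : ℕ} {u : List ℝ} {a : ℕ} (ha : a ∈ M.recent K u) :
    a - (u.length - K) ∈ M.actions (cut K u) := by
  have h4 := ha.2
  have h1 := ha.1.1
  rw [← lost_append_cut K u, show a = (u.take (u.length - K)).length + (a - (u.length - K)) by
    rw [List.length_take]; omega] at ha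
  exact (M.recent_of_append ha (by omega)).1

/-- A solution of the optimality inequality of the truncated problem bounds the optimal costs over
finitely many steps from below. -/
theorem exists_le_optValue {η : ℝ} {K : ℕ} (hK : 0 < K) {h : List ℝ → ℝ} {lam : ℝ}
    (hopt : ∀ b, M.IsState K b → ∀ a ∈ M.actions b,
      h b + lam ≤ M.stepCost (1 / M.mu) η K h b a) :
    ∃ C, ∀ n u, M.IsWord u → u ≠ [] → n * lam - C ≤ M.optValue η K n u := by
  have hmu := M.mu_pos
  obtain ⟨C, hC⟩ := M.exists_bound_cut K h
  obtain ⟨D, hD⟩ := M.exists_growth_extend (1 / M.mu) K h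
  have key : ∀ n u, M.IsWord u → u ≠ [] →
      extend (1 / M.mu) K h u + n * lam - C ≤ M.optValue η K n u := by
    intro n
    induction n with
    | zero =>
      intro u hu _
      have h1 := (abs_le.1 (hC u hu)).2
      have h2 : lost K u ≤ u.sum := by
        conv_rhs => rw [← lost_append_cut K u, List.sum_append]
        exact le_add_of_nonneg_right (hu.cut K).sum_nonneg
      have h3 := mul_le_mul_of_nonneg_left h2 (by positivity : 0 ≤ 1 / M.mu)
      simp only [extend, optValue, Nat.cast_zero, zero_mul, add_zero]
      linarith
    | succ n ih =>
      intro u hu hu0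
      obtain ⟨a, ha, he⟩ := M.exists_optValue_succ_eq η hK n hu0
      rw [← he]
      have h1 := hopt _ (hu.isState_cut hu0 hK) _ (M.recent_cut ha)
      have h2 := M.wordCost_extend (1 / M.mu) η h u ha.1.1 ha.2
      obtain ⟨E, hE⟩ := M.exists_growth_optValue η hK n
      have h3 : (n * lam - C) + M.blockMean (fun w => extend (1 / M.mu) K h (u.drop a ++ w)) ≤
          M.blockMean fun w => M.optValue η K n (u.drop a ++ w) := by
        rw [← blockMean_const_add (hD.append (hu.drop a))]
        refine blockMean_mono ((Growth.of_bounded (fun _ _ => le_rfl)).add (hD.append (hu.drop a)))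
          (hE.append (hu.drop a)) fun w hw hw0 => ?_
        have := ih (u.drop a ++ w) ((hu.drop a).append hw) (by simp [hw0])
        linarith
      rw [wordCost] at h2 ⊢
      have h4 : extend (1 / M.mu) K h u = 1 / M.mu * lost K u + h (cut K u) := rfl
      push_cast
      linarith
  refine ⟨2 * C, fun n u hu hu0 => ?_⟩
  have h1 := (abs_le.1 (hC u hu)).1
  have h2 := mul_nonneg (by positivity : 0 ≤ 1 / M.mu) (hu.lost_nonneg K)
  have h3 := key n u hu hu0
  simp only [extend] at h3
  linarith

end Model
end AgeDistortion

namespace AgeDistortion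
namespace Model

variable {Ω : Type*} [MeasurableSpace Ω] {P : Measure Ω} {𝒳 : Type*} [MeasurableSpace 𝒳]
variable (M : Model P 𝒳)

/-! ### Adapted processes -/

/-- `Y` is determined by the history up to the `i`-th speaking time. -/
def Adapted {β : Type*} (i : ℕ) (Y : Ω → β) : Prop :=
  ∀ ω ω', M.hist i ω = M.hist i ω' → Y ω = Y ω'

theorem hist_eq_of_le {i j : ℕ} (hij : i ≤ j) {ω ω' : Ω} (h : M.hist j ω = M.hist j ω') :
    M.hist i ω = M.hist i ω' := by
  have e : ∀ ω, M.hist i ω = (M.hist j ω).take i := fun ω => by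
    rw [hist, hist, ← List.map_take, List.take_range, min_eq_left hij]
  rw [e, e, h]

variable {M} in
theorem Adapted.mono {β : Type*} {i j : ℕ} {Y : Ω → β} (hY : M.Adapted i Y) (hij : i ≤ j) :
    M.Adapted j Y := fun ω ω' h => hY ω ω' (M.hist_eq_of_le hij h)

variable {M} in
theorem Adapted.comp {β γ : Type*} {i : ℕ} {Y : Ω → β} (hY : M.Adapted i Y) (f : β → γ) :
    M.Adapted i fun ω => f (Y ω) := fun ω ω' h => congrArg f (hY ω ω' h)

variable {M} in
theorem Adapted.comp₂ {β γ δ : Type*} {i : ℕ} {Y : Ω → β} {Y' : Ω → γ} (hY : M.Adapted i Y)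
    (hY' : M.Adapted i Y') (f : β → γ → δ) : M.Adapted i fun ω => f (Y ω) (Y' ω) :=
  fun ω ω' h => by simp only [hY ω ω' h, hY' ω ω' h]

variable {M} in
theorem Adapted.sum {ι : Type*} {i : ℕ} {s : Finset ι} {Y : ι → Ω → ℝ}
    (hY : ∀ j ∈ s, M.Adapted i (Y j)) : M.Adapted i fun ω => ∑ j ∈ s, Y j ω :=
  fun ω ω' h => Finset.sum_congr rfl fun j hj => hY j hj ω ω' h

theorem adapted_T {i j : ℕ} (hij : i ≤ j) : M.Adapted j (M.T i) := by
  intro ω ω' h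
  have h1 := congrArg (fun l => l.flatten.length) (M.hist_eq_of_le hij h)
  simpa [flatten_hist] using h1

theorem adapted_Z {i : ℕ} : M.Adapted (i + 1) (M.Z (i + 1)) := by
  intro ω ω' h
  have h1 := M.adapted_T le_rfl ω ω' h
  have h2 := M.adapted_T (Nat.le_succ i) ω ω' h
  rw [T_succ, T_succ] at h1
  omega

theorem adapted_X {i : ℕ} {ω ω' : Ω} (h : M.hist i ω = M.hist i ω') {t : ℕ} (h1 : 1 ≤ t)
    (h2 : t ≤ M.T i ω) : M.X t ω = M.X t ω' := by
  have h3 := congrArg List.flatten h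
  rw [flatten_hist, flatten_hist, ← M.adapted_T le_rfl ω ω' h] at h3
  have h4 := List.map_inj_left.1 h3 (t - 1) (List.mem_range.2 (by omega))
  rwa [Nat.sub_add_cancel h1] at h4

theorem segment_congr {i : ℕ} {ω ω' : Ω} (h : M.hist i ω = M.hist i ω') {a b : ℕ} (h1 : 1 ≤ a)
    (h2 : b ≤ M.T i ω) : M.segment a b ω = M.segment a b ω' := by
  refine List.map_congr_left fun t ht => ?_
  rw [List.mem_range'_1] at ht
  rw [V, V, M.adapted_X h (by omega) (by omega)]

theorem adapted_block (i : ℕ) : M.Adapted (i + 1) (M.block i) := by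
  intro ω ω' h
  rw [hist_succ, hist_succ] at h
  have := (List.append_inj_right' h rfl)
  simpa using this

section Measurable

variable [Finite 𝒳] [MeasurableSingletonClass 𝒳]

variable {M} in
theorem Adapted.measurable {β : Type*} [MeasurableSpace β] {i : ℕ} {Y : Ω → β}
    (hY : M.Adapted i Y) : Measurable Y := by
  intro A _
  have e : Y ⁻¹' A = M.hist i ⁻¹' (M.hist i '' (Y ⁻¹' A)) := by
    refine (Set.subset_preimage_image _ _).antisymm ?_
    rintro ω ⟨ω', h1, h2⟩
    rw [Set.mem_preimage, ← hY ω' ω h2]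
    exact h1
  rw [e]
  exact M.measurable_hist i MeasurableSet.of_discrete

variable [IsProbabilityMeasure P]

variable {M} in
theorem Adapted.integrable {i : ℕ} {Y : Ω → ℝ} (hY : M.Adapted i Y) {C : ℝ}
    (h : ∀ᵐ ω ∂P, |Y ω| ≤ C * (1 + M.T i ω)) : Integrable Y P :=
  (((integrable_const _).add (M.integrable_T i)).const_mul C).mono'
    hY.measurable.aestronglyMeasurable h

variable {M} in
/-- The Markov property for adapted functions of the next block. -/
theorem Adapted.integral_block {i : ℕ} {G : Ω → List ℝ → ℝ} (hG : M.Adapted i G)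
    (hint : Integrable (fun ω => G ω ((M.block i ω).map M.v)) P) :
    ∫ ω, G ω ((M.block i ω).map M.v) ∂P = ∫ ω, M.blockMean (G ω) ∂P := by
  classical
  obtain ⟨G', hG'⟩ : ∃ G' : List (List 𝒳) → List ℝ → ℝ, ∀ ω, G ω = G' (M.hist i ω) := by
    refine ⟨fun a => if h : ∃ ω, M.hist i ω = a then G h.choose else fun _ => 0, fun ω => ?_⟩
    have h : ∃ ω', M.hist i ω' = M.hist i ω := ⟨ω, rfl⟩
    show G ω = dite _ _ _
    rw [dif_pos h]
    exact hG _ _ h.choose_spec.symm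
  simp only [hG'] at hint ⊢
  rw [M.integral_hist_block i (fun a w => G' a (w.map M.v)) hint]
  simp only [blockMean, segment_one_Z]

end Measurable

/-! ### The buffer of a selection process -/

/-- The packets that remain after the `i`-th selection. -/
def rest (S : ℕ → Ω → ℕ) (i : ℕ) (ω : Ω) : List ℝ := M.segment (S i ω + 1) (M.T i ω) ω

/-- The packets that are available for the `(i+1)`-st selection. -/
def avail (S : ℕ → Ω → ℕ) (i : ℕ) (ω : Ω) : List ℝ := M.segment (S i ω + 1) (M.T (i + 1) ω) ω

variable {S : ℕ → Ω → ℕ}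

theorem isWord_rest (i : ℕ) (ω : Ω) : M.IsWord (M.rest S i ω) := M.isWord_segment _ _ _

theorem isWord_avail (i : ℕ) (ω : Ω) : M.IsWord (M.avail S i ω) := M.isWord_segment _ _ _

theorem length_rest (i : ℕ) (ω : Ω) : (M.rest S i ω).length = M.T i ω - S i ω := by
  rw [rest, length_segment]
  omega

theorem length_avail (i : ℕ) (ω : Ω) : (M.avail S i ω).length = M.T (i + 1) ω - S i ω := by
  rw [avail, length_segment]
  omega

theorem avail_eq {i : ℕ} {ω : Ω} (h : S i ω ≤ M.T i ω) :
    M.avail S i ω = M.rest S i ω ++ (M.block i ω).map M.v := by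
  rw [map_block]
  exact M.segment_append _ _ _ ω (by omega) (M.T_mono ω (Nat.le_succ i))

theorem rest_succ {i : ℕ} {ω : Ω} (h : S i ω < S (i + 1) ω) :
    M.rest S (i + 1) ω = (M.avail S i ω).drop (S (i + 1) ω - S i ω) := by
  rw [avail, segment_drop, rest]
  congr 1
  omega

theorem sum_segment (a b : ℕ) (ω : Ω) :
    (M.segment a b ω).sum = ∑ t ∈ Finset.Ico a (b + 1), M.V t ω := rfl

theorem skipped_eq {i : ℕ} {ω : Ω} (h1 : S i ω < S (i + 1) ω) (h2 : S (i + 1) ω ≤ M.T (i + 1) ω) :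
    M.skipped S (i + 1) ω = ((M.avail S i ω).take (S (i + 1) ω - S i ω - 1)).sum := by
  have e : (M.avail S i ω).take (S (i + 1) ω - S i ω - 1) =
      M.segment (S i ω + 1) (S (i + 1) ω - 1) ω := by
    rw [avail, M.segment_append _ (S (i + 1) ω - 1) _ ω (by omega) (by omega)]
    refine List.take_left' ?_
    rw [length_segment]
    omega
  rw [e, sum_segment, skipped]
  refine Finset.sum_congr ?_ fun _ _ => rfl
  ext t
  simp only [Nat.add_sub_cancel, Finset.mem_Ioo, Finset.mem_Ico]
  omega

variable {M}

theorem IsSelection.le_T (hS : M.IsSelection S) :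
    ∀ᵐ ω ∂P, ∀ i, S i ω < S (i + 1) ω ∧ S (i + 1) ω ≤ M.T (i + 1) ω ∧ S i ω ≤ M.T i ω := by
  filter_upwards [hS.2.2] with ω h i
  refine ⟨(h i).1, (h i).2, ?_⟩
  cases i with
  | zero => simp [hS.1]
  | succ i => exact (h i).2

theorem IsSelection.adapted (hS : M.IsSelection S) {i j : ℕ} (hij : i ≤ j) :
    M.Adapted j (S i) := by
  refine Adapted.mono (fun ω ω' h => ?_) hij
  cases i with
  | zero => rw [hS.1, hS.1]
  | succ i =>
    obtain ⟨φ, hφ⟩ := hS.2.1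
    have hT := M.adapted_T le_rfl ω ω' h
    rw [hφ _ (by omega), hφ _ (by omega), ← hT, M.segment_congr h le_rfl le_rfl]
    congr 1
    refine List.map_congr_left fun k hk => ?_
    rw [List.mem_range'_1] at hk
    exact M.adapted_T (by omega) ω ω' h

theorem IsSelection.adapted_rest (hS : M.IsSelection S) (i : ℕ) : M.Adapted i (M.rest S i) := by
  intro ω ω' h
  rw [rest, rest, ← hS.adapted le_rfl ω ω' h, ← M.adapted_T le_rfl ω ω' h]
  exact M.segment_congr h (by omega) le_rfl

theorem IsSelection.adapted_avail (hS : M.IsSelection S) (i : ℕ) :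
    M.Adapted (i + 1) (M.avail S i) := by
  intro ω ω' h
  rw [avail, avail, ← hS.adapted (Nat.le_succ i) ω ω' h, ← M.adapted_T le_rfl ω ω' h]
  exact M.segment_congr h (by omega) le_rfl

variable [Finite 𝒳] [MeasurableSingletonClass 𝒳] [IsProbabilityMeasure P]

theorem IsSelection.integrable_avail (hS : M.IsSelection S) {C : ℝ} {F : List ℝ → ℝ}
    (hF : M.Growth C F) (i : ℕ) : Integrable (fun ω => F (M.avail S i ω)) P := by
  refine ((hS.adapted_avail i).comp F).integrable (C := C) (Eventually.of_forall fun ω => ?_)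
  refine (hF _ (M.isWord_avail i ω)).trans (mul_le_mul_of_nonneg_left ?_ hF.nonneg)
  have : ((M.avail S i ω).length : ℝ) ≤ M.T (i + 1) ω := by
    rw [length_avail]
    exact_mod_cast Nat.sub_le _ _
  linarith

/-- The expectation at the next step. -/
theorem IsSelection.integral_avail (hS : M.IsSelection S) {C : ℝ} {F : List ℝ → ℝ}
    (hF : M.Growth C F) (i : ℕ) : ∫ ω, F (M.avail S i ω) ∂P =
      ∫ ω, M.blockMean (fun w => F (M.rest S i ω ++ w)) ∂P := by
  have h := hS.integrable_avail hF i
  have e : (fun ω => F (M.avail S i ω)) =ᵐ[P]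
      fun ω => F (M.rest S i ω ++ (M.block i ω).map M.v) := by
    filter_upwards [hS.le_T] with ω hω
    rw [M.avail_eq (hω i).2.2]
  rw [integral_congr_ae e]
  exact Adapted.integral_block ((hS.adapted_rest i).comp fun c w => F (c ++ w)) (h.congr e)

theorem IsSelection.integrable_blockMean (hS : M.IsSelection S) {C : ℝ} {F : List ℝ → ℝ}
    (hF : M.Growth C F) (i : ℕ) :
    Integrable (fun ω => M.blockMean fun w => F (M.rest S i ω ++ w)) P := by
  refine ((hS.adapted_rest i).comp fun c => M.blockMean fun w => F (c ++ w)).integrable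
    (C := C * (1 + M.mu)) (Eventually.of_forall fun ω => ?_)
  refine (abs_blockMean_append_le hF (M.isWord_rest i ω)).trans ?_
  rw [mul_assoc]
  refine mul_le_mul_of_nonneg_left ?_ hF.nonneg
  have h1 : ((M.rest S i ω).length : ℝ) ≤ M.T i ω := by
    rw [length_rest]
    exact_mod_cast Nat.sub_le _ _
  nlinarith [mul_nonneg M.mu_pos.le (Nat.cast_nonneg (α := ℝ) (M.T i ω))]

theorem IsSelection.adapted_skip (hS : M.IsSelection S) (i : ℕ) : M.Adapted (i + 1) fun ω =>
    ((M.avail S i ω).take (S (i + 1) ω - S i ω - 1)).sum := by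
  intro ω ω' h
  simp only [hS.adapted_avail i ω ω' h, hS.adapted le_rfl ω ω' h,
    hS.adapted (Nat.le_succ i) ω ω' h]

theorem skipped_nonneg (i : ℕ) (ω : Ω) : 0 ≤ M.skipped S i ω :=
  Finset.sum_nonneg fun _ _ => M.V_nonneg _ _

theorem skipped_le (i : ℕ) (ω : Ω) (h : S (i + 1) ω ≤ M.T (i + 1) ω) :
    M.skipped S (i + 1) ω ≤ M.vMax * M.T (i + 1) ω := by
  have h1 := Finset.sum_le_card_nsmul (Finset.Ioo (S i ω) (S (i + 1) ω)) (fun t => M.V t ω) M.vMax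
    fun t _ => M.le_vMax _
  rw [nsmul_eq_mul, Nat.card_Ioo, mul_comm] at h1
  refine h1.trans (mul_le_mul_of_nonneg_left ?_ M.vMax_nonneg)
  exact_mod_cast (by omega : S (i + 1) ω - S i ω - 1 ≤ M.T (i + 1) ω)

theorem IsSelection.aemeasurable_skipped (hS : M.IsSelection S) (i : ℕ) :
    AEMeasurable (M.skipped S (i + 1)) P := by
  refine ⟨_, (hS.adapted_skip i).measurable, ?_⟩
  filter_upwards [hS.le_T] with ω hω
  exact M.skipped_eq (hω i).1 (hω i).2.1

theorem IsSelection.integrable_skipped (hS : M.IsSelection S) (i : ℕ) :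
    Integrable (M.skipped S (i + 1)) P := by
  refine ((M.integrable_T (i + 1)).const_mul M.vMax).mono'
    (hS.aemeasurable_skipped i).aestronglyMeasurable ?_
  filter_upwards [hS.le_T] with ω hω
  rw [Real.norm_eq_abs, abs_of_nonneg (skipped_nonneg _ _)]
  exact skipped_le i ω (hω i).2.1

/-- The cost of the step from the `i`-th to the `(i+1)`-st selection, with ages capped at `K`. -/
def cappedCost (M : Model P 𝒳) (η : ℝ) (K : ℕ) (S : ℕ → Ω → ℕ) (i : ℕ) (ω : Ω) : ℝ :=
  1 / M.mu * M.skipped S (i + 1) ω + η * (min (M.T (i + 1) ω - S (i + 1) ω) K : ℕ)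

theorem IsSelection.integrable_cap (hS : M.IsSelection S) (K i : ℕ) :
    Integrable (fun ω => ((min (M.T i ω - S i ω) K : ℕ) : ℝ)) P := by
  refine (((M.adapted_T le_rfl).comp₂ (hS.adapted le_rfl)
    fun a b => ((min (a - b) K : ℕ) : ℝ))).integrable (C := 1) (Eventually.of_forall fun ω => ?_)
  rw [abs_of_nonneg (Nat.cast_nonneg _), one_mul]
  have : min (M.T i ω - S i ω) K ≤ 1 + M.T i ω := by omega
  exact_mod_cast this

theorem IsSelection.integrable_cappedCost (hS : M.IsSelection S) (η : ℝ) (K i : ℕ) :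
    Integrable (M.cappedCost η K S i) P :=
  ((hS.integrable_skipped i).const_mul _).add ((hS.integrable_cap K (i + 1)).const_mul _)

/-- A lower bound for the expected cost of an arbitrary selection process over `n` steps when all
remaining packets are lost in the end. -/
theorem IsSelection.le_integral_cost (hS : M.IsSelection S) {η : ℝ} (hη : 0 < η) {K : ℕ}
    (hK : 0 < K) (hKη : (M.vMax - M.vMin) / M.mu ≤ η * K) (n : ℕ) :
    ∫ ω, M.optValue η K n (M.avail S 0 ω) ∂P ≤
      ∑ i ∈ Finset.range n, ∫ ω, M.cappedCost η K S i ω ∂P +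
        1 / M.mu * ∫ ω, (M.avail S n ω).sum ∂P := by
  have hG := fun n => (M.exists_growth_optValue η hK n).choose_spec
  have step : ∀ m i, ∫ ω, M.optValue η K (m + 1) (M.avail S i ω) ∂P ≤
      ∫ ω, M.cappedCost η K S i ω ∂P + ∫ ω, M.optValue η K m (M.avail S (i + 1) ω) ∂P := by
    intro m i
    rw [hS.integral_avail (hG m), ← integral_add (hS.integrable_cappedCost η K i)
      (hS.integrable_blockMean (hG m) (i + 1))]
    refine integral_mono_ae (hS.integrable_avail (hG (m + 1)) i)
      ((hS.integrable_cappedCost η K i).add (hS.integrable_blockMean (hG m) (i + 1))) ?_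
    filter_upwards [hS.le_T] with ω hω
    obtain ⟨h1, h2, h3⟩ := hω i
    have := M.optValue_succ_le_capped hη hK hKη m (M.isWord_avail (S := S) i ω)
      (a := S (i + 1) ω - S i ω) (by omega) (by rw [length_avail]; omega)
    rw [← M.skipped_eq h1 h2, ← M.rest_succ h1, length_avail,
      show M.T (i + 1) ω - S i ω - (S (i + 1) ω - S i ω) = M.T (i + 1) ω - S (i + 1) ω by omega]
      at this
    exact this
  have main : ∀ k, k ≤ n → ∫ ω, M.optValue η K n (M.avail S 0 ω) ∂P ≤
      ∑ i ∈ Finset.range k, ∫ ω, M.cappedCost η K S i ω ∂P +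
        ∫ ω, M.optValue η K (n - k) (M.avail S k ω) ∂P := by
    intro k
    induction k with
    | zero => simp
    | succ k ih =>
      intro hk
      have h1 := ih (by omega)
      have h2 := step (n - (k + 1)) k
      rw [show n - (k + 1) + 1 = n - k by omega] at h2
      rw [Finset.sum_range_succ]
      linarith
  have := main n le_rfl
  rw [Nat.sub_self] at this
  simpa only [optValue, integral_const_mul] using this

end Model
end AgeDistortion

namespace AgeDistortion
namespace Model

variable {Ω : Type*} [MeasurableSpace Ω] {P : Measure Ω} {𝒳 : Type*} [MeasurableSpace 𝒳]
variable {M : Model P 𝒳} {S : ℕ → Ω → ℕ}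

/-! ### The optimality inequality bounds the cost of every selection process -/

theorem tendsto_ofReal_sub_div (a C : ℝ) :
    Tendsto (fun n : ℕ => ENNReal.ofReal (a - C / n)) atTop (nhds (ENNReal.ofReal a)) := by
  refine (ENNReal.continuous_ofReal.tendsto a).comp ?_
  simpa using (tendsto_const_nhds (x := a)).sub (tendsto_const_div_atTop_nhds_zero_nat C)

theorem ennreal_limsup_add_le (u v : ℕ → ENNReal) :
    limsup (fun n => u n + v n) atTop ≤ limsup u atTop + limsup v atTop := by
  simp only [limsup_eq_iInf_iSup_of_nat]
  rw [ENNReal.iInf_add_iInf]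
  · exact iInf_mono fun n => iSup₂_le fun i hi =>
      add_le_add (le_iSup₂ (f := fun i (_ : i ≥ n) => u i) i hi)
        (le_iSup₂ (f := fun i (_ : i ≥ n) => v i) i hi)
  · intro i j
    refine ⟨max i j, add_le_add ?_ ?_⟩
    · exact iSup₂_mono' fun k hk => ⟨k, (le_max_left i j).trans hk, le_rfl⟩
    · exact iSup₂_mono' fun k hk => ⟨k, (le_max_right i j).trans hk, le_rfl⟩

/-- The total distortion at a time between two speaking times: the packets skipped so far, and the
packets after the last selected one. -/
theorem sum_distortion_eq {ω : Ω} (hZ : ∀ i, 0 < M.Z (i + 1) ω)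
    (hω : ∀ i, S i ω < S (i + 1) ω ∧ S (i + 1) ω ≤ M.T (i + 1) ω ∧ S i ω ≤ M.T i ω)
    (h0 : S 0 ω = 0) {n t : ℕ} (h1 : M.T n ω < t) (h2 : t ≤ M.T (n + 1) ω) :
    ∑ j ∈ Finset.Icc 1 t, M.d (M.X j ω) (M.Y S t j ω) =
      ∑ i ∈ Finset.range n, M.skipped S (i + 1) ω +
        ∑ j ∈ Finset.Ico (S n ω + 1) (t + 1), M.V j ω := by
  have hmono : StrictMono fun i => S i ω := strictMono_nat_of_lt_succ fun i => (hω i).1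
  have hTmono : StrictMono fun i => M.T i ω := strictMono_nat_of_lt_succ fun i => by
    rw [T_succ]
    exact Nat.lt_add_of_pos_right (hZ i)
  have hT : ∀ i, M.T i ω < t ↔ i ≤ n := by
    intro i
    constructor
    · intro h
      by_contra hi
      have : M.T (n + 1) ω ≤ M.T i ω := M.T_mono ω (by omega)
      omega
    · intro h
      exact (M.T_mono ω h).trans_lt h1
  have hsent : ∀ i, 1 ≤ i → i ≤ n → M.d (M.X (S i ω) ω) (M.Y S t (S i ω) ω) = 0 := by
    intro i hi1 hi2
    rw [Y, if_pos ⟨i, hi1, (hT i).2 hi2, rfl⟩]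
    exact M.d_self _
  have hnot : ∀ j, (∀ i, 1 ≤ i → i ≤ n → S i ω ≠ j) →
      M.d (M.X j ω) (M.Y S t j ω) = M.V j ω := by
    intro j hj
    rw [Y, if_neg]
    · rfl
    · rintro ⟨i, hi1, hi2, hi3⟩
      exact hj i hi1 ((hT i).1 hi2) hi3
  have hpre : ∀ m, m ≤ n →
      ∑ j ∈ Finset.Ico 1 (S m ω + 1), M.d (M.X j ω) (M.Y S t j ω) =
        ∑ i ∈ Finset.range m, M.skipped S (i + 1) ω := by
    intro m
    induction m with
    | zero => simp [h0]
    | succ m ih =>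
      intro hm
      have hlt := (hω m).1
      rw [Finset.sum_range_succ, ← ih (by omega), Finset.sum_Ico_succ_top (by omega),
        hsent (m + 1) (by omega) hm, add_zero,
        ← Finset.sum_Ico_consecutive _ (by omega : 1 ≤ S m ω + 1) (by omega)]
      congr 1
      have e : Finset.Ioo (S (m + 1 - 1) ω) (S (m + 1) ω) =
          Finset.Ico (S m ω + 1) (S (m + 1) ω) := by
        ext j
        simp only [Nat.add_sub_cancel, Finset.mem_Ioo, Finset.mem_Ico]
        omega
      rw [skipped, e]
      refine Finset.sum_congr rfl fun j hj => hnot j fun i _ _ hij => ?_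
      rw [Finset.mem_Ico, ← hij] at hj
      have a1 : m < i := hmono.lt_iff_lt.1 (by omega : S m ω < S i ω)
      have a2 : i < m + 1 := hmono.lt_iff_lt.1 hj.2
      omega
  have hSt : S n ω < t := (hω n).2.2.trans_lt h1
  have e : Finset.Icc 1 t = Finset.Ico 1 (t + 1) := by
    ext j
    simp only [Finset.mem_Icc, Finset.mem_Ico]
    omega
  rw [e, ← Finset.sum_Ico_consecutive _ (by omega : 1 ≤ S n ω + 1) (by omega), hpre n le_rfl]
  congr 1
  refine Finset.sum_congr rfl fun j hj => hnot j fun i _ hi hij => ?_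
  rw [Finset.mem_Ico, ← hij] at hj
  have : S i ω ≤ S n ω := hmono.monotone hi
  omega

theorem sum_distortion_le [Finite 𝒳] (t : ℕ) (ω : Ω) :
    ∑ j ∈ Finset.Icc 1 t, M.d (M.X j ω) (M.Y S t j ω) ≤ M.vMax * t := by
  have h1 : ∀ j ∈ Finset.Icc 1 t, M.d (M.X j ω) (M.Y S t j ω) ≤ M.vMax := by
    intro j _
    rw [Y]
    split_ifs
    · rw [M.d_self]
      exact M.vMax_nonneg
    · exact M.le_vMax _
  have := Finset.sum_le_card_nsmul _ _ _ h1
  rw [Nat.card_Icc, nsmul_eq_mul] at this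
  simpa [mul_comm] using this

theorem sum_distortion_nonneg (t : ℕ) (ω : Ω) :
    0 ≤ ∑ j ∈ Finset.Icc 1 t, M.d (M.X j ω) (M.Y S t j ω) :=
  Finset.sum_nonneg fun _ _ => M.d_nonneg _ _

variable [Finite 𝒳] [MeasurableSingletonClass 𝒳] [IsProbabilityMeasure P]

theorem pairwise_indep_Z : Pairwise (Function.onFun (IndepFun · · P)
    fun (i : ℕ) ω => (M.Z (i + 1) ω : ℝ)) := by
  intro i j hij
  exact (M.indep_Z.indepFun hij).comp (φ := fun n : ℕ => (n : ℝ)) (ψ := fun n : ℕ => (n : ℝ))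
    Measurable.of_discrete Measurable.of_discrete

theorem sum_Z_eq (n : ℕ) (ω : Ω) : ∑ i ∈ Finset.range n, (M.Z (i + 1) ω : ℝ) = M.T n ω := by
  induction n with
  | zero => simp [T_zero]
  | succ n ih =>
    rw [Finset.sum_range_succ, ih, T_succ]
    push_cast
    rfl

theorem identDistrib_Z (i : ℕ) : IdentDistrib (fun ω => (M.Z (i + 1) ω : ℝ))
    (fun ω => (M.Z (0 + 1) ω : ℝ)) P P :=
  (M.ident_Z (i + 1) (by omega)).comp (u := fun n : ℕ => (n : ℝ)) Measurable.of_discrete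

theorem tendsto_T_div : ∀ᵐ ω ∂P, Tendsto (fun n : ℕ => (M.T n ω : ℝ) / n) atTop (nhds M.mu) := by
  have h := strong_law_ae_real (fun (i : ℕ) ω => (M.Z (i + 1) ω : ℝ)) (M.integrable_Z 0)
    pairwise_indep_Z identDistrib_Z
  simp only [sum_Z_eq, M.integral_Z] at h
  exact h

theorem tendsto_integral_T_div :
    Tendsto (fun n : ℕ => ∫ ω, |(M.T n ω : ℝ) / n - M.mu| ∂P) atTop (nhds 0) := by
  have h := strong_law_Lp (p := 1) le_rfl (by simp) (fun (i : ℕ) ω => (M.Z (i + 1) ω : ℝ))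
    (memLp_one_iff_integrable.2 (M.integrable_Z 0)) pairwise_indep_Z identDistrib_Z
  simp only [sum_Z_eq, M.integral_Z, eLpNorm_one_eq_lintegral_enorm] at h
  have h2 := (ENNReal.tendsto_toReal ENNReal.zero_ne_top).comp h
  refine h2.congr fun n => ?_
  rw [Function.comp_apply, ← integral_norm_eq_lintegral_enorm]
  · simp [div_eq_inv_mul]
  · exact (((M.integrable_T n).const_mul _).sub (integrable_const _)).aestronglyMeasurable

/-- The expected cost with capped ages grows at least linearly with rate `lam`, if `lam` satisfies
the optimality inequality of the truncated problem. -/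
theorem exists_le_integral_cost {η : ℝ} (hη : 0 < η) {K : ℕ} (hK : 0 < K)
    (hKη : (M.vMax - M.vMin) / M.mu ≤ η * K) {h : List ℝ → ℝ} {lam : ℝ}
    (hopt : ∀ b, M.IsState K b → ∀ a ∈ M.actions b,
      h b + lam ≤ M.stepCost (1 / M.mu) η K h b a) :
    ∃ C, ∀ S, M.IsSelection S → ∀ n : ℕ, n * lam - C ≤
      ∑ i ∈ Finset.range n, ∫ ω, M.cappedCost η K S i ω ∂P +
        1 / M.mu * ∫ ω, (M.avail S n ω).sum ∂P := by
  obtain ⟨C, hC⟩ := M.exists_le_optValue hK hopt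
  refine ⟨C, fun S hS n => ?_⟩
  refine le_trans ?_ (hS.le_integral_cost hη hK hKη n)
  obtain ⟨D, hD⟩ := M.exists_growth_optValue η hK n
  have : ∫ _, (n * lam - C) ∂P = n * lam - C := by simp
  rw [← this]
  refine integral_mono_ae (integrable_const _) (hS.integrable_avail hD 0) ?_
  filter_upwards [M.ae_Z_pos] with ω hω
  refine hC n _ (M.isWord_avail 0 ω) fun h0 => ?_
  have h1 := congrArg List.length h0
  rw [length_avail, hS.1, T_succ, T_zero] at h1
  have := hω 0
  simp at h1 this
  omega

theorem sum_Icc_one_eq {A : Type*} [AddCommMonoid A] (g : ℕ → A) (n : ℕ) :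
    ∑ j ∈ Finset.Icc 1 n, g j = ∑ i ∈ Finset.range n, g (i + 1) := by
  induction n with
  | zero => simp
  | succ n ih => rw [Finset.sum_Icc_succ_top (by omega), ih, Finset.sum_range_succ]

theorem IsSelection.accCost_ge (hS : M.IsSelection S) {η : ℝ} (hη : 0 < η) (K n : ℕ) :
    ENNReal.ofReal (∑ i ∈ Finset.range n, ∫ ω, M.cappedCost η K S i ω ∂P) ≤
      M.accCost η S n := by
  have hmu := M.mu_pos
  rw [← integral_finsetSum _ fun i _ => hS.integrable_cappedCost η K i,
    ofReal_integral_eq_lintegral_ofReal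
      (integrable_finsetSum _ fun i _ => hS.integrable_cappedCost η K i)
      (Eventually.of_forall fun ω => Finset.sum_nonneg fun i _ => ?_)]
  · refine lintegral_mono_ae ?_
    filter_upwards [hS.le_T] with ω hω
    refine ENNReal.ofReal_le_ofReal ?_
    rw [sum_Icc_one_eq]
    refine Finset.sum_le_sum fun i _ => ?_
    refine add_le_add le_rfl (mul_le_mul_of_nonneg_left ?_ hη.le)
    rw [← Nat.cast_sub (hω i).2.1]
    exact_mod_cast min_le_left _ _
  · exact add_nonneg (mul_nonneg (by positivity) (skipped_nonneg _ _)) (by positivity)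

/-- The average cost of a process in the restricted class is at least `lam`. -/
theorem IsRestrictedSelection.le_avgCost (hS : M.IsRestrictedSelection S) {η : ℝ} (hη : 0 < η)
    {K : ℕ} (hK : 0 < K) (hKη : (M.vMax - M.vMin) / M.mu ≤ η * K) {h : List ℝ → ℝ} {lam : ℝ}
    (hopt : ∀ b, M.IsState K b → ∀ a ∈ M.actions b,
      h b + lam ≤ M.stepCost (1 / M.mu) η K h b a) :
    ENNReal.ofReal lam ≤ M.avgCost η S := by
  have hmu := M.mu_pos
  have hv := M.vMax_nonneg
  obtain ⟨C, hC⟩ := exists_le_integral_cost hη hK hKη hopt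
  set B := ⨆ i, ∫⁻ ω, ENNReal.ofReal (((M.T i ω : ℝ) - S i ω) ^ 2) ∂P with hB
  have hint : ∀ n, ∫ ω, (M.avail S n ω).sum ∂P ≤ M.vMax * (B.toReal + M.mu) := by
    intro n
    have hA : Integrable (fun ω => (M.T n ω : ℝ) - S n ω) P := by
      refine (((M.adapted_T le_rfl).comp₂ (hS.1.adapted (le_refl n))
        fun a b => (a : ℝ) - b)).integrable (C := 1) ?_
      filter_upwards [hS.1.le_T] with ω hω
      have h1 := (hω n).2.2
      have h2 : (S n ω : ℝ) ≤ M.T n ω := by exact_mod_cast h1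
      rw [abs_of_nonneg (by linarith)]
      linarith [Nat.cast_nonneg (α := ℝ) (S n ω)]
    have hA' : ∫ ω, ((M.T n ω : ℝ) - S n ω) ∂P ≤ B.toReal := by
      rw [integral_eq_lintegral_of_nonneg_ae _ hA.aestronglyMeasurable]
      · refine ENNReal.toReal_mono hS.2.1.ne (le_trans (lintegral_mono_ae ?_)
          (le_iSup (fun i => ∫⁻ ω, ENNReal.ofReal (((M.T i ω : ℝ) - S i ω) ^ 2) ∂P) n))
        filter_upwards [hS.1.le_T] with ω hω
        rw [← Nat.cast_sub (hω n).2.2]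
        refine ENNReal.ofReal_le_ofReal ?_
        exact_mod_cast Nat.le_self_pow (by norm_num) _
      · filter_upwards [hS.1.le_T] with ω hω
        rw [← Nat.cast_sub (hω n).2.2]
        exact Nat.cast_nonneg _
    have hs : Integrable (fun ω => (M.avail S n ω).sum) P :=
      hS.1.integrable_avail (C := M.vMax) (fun u hu => by
        rw [abs_of_nonneg hu.sum_nonneg]
        exact hu.sum_le.trans (mul_le_mul_of_nonneg_left (by linarith) hv)) n
    calc ∫ ω, (M.avail S n ω).sum ∂P
        ≤ ∫ ω, M.vMax * (((M.T n ω : ℝ) - S n ω) + M.Z (n + 1) ω) ∂P := by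
          refine integral_mono_ae hs ((hA.add (M.integrable_Z n)).const_mul _) ?_
          filter_upwards [hS.1.le_T] with ω hω
          refine (M.isWord_avail n ω).sum_le.trans (le_of_eq ?_)
          rw [length_avail, T_succ, ← Nat.cast_sub (hω n).2.2, ← Nat.cast_add]
          congr 2
          have := (hω n).2.2
          omega
      _ = M.vMax * (∫ ω, ((M.T n ω : ℝ) - S n ω) ∂P + M.mu) := by
          rw [integral_const_mul, integral_add hA (M.integrable_Z n), integral_Z]
      _ ≤ _ := by gcongr
  set D := C + 1 / M.mu * (M.vMax * (B.toReal + M.mu)) with hD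
  rw [← (tendsto_ofReal_sub_div lam D).limsup_eq]
  refine limsup_le_limsup (eventually_gt_atTop 0 |>.mono fun n hn => ?_)
  have hn' : (0 : ℝ) < n := by exact_mod_cast hn
  refine le_trans ?_ (mul_le_mul_right (hS.1.accCost_ge hη K n) _)
  rw [← ENNReal.ofReal_mul (by positivity)]
  refine ENNReal.ofReal_le_ofReal ?_
  have h1 := hC S hS.1 n
  have h2 := mul_le_mul_of_nonneg_left (hint n) (by positivity : 0 ≤ 1 / M.mu)
  have h3 : n * lam - D ≤ ∑ i ∈ Finset.range n, ∫ ω, M.cappedCost η K S i ω ∂P := by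
    rw [hD]
    linarith
  calc lam - D / n = 1 / n * (n * lam - D) := by field_simp
    _ ≤ _ := mul_le_mul_of_nonneg_left h3 (by positivity)

/-- The distortion and the excess age of an arbitrary selection process lie above the line of slope
`-η` determined by `lam`. -/
theorem IsSelection.le_distortion_add (hS : M.IsSelection S) {η : ℝ} (hη : 0 < η)
    {K : ℕ} (hK : 0 < K) (hKη : (M.vMax - M.vMin) / M.mu ≤ η * K) {h : List ℝ → ℝ} {lam : ℝ}
    (hopt : ∀ b, M.IsState K b → ∀ a ∈ M.actions b,
      h b + lam ≤ M.stepCost (1 / M.mu) η K h b a) :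
    ENNReal.ofReal lam ≤ M.distortion S + ENNReal.ofReal η * M.excessAge S := by
  have hmu := M.mu_pos
  have hv := M.vMax_nonneg
  obtain ⟨C, hC⟩ := exists_le_integral_cost hη hK hKη hopt
  -- `a n` is the cost per step up to the speaking time `T (n + 1)`, with capped ages weighted by
  -- the next interspeaking time; it is dominated by a multiple of the average interspeaking time, so
  -- that truncating it at the mean leaves an error that vanishes in the limit
  let skip : ℕ → Ω → ℝ := fun i ω => ((M.avail S i ω).take (S (i + 1) ω - S i ω - 1)).sum
  let cap : ℕ → Ω → ℝ := fun i ω => ((min (M.T i ω - S i ω) K : ℕ) : ℝ)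
  let a : ℕ → Ω → ℝ := fun n ω => (1 / M.mu * (∑ i ∈ Finset.range n, skip i ω +
    (M.avail S n ω).sum) + η / M.mu * ∑ i ∈ Finset.range n, cap (i + 1) ω * M.Z (i + 2) ω) /
      (n + 1)
  let D := M.vMax / M.mu + η * K / M.mu
  have hD : 0 ≤ D := by positivity
  have hcapA : ∀ i, M.Adapted i (cap i) := fun i => (M.adapted_T le_rfl).comp₂
    (hS.adapted le_rfl) fun a b => ((min (a - b) K : ℕ) : ℝ)
  have hcapZ : ∀ i, Integrable (fun ω => cap (i + 1) ω * M.Z (i + 2) ω) P := by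
    intro i
    refine ((M.integrable_Z (i + 1)).const_mul (K : ℝ)).mono'
      ((hcapA (i + 1)).measurable.mul ((M.adapted_Z (i := i + 1)).comp
        fun n : ℕ => (n : ℝ)).measurable).aestronglyMeasurable (Eventually.of_forall fun ω => ?_)
    rw [Real.norm_eq_abs, abs_of_nonneg (by positivity)]
    exact mul_le_mul_of_nonneg_right (Nat.cast_le.2 (min_le_right _ _)) (Nat.cast_nonneg _)
  have hcapE : ∀ i, ∫ ω, cap (i + 1) ω * M.Z (i + 2) ω ∂P = M.mu * ∫ ω, cap (i + 1) ω ∂P := by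
    intro i
    have := Adapted.integral_block (M := M) (i := i + 1) (G := fun ω w => cap (i + 1) ω * w.length)
      ((hcapA (i + 1)).comp fun c (w : List ℝ) => c * w.length)
      (by simpa only [List.length_map, length_block] using hcapZ i)
    simp only [List.length_map, length_block] at this
    rw [this, ← integral_const_mul]
    congr 1
    ext ω
    rw [blockMean_const_mul, blockMean]
    simp only [length_segment_one_Z]
    rw [mul_comm]
    rfl
  have hsum : ∀ n, Integrable (fun ω => (M.avail S n ω).sum) P := fun n =>
      hS.integrable_avail (C := M.vMax) (fun u hu => by
        rw [abs_of_nonneg hu.sum_nonneg]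
        exact hu.sum_le.trans (mul_le_mul_of_nonneg_left (by linarith) hv)) n
  have hskip : ∀ i, M.skipped S (i + 1) =ᵐ[P] skip i := fun i => by
    filter_upwards [hS.le_T] with ω hω
    exact M.skipped_eq (hω i).1 (hω i).2.1
  have hskipI : ∀ i, Integrable (skip i) P := fun i => (hS.integrable_skipped i).congr (hskip i)
  have haI : ∀ n, Integrable (a n) P := fun n =>
    ((((integrable_finsetSum _ fun i _ => hskipI i).add (hsum n)).const_mul _).add
      ((integrable_finsetSum _ fun i _ => hcapZ i).const_mul _)).div_const _
  have haE : ∀ n : ℕ, lam - (C + lam) / ((n + 1 : ℕ) : ℝ) ≤ ∫ ω, a n ω ∂P := by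
    intro n
    have e : ∫ ω, a n ω ∂P = (∑ i ∈ Finset.range n, ∫ ω, M.cappedCost η K S i ω ∂P +
        1 / M.mu * ∫ ω, (M.avail S n ω).sum ∂P) / (n + 1) := by
      rw [integral_div, integral_add, integral_const_mul, integral_const_mul, integral_add,
        integral_finsetSum _ fun i _ => hskipI i, integral_finsetSum _ fun i _ => hcapZ i]
      · have e1 : ∀ i, ∫ ω, M.cappedCost η K S i ω ∂P =
            1 / M.mu * ∫ ω, skip i ω ∂P + η / M.mu * ∫ ω, cap (i + 1) ω * M.Z (i + 2) ω ∂P := by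
          intro i
          rw [hcapE, ← integral_congr_ae (hskip i)]
          simp only [cappedCost]
          rw [integral_add ((hS.integrable_skipped i).const_mul _)
            ((hS.integrable_cap K (i + 1)).const_mul _), integral_const_mul, integral_const_mul]
          congr 1
          field_simp
          rfl
        simp only [e1, Finset.sum_add_distrib, ← Finset.mul_sum]
        ring
      · exact integrable_finsetSum _ fun i _ => hskipI i
      · exact hsum n
      · exact ((integrable_finsetSum _ fun i _ => hskipI i).add (hsum n)).const_mul _
      · exact (integrable_finsetSum _ fun i _ => hcapZ i).const_mul _
    rw [e, le_div_iff₀ (by positivity)]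
    have := hC S hS n
    push_cast
    have e2 : (lam - (C + lam) / ((n : ℝ) + 1)) * (n + 1) = n * lam - C := by
      field_simp
      ring
    rw [e2]
    exact this
  have hgood := hS.le_T
  have hskipeq : ∀ᵐ ω ∂P, ∀ n, ∑ i ∈ Finset.range n, skip i ω + (M.avail S n ω).sum =
      ∑ j ∈ Finset.Icc 1 (M.T (n + 1) ω), M.d (M.X j ω) (M.Y S (M.T (n + 1) ω) j ω) := by
    filter_upwards [hgood, M.ae_Z_pos] with ω hω hZ n
    rw [sum_distortion_eq hZ hω (hS.1 ω) (n := n) (by rw [T_succ]; have := hZ n; omega) le_rfl,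
      avail, sum_segment]
    congr 1
    exact Finset.sum_congr rfl fun i _ => (M.skipped_eq (hω i).1 (hω i).2.1).symm
  have hcaple : ∀ n ω, ∑ i ∈ Finset.range n, cap (i + 1) ω * M.Z (i + 2) ω ≤
      K * M.T (n + 1) ω := by
    intro n ω
    induction n with
    | zero => simp; positivity
    | succ n ih =>
      rw [Finset.sum_range_succ, T_succ]
      push_cast
      have : cap (n + 1) ω ≤ K := Nat.cast_le.2 (min_le_right _ _)
      have := mul_le_mul_of_nonneg_right this (Nat.cast_nonneg (α := ℝ) (M.Z (n + 2) ω))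
      rw [mul_add]
      exact add_le_add ih this
  have hadom : ∀ᵐ ω ∂P, ∀ n : ℕ, a n ω ≤ D * (M.T (n + 1) ω / (n + 1 : ℕ)) := by
    filter_upwards [hskipeq] with ω h1 n
    have h2 := sum_distortion_le (M := M) (S := S) (M.T (n + 1) ω) ω
    rw [← h1] at h2
    have h3 := hcaple n ω
    simp only [a, D]
    push_cast
    rw [← mul_div_assoc]
    refine div_le_div_of_nonneg_right ?_ (by positivity)
    have h4 := mul_le_mul_of_nonneg_left h2 (by positivity : 0 ≤ 1 / M.mu)
    have h5 := mul_le_mul_of_nonneg_left h3 (by positivity : 0 ≤ η / M.mu)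
    refine (add_le_add h4 h5).trans (le_of_eq ?_)
    ring
  let f : ℕ → Ω → ENNReal := fun n ω => ENNReal.ofReal (min (a n ω) (D * M.mu))
  have hameas : ∀ n, Measurable (a n) := by
    intro n
    refine Measurable.div_const (Measurable.add (Measurable.const_mul (Measurable.add
      (Finset.measurable_fun_sum _ fun i _ => ?_) ?_) _)
      (Measurable.const_mul (Finset.measurable_fun_sum _ fun i _ => ?_) _)) _
    · exact (hS.adapted_skip i).measurable
    · exact ((hS.adapted_avail n).comp List.sum).measurable
    · exact (hcapA (i + 1)).measurable.mul ((M.adapted_Z (i := i + 1)).comp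
        fun n : ℕ => (n : ℝ)).measurable
  have hfE : ENNReal.ofReal lam ≤ limsup (fun n => ∫⁻ ω, f n ω ∂P) atTop := by
    have ht : Tendsto (fun n : ℕ => ENNReal.ofReal (lam - (C + lam) / ((n + 1 : ℕ) : ℝ) -
        D * ∫ ω, |(M.T (n + 1) ω : ℝ) / (n + 1 : ℕ) - M.mu| ∂P)) atTop
        (nhds (ENNReal.ofReal lam)) := by
      refine (ENNReal.continuous_ofReal.tendsto lam).comp ?_
      have h1 := (tendsto_const_nhds (x := lam)).sub
        (tendsto_const_div_atTop_nhds_zero_nat (C + lam))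
      have h2 := h1.sub ((tendsto_integral_T_div (M := M)).const_mul D)
      have h3 := h2.comp (tendsto_add_atTop_nat 1)
      simpa [Function.comp_def] using h3
    rw [← ht.limsup_eq]
    refine limsup_le_limsup (Eventually.of_forall fun n => ?_)
    have hminI : Integrable (fun ω => min (a n ω) (D * M.mu)) P :=
      (haI n).inf (integrable_const _)
    have hmaxI : Integrable (fun ω => max (min (a n ω) (D * M.mu)) 0) P :=
      hminI.sup (integrable_const 0)
    have hTI : Integrable (fun ω => |(M.T (n + 1) ω : ℝ) / (n + 1 : ℕ) - M.mu|) P :=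
      (((M.integrable_T (n + 1)).div_const _).sub (integrable_const _)).abs
    calc _ ≤ ENNReal.ofReal (∫ ω, min (a n ω) (D * M.mu) ∂P) := by
          refine ENNReal.ofReal_le_ofReal ?_
          have h1 : ∫ ω, a n ω ∂P ≤ ∫ ω, (min (a n ω) (D * M.mu) +
              D * |(M.T (n + 1) ω : ℝ) / (n + 1 : ℕ) - M.mu|) ∂P := by
            refine integral_mono_ae (haI n) (hminI.add (hTI.const_mul D)) ?_
            filter_upwards [hadom] with ω hω
            have h2 := hω n
            have h3 := mul_le_mul_of_nonneg_left
              (le_abs_self ((M.T (n + 1) ω : ℝ) / (n + 1 : ℕ) - M.mu)) hD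
            have h4 := mul_nonneg hD (abs_nonneg ((M.T (n + 1) ω : ℝ) / (n + 1 : ℕ) - M.mu))
            rcases min_cases (a n ω) (D * M.mu) with ⟨h5, -⟩ | ⟨h5, -⟩ <;> rw [h5] <;> linarith
          rw [integral_add hminI (hTI.const_mul D), integral_const_mul] at h1
          linarith [haE n]
      _ ≤ ENNReal.ofReal (∫ ω, max (min (a n ω) (D * M.mu)) 0 ∂P) :=
          ENNReal.ofReal_le_ofReal (integral_mono hminI hmaxI
            fun ω => le_max_left _ _)
      _ = _ := by
          rw [ofReal_integral_eq_lintegral_ofReal hmaxI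
            (Eventually.of_forall fun ω => le_max_right _ _)]
          simp [f]
  have hlim := limsup_lintegral_le (μ := P) (f := f) (fun _ => ENNReal.ofReal (D * M.mu))
    (fun n => ((hameas n).min measurable_const).ennreal_ofReal)
    (fun n => Eventually.of_forall fun ω => ENNReal.ofReal_le_ofReal (min_le_right _ _))
    (by simp)
  refine (hfE.trans hlim).trans ?_
  rw [distortion, excessAge, ← lintegral_const_mul' _ _ ENNReal.ofReal_ne_top,
    ← lintegral_add_right]
  swap
  · refine Measurable.const_mul (Measurable.limsup fun i => Measurable.ennreal_ofReal ?_) _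
    refine Measurable.const_mul (Measurable.const_mul
      (Finset.measurable_fun_sum _ fun j _ => ?_) _) _
    refine Measurable.mul ?_ ((M.adapted_Z (i := j)).comp fun n : ℕ => (n : ℝ)).measurable
    exact ((M.adapted_T le_rfl).comp₂ (hS.adapted (le_refl j)) fun a b => (a : ℝ) - b).measurable
  refine lintegral_mono_ae ?_
  filter_upwards [hgood, hskipeq, tendsto_T_div (M := M), M.ae_Z_pos] with ω hω hsk hT hZ
  set dist : ℕ → ℝ := fun t => 1 / (t : ℝ) *
    ∑ j ∈ Finset.Icc 1 t, M.d (M.X j ω) (M.Y S t j ω) with hdist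
  set age : ℕ → ℝ := fun i => 1 / M.mu * (1 / (i : ℝ) *
    ∑ j ∈ Finset.Icc 1 i, ((M.T j ω : ℝ) - S j ω) * M.Z (j + 1) ω) with hage
  set ρ : ℕ → ℝ := fun n => (M.T (n + 1) ω : ℝ) / (n + 1 : ℕ) / M.mu with hρ
  have hρlim : Tendsto (fun n => ENNReal.ofReal (M.vMax * |ρ n - 1|)) atTop (nhds 0) := by
    have h1 : Tendsto ρ atTop (nhds 1) := by
      have := (hT.comp (tendsto_add_atTop_nat 1)).div_const M.mu
      rwa [div_self hmu.ne'] at this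
    have h2 := ((h1.sub_const 1).abs).const_mul M.vMax
    rw [sub_self, abs_zero, mul_zero] at h2
    have h3 := (ENNReal.continuous_ofReal.tendsto _).comp h2
    rwa [ENNReal.ofReal_zero] at h3
  have hbound : ∀ n, 0 < n → f n ω ≤ ENNReal.ofReal (dist (M.T (n + 1) ω)) +
      ENNReal.ofReal (M.vMax * |ρ n - 1|) + ENNReal.ofReal η * ENNReal.ofReal (age n) := by
    intro n hn
    have hn' : (0 : ℝ) < n := by exact_mod_cast hn
    have hT0 : (0 : ℝ) < M.T (n + 1) ω := by
      have := M.le_T ω hZ (n + 1)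
      exact_mod_cast (by omega : 0 < M.T (n + 1) ω)
    have hd0 : 0 ≤ dist (M.T (n + 1) ω) :=
      mul_nonneg (by positivity) (sum_distortion_nonneg _ _)
    have hd1 : dist (M.T (n + 1) ω) ≤ M.vMax := by
      rw [hdist]
      have := sum_distortion_le (M := M) (S := S) (M.T (n + 1) ω) ω
      simp only [one_div_mul_eq_div]
      rw [div_le_iff₀ hT0]
      exact this
    have hage0 : 0 ≤ age n := by
      refine mul_nonneg (by positivity) (mul_nonneg (by positivity)
        (Finset.sum_nonneg fun j hj => ?_))
      rw [← Nat.cast_sub (hω j).2.2]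
      positivity
    rw [← ENNReal.ofReal_mul hη.le, ← ENNReal.ofReal_add hd0 (by positivity),
      ← ENNReal.ofReal_add (by positivity) (by positivity)]
    refine ENNReal.ofReal_le_ofReal ((min_le_left _ _).trans ?_)
    have e1 : a n ω = ρ n * dist (M.T (n + 1) ω) +
        η / M.mu * (1 / ((n : ℝ) + 1) * ∑ i ∈ Finset.range n, cap (i + 1) ω * M.Z (i + 2) ω) := by
      simp only [a, hρ, hdist]
      rw [hsk n]
      push_cast
      field_simp
    have e2 : η / M.mu * (1 / ((n : ℝ) + 1) *
        ∑ i ∈ Finset.range n, cap (i + 1) ω * M.Z (i + 2) ω) ≤ η * age n := by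
      simp only [hage]
      rw [sum_Icc_one_eq, div_mul_eq_mul_div, mul_div_assoc, div_eq_inv_mul, ← one_div]
      gcongr
      · linarith
      · rw [← Nat.cast_sub (hω _).2.1]
        exact Nat.cast_le.2 (min_le_left _ _)
    have e3 : ρ n * dist (M.T (n + 1) ω) ≤ dist (M.T (n + 1) ω) + M.vMax * |ρ n - 1| := by
      have h1 : (ρ n - 1) * dist (M.T (n + 1) ω) ≤ |ρ n - 1| * M.vMax :=
        mul_le_mul (le_abs_self _) hd1 hd0 (abs_nonneg _)
      linarith
    linarith
  calc limsup (fun n => f n ω) atTop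
      ≤ limsup (fun n => (ENNReal.ofReal (dist (M.T (n + 1) ω)) +
        ENNReal.ofReal (M.vMax * |ρ n - 1|)) + ENNReal.ofReal η * ENNReal.ofReal (age n)) atTop :=
        limsup_le_limsup ((eventually_gt_atTop 0).mono hbound)
    _ ≤ limsup (fun n => ENNReal.ofReal (dist (M.T (n + 1) ω))) atTop + 0 +
        ENNReal.ofReal η * limsup (fun n => ENNReal.ofReal (age n)) atTop := by
        refine (ennreal_limsup_add_le _ _).trans (add_le_add ?_ ?_)
        · refine (ennreal_limsup_add_le _ _).trans (add_le_add le_rfl ?_)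
          rw [hρlim.limsup_eq]
        · rw [ENNReal.limsup_const_mul_of_ne_top ENNReal.ofReal_ne_top]
    _ ≤ _ := by
        rw [add_zero]
        refine add_le_add ?_ le_rfl
        have ht : Tendsto (fun n => M.T (n + 1) ω) atTop atTop :=
          tendsto_atTop_mono (fun n => (Nat.le_succ n).trans (M.le_T ω hZ (n + 1))) tendsto_id
        exact limsup_le_limsup_of_le (f := map (fun n => M.T (n + 1) ω) atTop) ht
          (u := fun t => ENNReal.ofReal (dist t))

end Model
end AgeDistortion

namespace AgeDistortion
namespace Model

variable {Ω : Type*} [MeasurableSpace Ω] {P : Measure Ω} {𝒳 : Type*} [MeasurableSpace 𝒳]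
variable (M : Model P 𝒳)

/-! ### Processes that follow stationary policies -/

/-- The process that selects `ρ Ts Vs p` when `Ts` is the list of speaking times and `Vs` the list
of importance values so far, and `p` is the previous selection. -/
def ruleSelection (ρ : List ℕ → List ℝ → ℕ → ℕ) : ℕ → Ω → ℕ
  | 0, _ => 0
  | i + 1, ω => ρ ((List.range' 1 (i + 1)).map fun j => M.T j ω)
      (M.segment 1 (M.T (i + 1) ω) ω) (ruleSelection ρ i ω)

theorem exists_ruleSelection_eq (ρ : List ℕ → List ℝ → ℕ → ℕ) :
    ∃ φ : List ℕ → List ℝ → ℕ, ∀ i, 1 ≤ i → ∀ ω, M.ruleSelection ρ i ω =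
      φ ((List.range' 1 i).map fun j => M.T j ω) (M.segment 1 (M.T i ω) ω) := by
  let Φ : ℕ → List ℕ → List ℝ → ℕ := fun k Ts Vs => Nat.rec 0
    (fun k p => ρ (Ts.take (k + 1)) (Vs.take (Ts.getD k 0)) p) k
  refine ⟨fun Ts Vs => Φ Ts.length Ts Vs, fun i _ ω => ?_⟩
  have key : ∀ k, k ≤ i → Φ k ((List.range' 1 i).map fun j => M.T j ω)
      (M.segment 1 (M.T i ω) ω) = M.ruleSelection ρ k ω := by
    intro k
    induction k with
    | zero => exact fun _ => rfl
    | succ k ih =>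
      intro hk
      have e1 : ((List.range' 1 i).map fun j => M.T j ω).take (k + 1) =
          (List.range' 1 (k + 1)).map fun j => M.T j ω := by
        rw [← List.map_take]
        congr 1
        rw [show i = (k + 1) + (i - (k + 1)) by omega, ← List.range'_append]
        exact List.take_left' (by simp)
      have e2 : ((List.range' 1 i).map fun j => M.T j ω).getD k 0 = M.T (k + 1) ω := by
        rw [List.getD_eq_getElem?_getD, List.getElem?_map, List.getElem?_range' (by omega)]
        simp [add_comm]
      have e3 : (M.segment 1 (M.T i ω) ω).take (M.T (k + 1) ω) =
          M.segment 1 (M.T (k + 1) ω) ω := by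
        rw [M.segment_append 1 (M.T (k + 1) ω) _ ω (by omega) (M.T_mono ω hk)]
        exact List.take_left' (by rw [length_segment]; omega)
      show ρ _ _ (Φ k _ _) = _
      rw [e1, e2, e3, ih (by omega)]
      rfl
  have := key i le_rfl
  simpa using this.symm

/-- The `(i+1)`-st selection is the one of the stationary policy `s` with a buffer of size `K`. -/
def Follows (K : ℕ) (s : List ℝ → ℕ) (S : ℕ → Ω → ℕ) (i : ℕ) (ω : Ω) : Prop :=
  S (i + 1) ω = M.T (i + 1) ω + s (cut K (M.avail S i ω)) - (cut K (M.avail S i ω)).length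

variable {S : ℕ → Ω → ℕ}

theorem cut_avail (K i : ℕ) (ω : Ω) :
    cut K (M.avail S i ω) =
      M.segment (max (S i ω + 1) (M.T (i + 1) ω + 1 - K)) (M.T (i + 1) ω) ω := by
  rw [cut, length_avail, avail, segment_drop]
  congr 1
  omega

theorem segment_getElem? (a b j : ℕ) (ω : Ω) (h : a + j ≤ b) :
    (M.segment a b ω)[j]? = some (M.V (a + j) ω) := by
  rw [segment, List.getElem?_map, List.getElem?_range' (by omega)]
  simp

variable {M}

section Follows

variable {K : ℕ} {s : List ℝ → ℕ} {i : ℕ} {ω : Ω}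

theorem Follows.spec (hK : 0 < K) (hs : M.IsPolicy K s) (hf : M.Follows K s S i ω)
    (hZ : 0 < M.Z (i + 1) ω) (hT : S i ω ≤ M.T i ω) :
    S i ω < S (i + 1) ω ∧ S (i + 1) ω ≤ M.T (i + 1) ω ∧
    M.T (i + 1) ω - S (i + 1) ω < K ∧
    S (i + 1) ω - S i ω - ((M.avail S i ω).length - K) = s (cut K (M.avail S i ω)) ∧
    (M.V (S (i + 1) ω) ω = M.vMin → S (i + 1) ω = M.T (i + 1) ω) := by
  have hlt : S i ω < M.T (i + 1) ω := by
    rw [T_succ]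
    omega
  have hst : M.IsState K (cut K (M.avail S i ω)) :=
    (M.isWord_avail i ω).isState_cut (fun h0 => by
      have := congrArg List.length h0
      rw [length_avail, List.length_nil] at this
      omega) hK
  obtain ⟨h1, h2, h3⟩ := hs _ hst
  have hlen := length_cut K (M.avail S i ω)
  rw [length_avail] at hlen
  rw [Follows] at hf
  refine ⟨by omega, by omega, by omega, by rw [length_avail]; omega, fun hv => ?_⟩
  by_contra hne
  refine h3 (by omega) ?_
  rw [M.cut_avail K i ω] at hlen h1 h2 hf ⊢
  rw [segment_getElem? _ _ _ _ _ (by rw [length_segment] at *; omega), ← hv]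
  congr 2
  rw [length_segment] at *
  omega

end Follows

/-- A process that follows stationary policies (possibly different ones at different times) with
buffers of bounded sizes is in the restricted class. -/
theorem isRestrictedSelection_ruleSelection [IsProbabilityMeasure P]
    {ρ : List ℕ → List ℝ → ℕ → ℕ} {K : ℕ} (hK : 0 < K)
    (h : ∀ i ω, ∃ L s, 0 < L ∧ L ≤ K ∧ M.IsPolicy L s ∧ M.Follows L s (M.ruleSelection ρ) i ω) :
    M.IsRestrictedSelection (M.ruleSelection ρ) ∧
      ∀ᵐ ω ∂P, ∀ i, M.T i ω - M.ruleSelection ρ i ω < K := by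
  have key : ∀ᵐ ω ∂P, ∀ i, M.ruleSelection ρ i ω ≤ M.T i ω ∧ M.T i ω - M.ruleSelection ρ i ω < K ∧
      (1 ≤ i → M.V (M.ruleSelection ρ i ω) ω = M.vMin → M.ruleSelection ρ i ω = M.T i ω) := by
    filter_upwards [M.ae_Z_pos] with ω hZ i
    induction i with
    | zero => simpa [ruleSelection, T_zero] using hK
    | succ i ih =>
      obtain ⟨L, s, hL, hLK, hs, hf⟩ := h i ω
      obtain ⟨-, h2, h3, -, h5⟩ := hf.spec hL hs (hZ i) ih.1
      exact ⟨h2, h3.trans_le hLK, fun _ => h5⟩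
  refine ⟨⟨⟨fun ω => rfl, M.exists_ruleSelection_eq ρ, ?_⟩, ?_, ?_⟩, ?_⟩
  · filter_upwards [key, M.ae_Z_pos] with ω hω hZ i
    obtain ⟨L, s, hL, -, hs, hf⟩ := h i ω
    obtain ⟨h1, h2, -⟩ := hf.spec hL hs (hZ i) (hω i).1
    exact ⟨h1, h2⟩
  · refine lt_of_le_of_lt (iSup_le fun i => ?_)
      (ENNReal.ofReal_lt_top (r := (K : ℝ) ^ 2))
    calc _ ≤ ∫⁻ _, ENNReal.ofReal ((K : ℝ) ^ 2) ∂P := by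
          refine lintegral_mono_ae ?_
          filter_upwards [key] with ω hω
          refine ENNReal.ofReal_le_ofReal ?_
          rw [← Nat.cast_sub (hω i).1]
          exact_mod_cast Nat.pow_le_pow_left (hω i).2.1.le 2
      _ = _ := by simp
  · filter_upwards [key] with ω hω i hi
    exact (hω i).2.2 hi
  · filter_upwards [key] with ω hω i
    exact (hω i).2.1

/-- The selection of the stationary policy `s` with a buffer of size `K`, given the importance
values `Vs` so far and the previous selection `p`. -/
def policyRule (K : ℕ) (s : List ℝ → ℕ) (Vs : List ℝ) (p : ℕ) : ℕ :=
  Vs.length + s (cut K (Vs.drop p)) - (cut K (Vs.drop p)).length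

theorem policyRule_segment (K : ℕ) (s : List ℝ → ℕ) (i : ℕ) (ω : Ω) :
    policyRule K s (M.segment 1 (M.T (i + 1) ω) ω) (S i ω) =
      M.T (i + 1) ω + s (cut K (M.avail S i ω)) - (cut K (M.avail S i ω)).length := by
  rw [policyRule, segment_drop, length_segment, avail, add_comm 1, Nat.add_sub_cancel]

theorem inducedSelection_eq_ruleSelection (K : ℕ) (s : List ℝ → ℕ) :
    M.inducedSelection K s = M.ruleSelection fun _ => policyRule K s := by
  funext i ω
  induction i with
  | zero => rfl
  | succ i ih =>
    rw [ruleSelection, ← ih, policyRule_segment, cut_avail]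
    rfl

theorem follows_inducedSelection (K : ℕ) (s : List ℝ → ℕ) (i : ℕ) (ω : Ω) :
    M.Follows K s (M.inducedSelection K s) i ω := by
  rw [Follows, M.cut_avail K i ω]
  rfl

theorem isRestrictedSelection_inducedSelection [IsProbabilityMeasure P] {K : ℕ} (hK : 0 < K)
    {s : List ℝ → ℕ} (hs : M.IsPolicy K s) :
    M.IsRestrictedSelection (M.inducedSelection K s) ∧
      ∀ᵐ ω ∂P, ∀ i, M.T i ω - M.inducedSelection K s i ω < K := by
  have e := inducedSelection_eq_ruleSelection (M := M) K s
  rw [e]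
  refine isRestrictedSelection_ruleSelection hK fun i ω => ⟨K, s, hK, le_rfl, hs, ?_⟩
  rw [← e]
  exact follows_inducedSelection K s i ω

variable [Finite 𝒳] [MeasurableSingletonClass 𝒳] [IsProbabilityMeasure P]

/-- The policy evaluation along a step that follows the policy. -/
theorem Follows.extend_add {α β : ℝ} {K : ℕ} (hK : 0 < K) {s : List ℝ → ℕ} (hs : M.IsPolicy K s)
    {h : List ℝ → ℝ} {lam : ℝ}
    (he : ∀ b, M.IsState K b → h b + lam = M.stepCost α β K h b (s b)) {i : ℕ} {ω : Ω}
    (hf : M.Follows K s S i ω) (hZ : 0 < M.Z (i + 1) ω) (hT : S i ω ≤ M.T i ω) :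
    extend α K h (M.avail S i ω) + lam = α * M.skipped S (i + 1) ω +
      β * ((M.T (i + 1) ω : ℝ) - S (i + 1) ω) +
      M.blockMean fun w => extend α K h (M.rest S (i + 1) ω ++ w) := by
  obtain ⟨h1, h2, h3, h4, -⟩ := hf.spec hK hs hZ hT
  have hlen := M.length_avail (S := S) i ω
  have hst : M.IsState K (cut K (M.avail S i ω)) :=
    (M.isWord_avail i ω).isState_cut (fun h0 => by
      have := congrArg List.length h0
      rw [length_avail, List.length_nil] at this
      omega) hK
  have e1 := M.wordCost_extend α β h (M.avail S i ω) (K := K) (a := S (i + 1) ω - S i ω)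
    (by omega) (by omega)
  rw [h4, ← he _ hst] at e1
  rw [wordCost, ← M.skipped_eq h1 h2, ← M.rest_succ h1, hlen, Nat.cast_sub (by omega),
    Nat.cast_sub h1.le] at e1
  rw [extend]
  linarith

/-- The average cost of a stationary policy is the constant of its evaluation. -/
theorem avgCost_inducedSelection {η : ℝ} (hη : 0 < η) {K : ℕ} (hK : 0 < K) {s : List ℝ → ℕ}
    (hs : M.IsPolicy K s) {h : List ℝ → ℝ} {lam : ℝ}
    (he : ∀ b, M.IsState K b → h b + lam = M.stepCost (1 / M.mu) η K h b (s b)) :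
    0 ≤ lam ∧ M.avgCost η (M.inducedSelection K s) = ENNReal.ofReal lam := by
  have hmu := M.mu_pos
  set S := M.inducedSelection K s with hSdef
  obtain ⟨hR, hage⟩ := isRestrictedSelection_inducedSelection (M := M) hK hs
  have hS := hR.1
  obtain ⟨C, hC⟩ := M.exists_growth_extend (1 / M.mu) K h
  let cost : ℕ → Ω → ℝ := fun i ω =>
    1 / M.mu * M.skipped S (i + 1) ω + η * ((M.T (i + 1) ω : ℝ) - S (i + 1) ω)
  have hcost0 : ∀ᵐ ω ∂P, ∀ i, 0 ≤ cost i ω := by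
    filter_upwards [hS.le_T] with ω hω i
    refine add_nonneg (mul_nonneg (by positivity) (skipped_nonneg _ _)) ?_
    rw [← Nat.cast_sub (hω i).2.1]
    positivity
  have hcostI : ∀ i, Integrable (cost i) P := by
    intro i
    refine ((hS.integrable_skipped i).const_mul _).add (Integrable.const_mul ?_ _)
    refine (hS.integrable_cap K (i + 1)).congr ?_
    filter_upwards [hS.le_T, hage] with ω hω hω'
    rw [min_eq_left (hω' _).le, Nat.cast_sub (hω i).2.1]
  have hstep : ∀ i, ∫ ω, extend (1 / M.mu) K h (M.avail S i ω) ∂P + lam =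
      ∫ ω, cost i ω ∂P + ∫ ω, extend (1 / M.mu) K h (M.avail S (i + 1) ω) ∂P := by
    intro i
    rw [hS.integral_avail hC (i + 1), ← integral_add (hcostI i)
      (hS.integrable_blockMean hC (i + 1))]
    have : lam = ∫ _, lam ∂P := by simp
    conv_lhs => rw [this]
    rw [← integral_add (hS.integrable_avail hC i) (integrable_const _)]
    refine integral_congr_ae ?_
    filter_upwards [hS.le_T, M.ae_Z_pos] with ω hω hZ
    exact (follows_inducedSelection K s i ω).extend_add hK hs he (hZ i) (hω i).2.2
  have hsum : ∀ n : ℕ, ∫ ω, extend (1 / M.mu) K h (M.avail S 0 ω) ∂P + n * lam =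
      ∑ i ∈ Finset.range n, ∫ ω, cost i ω ∂P +
        ∫ ω, extend (1 / M.mu) K h (M.avail S n ω) ∂P := by
    intro n
    induction n with
    | zero => simp
    | succ n ih =>
      rw [Finset.sum_range_succ]
      have := hstep n
      push_cast
      linarith
  have hbd : ∀ n, |∫ ω, extend (1 / M.mu) K h (M.avail S n ω) ∂P| ≤ C * (1 + K + M.mu) := by
    intro n
    have hi : Integrable (fun ω => C * (1 + K + (M.Z (n + 1) ω : ℝ))) P :=
      ((integrable_const _).add (M.integrable_Z n)).const_mul _
    have e : ∫ ω, C * (1 + K + (M.Z (n + 1) ω : ℝ)) ∂P = C * (1 + K + M.mu) := by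
      rw [integral_const_mul, integral_add (integrable_const _) (M.integrable_Z n), integral_Z]
      simp
    rw [← e]
    refine abs_integral_le_integral_abs.trans
      (integral_mono_ae (hS.integrable_avail hC n).abs hi ?_)
    filter_upwards [hS.le_T, hage] with ω hω hω'
    refine (hC _ (M.isWord_avail n ω)).trans (mul_le_mul_of_nonneg_left ?_ hC.nonneg)
    rw [length_avail, T_succ, add_assoc]
    have h1 : M.T n ω - S n ω < K := hω' n
    have h2 := (hω n).2.2
    exact_mod_cast (by omega : 1 + (M.T n ω + M.Z (n + 1) ω - S n ω) ≤ 1 + (K + M.Z (n + 1) ω))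
  set D := 2 * (C * (1 + K + M.mu)) with hD
  set I : ℕ → ℝ := fun n => ∑ i ∈ Finset.range n, ∫ ω, cost i ω ∂P with hI
  have hID : ∀ n : ℕ, |I n - n * lam| ≤ D := by
    intro n
    have h1 := abs_le.1 (hbd 0)
    have h2 := abs_le.1 (hbd n)
    have h3 := hsum n
    rw [abs_le]
    constructor <;> linarith
  have hI0 : ∀ n, 0 ≤ I n := fun n => Finset.sum_nonneg fun i _ =>
    integral_nonneg_of_ae (hcost0.mono fun ω hω => hω i)
  have hlim : Tendsto (fun n : ℕ => 1 / (n : ℝ) * I n) atTop (nhds lam) := by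
    rw [← tendsto_sub_nhds_zero_iff]
    refine squeeze_zero_norm' ?_ (tendsto_const_div_atTop_nhds_zero_nat D)
    filter_upwards [eventually_gt_atTop 0] with n hn
    have hn' : (0 : ℝ) < n := by exact_mod_cast hn
    have : 1 / (n : ℝ) * I n - lam = (I n - n * lam) / n := by field_simp
    rw [this, Real.norm_eq_abs, abs_div, abs_of_pos hn']
    exact div_le_div_of_nonneg_right (hID n) hn'.le
  have hacc : ∀ n, M.accCost η S n = ENNReal.ofReal (I n) := by
    intro n
    rw [hI]
    simp only
    rw [← integral_finsetSum _ fun i _ => hcostI i, ofReal_integral_eq_lintegral_ofReal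
      (integrable_finsetSum _ fun i _ => hcostI i)
      (hcost0.mono fun ω hω => Finset.sum_nonneg fun i _ => hω i), accCost]
    simp only [sum_Icc_one_eq, cost]
  have hlim' : Tendsto (fun n : ℕ => ENNReal.ofReal (1 / (n : ℝ)) * M.accCost η S n) atTop
      (nhds (ENNReal.ofReal lam)) := by
    refine ((ENNReal.continuous_ofReal.tendsto lam).comp hlim).congr fun n => ?_
    rw [hacc, ← ENNReal.ofReal_mul (by positivity)]
    rfl
  refine ⟨ge_of_tendsto' hlim fun n => mul_nonneg (by positivity) (hI0 n), hlim'.limsup_eq⟩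

end Model
end AgeDistortion

namespace AgeDistortion
namespace Model

variable {Ω : Type*} [MeasurableSpace Ω] {P : Measure Ω} {𝒳 : Type*} [MeasurableSpace 𝒳]
variable {M : Model P 𝒳} {S : ℕ → Ω → ℕ}

/-! ### Almost sure limits of averages -/

/-- For a monotone sequence, convergence of the averages along the squares suffices, because the
ratio of successive squares tends to one. -/
theorem tendsto_div_of_sq {u : ℕ → ℝ} {l : ℝ} (hu : Monotone u)
    (h : Tendsto (fun k : ℕ => u (k ^ 2) / ((k ^ 2 : ℕ) : ℝ)) atTop (nhds l)) :
    Tendsto (fun n : ℕ => u n / n) atTop (nhds l) := by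
  refine tendsto_div_of_monotone_of_exists_subseq_tendsto_div u l hu fun a ha => ?_
  refine ⟨fun k => k ^ 2, ?_, tendsto_pow_atTop (by norm_num), h⟩
  have h1 : Tendsto (fun k : ℕ => (1 + 1 / (k : ℝ)) ^ 2) atTop (nhds 1) := by
    have := ((tendsto_const_nhds (x := (1 : ℝ))).add
      (tendsto_const_div_atTop_nhds_zero_nat (1 : ℝ))).pow 2
    simpa using this
  filter_upwards [h1.eventually_le_const ha, eventually_gt_atTop 0] with k hk hk0
  have hk0' : (0 : ℝ) < k := by exact_mod_cast hk0
  push_cast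
  calc ((k : ℝ) + 1) ^ 2 = (1 + 1 / (k : ℝ)) ^ 2 * k ^ 2 := by
        field_simp
    _ ≤ a * k ^ 2 := by gcongr

theorem tendsto_shift_div {u : ℕ → ℝ} {l : ℝ} :
    Tendsto (fun n : ℕ => u (n + 1) / n) atTop (nhds l) ↔
      Tendsto (fun n : ℕ => u n / n) atTop (nhds l) := by
  rw [← tendsto_add_atTop_iff_nat (f := fun n : ℕ => u n / n) 1]
  have h1 : Tendsto (fun n : ℕ => (n : ℝ) / (n + 1)) atTop (nhds 1) :=
    tendsto_natCast_div_add_atTop 1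
  have h2 : Tendsto (fun n : ℕ => ((n : ℝ) + 1) / n) atTop (nhds 1) := by
    have := h1.inv₀ one_ne_zero
    simpa using this
  constructor
  · intro h
    have := h.mul h1
    rw [mul_one] at this
    refine this.congr' ((eventually_gt_atTop 0).mono fun n hn => ?_)
    have hn' : (n : ℝ) ≠ 0 := by exact_mod_cast hn.ne'
    push_cast
    field_simp
  · intro h
    have := h.mul h2
    rw [mul_one] at this
    refine this.congr' ((eventually_gt_atTop 0).mono fun n hn => ?_)
    have hn' : (n : ℝ) ≠ 0 := by exact_mod_cast hn.ne'
    push_cast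
    field_simp

variable [Finite 𝒳] [MeasurableSingletonClass 𝒳] [IsProbabilityMeasure P]

/-- Random variables whose second moments grow at most linearly are negligible along the squares,
by the Borel–Cantelli argument. -/
theorem tendsto_sq_div_of_integral_sq_le {N : ℕ → Ω → ℝ} {Q : ℝ} (hN : ∀ n, MemLp (N n) 2 P)
    (hQ : ∀ n : ℕ, ∫ ω, N n ω ^ 2 ∂P ≤ n * Q) :
    ∀ᵐ ω ∂P, Tendsto (fun k : ℕ => N (k ^ 2) ω / ((k ^ 2 : ℕ) : ℝ)) atTop (nhds 0) := by
  have hmeas : ∀ k : ℕ, AEMeasurable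
      (fun ω => ENNReal.ofReal ((N (k ^ 2) ω / ((k ^ 2 : ℕ) : ℝ)) ^ 2)) P := fun k =>
    (((hN (k ^ 2)).1.aemeasurable.div_const _).pow_const 2).ennreal_ofReal
  have hfin : ∫⁻ ω, ∑' k : ℕ, ENNReal.ofReal ((N (k ^ 2) ω / ((k ^ 2 : ℕ) : ℝ)) ^ 2) ∂P ≠ ⊤ := by
    rw [lintegral_tsum hmeas]
    have hs : Summable fun k : ℕ => Q * (1 / (k : ℝ) ^ 2) :=
      (Real.summable_one_div_nat_pow.2 one_lt_two).mul_left Q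
    refine ne_top_of_le_ne_top hs.tsum_ofReal_ne_top (ENNReal.tsum_le_tsum fun k => ?_)
    have hi : Integrable (fun ω => (N (k ^ 2) ω / ((k ^ 2 : ℕ) : ℝ)) ^ 2) P := by
      simp only [div_pow]
      exact (hN _).integrable_sq.div_const _
    rw [← ofReal_integral_eq_lintegral_ofReal hi (Eventually.of_forall fun _ => sq_nonneg _)]
    refine ENNReal.ofReal_le_ofReal ?_
    simp only [div_pow]
    rw [integral_div]
    rcases Nat.eq_zero_or_pos k with rfl | hk
    · simp
    · have hk' : (0 : ℝ) < k := by exact_mod_cast hk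
      rw [div_le_iff₀ (by positivity)]
      refine (hQ _).trans (le_of_eq ?_)
      push_cast
      field_simp
  have hae := ae_lt_top' (AEMeasurable.tsum hmeas) hfin
  filter_upwards [hae] with ω hω
  have h1 := ENNReal.tendsto_atTop_zero_of_tsum_ne_top hω.ne
  have h2 := (ENNReal.tendsto_toReal ENNReal.zero_ne_top).comp h1
  have h3 : Tendsto (fun k : ℕ => (N (k ^ 2) ω / ((k ^ 2 : ℕ) : ℝ)) ^ 2) atTop (nhds 0) := by
    refine h2.congr fun k => ?_
    rw [Function.comp_apply, ENNReal.toReal_ofReal (sq_nonneg _)]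
  have h4 := (Real.continuous_sqrt.tendsto 0).comp h3
  rw [Real.sqrt_zero] at h4
  refine tendsto_zero_iff_abs_tendsto_zero _ |>.2 (h4.congr fun k => ?_)
  exact Real.sqrt_sq_eq_abs _

/-- The second moments of sums with orthogonal increments grow at most linearly. -/
theorem integral_sum_sq_le {ξ : ℕ → Ω → ℝ} {Q : ℝ} (hξ : ∀ i, MemLp (ξ i) 2 P)
    (hQ : ∀ i, ∫ ω, ξ i ω ^ 2 ∂P ≤ Q)
    (horth : ∀ n, ∫ ω, (∑ i ∈ Finset.range n, ξ i ω) * ξ n ω ∂P = 0) (n : ℕ) :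
    ∫ ω, (∑ i ∈ Finset.range n, ξ i ω) ^ 2 ∂P ≤ n * Q := by
  have hN : ∀ n, MemLp (fun ω => ∑ i ∈ Finset.range n, ξ i ω) 2 P := fun n =>
    memLp_finsetSum _ fun i _ => hξ i
  induction n with
  | zero => simp
  | succ n ih =>
    have e : ∀ ω, (∑ i ∈ Finset.range (n + 1), ξ i ω) ^ 2 =
        (∑ i ∈ Finset.range n, ξ i ω) ^ 2 +
          2 * ((∑ i ∈ Finset.range n, ξ i ω) * ξ n ω) + ξ n ω ^ 2 := by
      intro ω
      rw [Finset.sum_range_succ]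
      ring
    have h1 : Integrable (fun ω => (∑ i ∈ Finset.range n, ξ i ω) * ξ n ω) P :=
      (hN n).integrable_mul (hξ n)
    simp only [e]
    rw [integral_add (f := fun ω => _ + _) ((hN n).integrable_sq.add (h1.const_mul 2))
        (hξ n).integrable_sq,
      integral_add (hN n).integrable_sq (h1.const_mul 2), integral_const_mul, horth]
    have := hQ n
    push_cast
    linarith

/-- The deviation of an adapted function of the next block from its conditional mean. -/
def deviation (M : Model P 𝒳) (G : ℕ → Ω → List ℝ → ℝ) (i : ℕ) (ω : Ω) : ℝ :=
  G i ω ((M.block i ω).map M.v) - M.blockMean (G i ω)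

theorem adapted_deviation {G : ℕ → Ω → List ℝ → ℝ} (hG : ∀ i, M.Adapted i (G i)) (i : ℕ) :
    M.Adapted (i + 1) (M.deviation G i) :=
  (((hG i).mono (Nat.le_succ i)).comp₂ (M.adapted_block i) fun g w => g (w.map M.v)).comp₂
    (((hG i).mono (Nat.le_succ i)).comp fun g => M.blockMean g) fun a b => a - b

theorem integral_mul_deviation {G : ℕ → Ω → List ℝ → ℝ} (hG : ∀ i, M.Adapted i (G i)) {C : ℝ}
    (hC : ∀ᵐ ω ∂P, ∀ i, M.Growth C (G i ω)) {n : ℕ} {N : Ω → ℝ} (hN : M.Adapted n N)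
    (hi : Integrable (fun ω => N ω * M.deviation G n ω) P) :
    ∫ ω, N ω * M.deviation G n ω ∂P = 0 := by
  have h2 := Adapted.integral_block (M := M) (i := n)
    (G := fun ω w => N ω * (G n ω w - M.blockMean (G n ω)))
    (hN.comp₂ (hG n) fun a g w => a * (g w - M.blockMean g)) hi
  refine h2.trans (integral_eq_zero_of_ae ?_)
  filter_upwards [hC] with ω hω
  rw [blockMean_const_mul, blockMean_sub (hω n) (Growth.of_bounded (fun _ _ => le_rfl))]
  simp [blockMean]

theorem memLp_deviation {G : ℕ → Ω → List ℝ → ℝ} (hG : ∀ i, M.Adapted i (G i)) {C : ℝ}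
    (hC : ∀ᵐ ω ∂P, ∀ i, M.Growth C (G i ω)) :
    ∃ Q, ∀ i, MemLp (M.deviation G i) 2 P ∧ ∫ ω, M.deviation G i ω ^ 2 ∂P ≤ Q := by
  have hbound : ∀ᵐ ω ∂P, ∀ i,
      |M.deviation G i ω| ≤ C * (1 + M.Z (i + 1) ω) + C * (1 + M.mu) := by
    filter_upwards [hC] with ω hω i
    refine (abs_sub _ _).trans (add_le_add ?_ (abs_blockMean_le (hω i)))
    have := hω i _ (M.isWord_map_v (M.block i ω))
    rwa [List.length_map, length_block] at this
  have hL : ∀ i, MemLp (fun ω => C * (1 + (M.Z (i + 1) ω : ℝ)) + C * (1 + M.mu)) 2 P := by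
    intro i
    have h1 : MemLp (fun ω => 1 + (M.Z (i + 1) ω : ℝ)) 2 P :=
      (memLp_const (1 : ℝ)).add (M.memLp_Z i)
    exact (h1.const_mul C).add (memLp_const (C * (1 + M.mu)))
  have hξL : ∀ i, MemLp (M.deviation G i) 2 P := fun i =>
    (hL i).mono' (adapted_deviation hG i).measurable.aestronglyMeasurable
      (hbound.mono fun ω hω => hω i)
  refine ⟨∫ ω, (C * (1 + (M.Z 1 ω : ℝ)) + C * (1 + M.mu)) ^ 2 ∂P, fun i => ⟨hξL i, ?_⟩⟩
  have e := ((M.ident_Z (i + 1) (by omega)).comp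
    (u := fun n : ℕ => (C * (1 + (n : ℝ)) + C * (1 + M.mu)) ^ 2)
    Measurable.of_discrete).integral_eq
  refine le_trans ?_ e.le
  refine integral_mono_ae (hξL i).integrable_sq (hL i).integrable_sq ?_
  filter_upwards [hbound] with ω hω
  exact sq_le_sq' (by linarith [(abs_le.1 (hω i)).1]) (abs_le.1 (hω i)).2

/-- A law of large numbers along the squares for the martingale of the deviations of adapted
functions of the next block from their conditional means; it follows from the orthogonality of the
increments. -/
theorem tendsto_martingale_sq {G : ℕ → Ω → List ℝ → ℝ} (hG : ∀ i, M.Adapted i (G i)) {C : ℝ}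
    (hC : ∀ᵐ ω ∂P, ∀ i, M.Growth C (G i ω)) :
    ∀ᵐ ω ∂P, Tendsto (fun k : ℕ => (∑ i ∈ Finset.range (k ^ 2),
      (G i ω ((M.block i ω).map M.v) - M.blockMean (G i ω))) / ((k ^ 2 : ℕ) : ℝ))
      atTop (nhds 0) := by
  obtain ⟨Q, hQ⟩ := memLp_deviation hG hC
  have hNA : ∀ n, M.Adapted n (fun ω => ∑ i ∈ Finset.range n, M.deviation G i ω) := fun n =>
    Adapted.sum fun i hi => (adapted_deviation hG i).mono (Finset.mem_range.1 hi)
  have hNL : ∀ n, MemLp (fun ω => ∑ i ∈ Finset.range n, M.deviation G i ω) 2 P := fun n =>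
    memLp_finsetSum _ fun i _ => (hQ i).1
  have horth : ∀ n, ∫ ω, (∑ i ∈ Finset.range n, M.deviation G i ω) * M.deviation G n ω ∂P = 0 :=
    fun n => integral_mul_deviation hG hC (hNA n) ((hNL n).integrable_mul (hQ n).1)
  have hN2 := integral_sum_sq_le (fun i => (hQ i).1) (fun i => (hQ i).2) horth
  filter_upwards [tendsto_sq_div_of_integral_sq_le hNL hN2] with ω hω
  simpa only [deviation] using hω

/-- Along almost every path on which a process eventually follows a stationary policy, the average
cost converges to the constant of the policy evaluation. -/
theorem IsSelection.tendsto_cost (hS : M.IsSelection S) {K L : ℕ} (hK : 0 < K)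
    (hage : ∀ᵐ ω ∂P, ∀ i, M.T i ω - S i ω < L) {s : List ℝ → ℕ} (hs : M.IsPolicy K s)
    {α β : ℝ} (hα : 0 ≤ α) (hβ : 0 ≤ β) {h : List ℝ → ℝ} {lam : ℝ}
    (he : ∀ b, M.IsState K b → h b + lam = M.stepCost α β K h b (s b)) :
    ∀ᵐ ω ∂P, (∀ᶠ i in atTop, M.Follows K s S i ω) →
      Tendsto (fun n : ℕ => (∑ i ∈ Finset.range n, (α * M.skipped S (i + 1) ω +
        β * ((M.T (i + 1) ω : ℝ) - S (i + 1) ω))) / n) atTop (nhds lam) := by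
  -- `hstep` below: the cost of a step is `lam`, plus a martingale difference, plus a telescoping
  -- difference of a bounded function
  obtain ⟨C, hC⟩ := M.exists_growth_extend α K h
  have hlen : ∀ᵐ ω ∂P, ∀ i, ((M.rest S i ω).length : ℝ) ≤ L := by
    filter_upwards [hage] with ω hω i
    rw [length_rest]
    exact_mod_cast (hω i).le
  have hm := tendsto_martingale_sq (M := M) (G := fun i ω w => extend α K h (M.rest S i ω ++ w))
    (fun i => (hS.adapted_rest i).comp fun c w => extend α K h (c ++ w)) (C := C * (1 + L)) (by
      filter_upwards [hlen] with ω hω i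
      refine (hC.append (M.isWord_rest i ω)).mono (mul_le_mul_of_nonneg_left ?_ hC.nonneg)
      linarith [hω i])
  filter_upwards [hm, hlen, hS.le_T, M.ae_Z_pos] with ω hω hl hT hZ hf
  set cost : ℕ → ℝ := fun i => α * M.skipped S (i + 1) ω +
    β * ((M.T (i + 1) ω : ℝ) - S (i + 1) ω) with hcost
  set g : ℕ → ℝ := fun i => M.blockMean fun w => extend α K h (M.rest S i ω ++ w) with hg
  set ξ : ℕ → ℝ := fun i => extend α K h (M.rest S i ω ++ (M.block i ω).map M.v) - g i with hξ
  obtain ⟨m, hm'⟩ := eventually_atTop.1 hf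
  have hcost0 : ∀ i, 0 ≤ cost i := fun i => by
    rw [hcost]
    simp only
    rw [← Nat.cast_sub (hT i).2.1]
    exact add_nonneg (mul_nonneg hα (skipped_nonneg _ _)) (by positivity)
  have hstep : ∀ i, m ≤ i → cost i = lam + ξ i + g i - g (i + 1) := by
    intro i hi
    have := (hm' i hi).extend_add hK hs he (hZ i) (hT i).2.2
    rw [M.avail_eq (hT i).2.2] at this
    simp only [hcost, hξ, hg]
    linarith
  have hgb : ∀ i, |g i| ≤ C * (1 + L + M.mu) := by
    intro i
    refine (abs_blockMean_append_le hC (M.isWord_rest i ω)).trans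
      (mul_le_mul_of_nonneg_left ?_ hC.nonneg)
    linarith [hl i]
  -- the finitely many steps that do not follow the policy contribute a constant
  set E : ℝ := ∑ i ∈ Finset.range m, cost i - (m * lam + ∑ i ∈ Finset.range m, ξ i - g m) with hE
  have hsum : ∀ n, m ≤ n → ∑ i ∈ Finset.range n, cost i =
      n * lam + ∑ i ∈ Finset.range n, ξ i + (E - g n) := by
    intro n hn
    induction n, hn using Nat.le_induction with
    | base =>
      rw [hE]
      ring
    | succ n hn ih =>
      rw [Finset.sum_range_succ, Finset.sum_range_succ, ih, hstep n hn]
      push_cast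
      ring
  refine tendsto_div_of_sq (u := fun n => ∑ i ∈ Finset.range n, cost i)
    (monotone_nat_of_le_succ fun n => by
      rw [Finset.sum_range_succ]
      exact le_add_of_nonneg_right (hcost0 n)) ?_
  have hsq : Tendsto (fun k : ℕ => k ^ 2) atTop atTop := tendsto_pow_atTop (by norm_num)
  have hz : Tendsto (fun k : ℕ => (E - g (k ^ 2)) / ((k ^ 2 : ℕ) : ℝ)) atTop (nhds 0) := by
    refine squeeze_zero_norm (a := fun k : ℕ => (|E| + C * (1 + L + M.mu)) / ((k ^ 2 : ℕ) : ℝ))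
      (fun k => ?_) ((tendsto_const_div_atTop_nhds_zero_nat _).comp hsq)
    rw [norm_div, Real.norm_eq_abs, Real.norm_eq_abs, Nat.abs_cast]
    refine div_le_div_of_nonneg_right ((abs_sub _ _).trans ?_) (Nat.cast_nonneg _)
    linarith [hgb (k ^ 2)]
  have hlim := ((tendsto_const_nhds (x := lam)).add hω).add hz
  rw [add_zero, add_zero] at hlim
  refine hlim.congr' ?_
  filter_upwards [hsq.eventually_ge_atTop m, eventually_gt_atTop 0] with k hk hk0
  have hk0' : (k : ℝ) ≠ 0 := by exact_mod_cast hk0.ne'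
  rw [hsum _ hk]
  push_cast
  field_simp

/-- If the ages are bounded and their averages converge, the excess age is the limit. -/
theorem IsSelection.tendsto_age (hS : M.IsSelection S) {K : ℕ}
    (hage : ∀ᵐ ω ∂P, ∀ i, M.T i ω - S i ω < K) :
    ∀ᵐ ω ∂P, ∀ a : ℝ, Tendsto (fun n : ℕ => (∑ i ∈ Finset.range n,
        ((M.T (i + 1) ω : ℝ) - S (i + 1) ω)) / n) atTop (nhds a) →
      Tendsto (fun n : ℕ => 1 / M.mu * (1 / (n : ℝ) *
        ∑ j ∈ Finset.Icc 1 n, ((M.T j ω : ℝ) - S j ω) * M.Z (j + 1) ω)) atTop (nhds a) := by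
  have hmu := M.mu_pos
  have hm := tendsto_martingale_sq (M := M)
    (G := fun i ω w => ((M.T i ω : ℝ) - S i ω) * w.length)
    (fun i => ((M.adapted_T le_rfl).comp₂ (hS.adapted le_rfl) fun a b => (a : ℝ) - b).comp
      fun c (w : List ℝ) => c * w.length) (C := K) (by
      filter_upwards [hage, hS.le_T] with ω hω hT i u _
      rw [← Nat.cast_sub (hT i).2.2, abs_of_nonneg (by positivity)]
      have : ((M.T i ω - S i ω : ℕ) : ℝ) ≤ K := by exact_mod_cast (hω i).le
      exact mul_le_mul this (by linarith) (by positivity) (by positivity))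
  filter_upwards [hm, hS.le_T] with ω hω hT a ha
  set A : ℕ → ℝ := fun i => (M.T i ω : ℝ) - S i ω with hA
  have hA0 : ∀ i, 0 ≤ A i := fun i => by
    rw [hA]
    simp only
    rw [← Nat.cast_sub (hT i).2.2]
    positivity
  have hA00 : A 0 = 0 := by simp [hA, T_zero, hS.1]
  have h1 : Tendsto (fun n : ℕ => (∑ i ∈ Finset.range n, A i) / n) atTop (nhds a) := by
    refine tendsto_shift_div.1 (ha.congr fun n => ?_)
    rw [Finset.sum_range_succ', hA00, add_zero]
  have hsq : Tendsto (fun k : ℕ => k ^ 2) atTop atTop := tendsto_pow_atTop (by norm_num)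
  have h2 : Tendsto (fun n : ℕ => (∑ i ∈ Finset.range n, A i * M.Z (i + 1) ω) / n) atTop
      (nhds (M.mu * a)) := by
    refine tendsto_div_of_sq (u := fun n => ∑ i ∈ Finset.range n, A i * M.Z (i + 1) ω)
      (monotone_nat_of_le_succ fun n => by
        rw [Finset.sum_range_succ]
        exact le_add_of_nonneg_right (mul_nonneg (hA0 n) (Nat.cast_nonneg _))) ?_
    have h3 := hω.add ((h1.comp hsq).const_mul M.mu)
    rw [zero_add] at h3
    refine h3.congr fun k => ?_
    have e : ∀ i, M.blockMean (fun w => ((M.T i ω : ℝ) - S i ω) * w.length) = A i * M.mu := by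
      intro i
      simp only [hA]
      rw [blockMean_const_mul, blockMean]
      simp only [length_segment_one_Z]
      rfl
    simp only [e]
    simp only [Function.comp_apply, List.length_map, length_block, Finset.sum_sub_distrib,
      ← Finset.sum_mul]
    change (∑ i ∈ Finset.range (k ^ 2), A i * (M.Z (i + 1) ω : ℝ) - _) / _ + _ = _
    ring
  have h4 := (tendsto_shift_div.2 h2).const_mul (1 / M.mu)
  rw [← mul_assoc, one_div_mul_cancel hmu.ne', one_mul] at h4
  refine h4.congr fun n => ?_
  rw [sum_Icc_one_eq, Finset.sum_range_succ', hA00, zero_mul, add_zero]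
  ring

/-- If the ages are bounded, the distortion is at most the limit of the average penalty per speaking
time, divided by `μ`. -/
theorem IsSelection.limsup_distortion_le (hS : M.IsSelection S) {K : ℕ}
    (hage : ∀ᵐ ω ∂P, ∀ i, M.T i ω - S i ω < K) :
    ∀ᵐ ω ∂P, ∀ a : ℝ, Tendsto (fun n : ℕ => (∑ i ∈ Finset.range n,
        M.skipped S (i + 1) ω) / n) atTop (nhds a) →
      limsup (fun t : ℕ => ENNReal.ofReal ((1 / (t : ℝ)) *
        ∑ j ∈ Finset.Icc 1 t, M.d (M.X j ω) (M.Y S t j ω))) atTop ≤ ENNReal.ofReal (a / M.mu) := by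
  have hmu := M.mu_pos
  have hv := M.vMax_nonneg
  filter_upwards [hage, hS.le_T, M.ae_Z_pos, tendsto_T_div (M := M)] with ω hω hT hZ hTn a ha
  set g : ℕ → ℝ := fun n => (∑ i ∈ Finset.range n, M.skipped S (i + 1) ω +
    M.vMax * (K + ((M.T (n + 1) ω : ℝ) - M.T n ω))) / M.T n ω with hg
  have hglim : Tendsto g atTop (nhds (a / M.mu)) := by
    have h1 : Tendsto (fun n : ℕ => M.vMax * (K / (n : ℝ) +
        ((M.T (n + 1) ω : ℝ) / n - M.T n ω / n))) atTop (nhds 0) := by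
      have h2 := tendsto_shift_div.2 hTn
      have := ((tendsto_const_div_atTop_nhds_zero_nat (K : ℝ)).add (h2.sub hTn)).const_mul M.vMax
      simpa using this
    have h3 := (ha.add h1).div hTn hmu.ne'
    rw [add_zero] at h3
    refine h3.congr' ((eventually_gt_atTop 0).mono fun n hn => ?_)
    have hn' : (n : ℝ) ≠ 0 := by exact_mod_cast hn.ne'
    have hT0 : (M.T n ω : ℝ) ≠ 0 := by
      have := M.le_T ω hZ n
      exact_mod_cast (by omega : M.T n ω ≠ 0)
    simp only [hg, Pi.div_apply]
    field_simp
  refine le_of_forall_gt_imp_ge_of_dense fun b hb => ?_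
  rcases eq_or_ne b ⊤ with rfl | hbt
  · exact le_top
  have hb' : a / M.mu < b.toReal := by
    rw [← ENNReal.ofReal_toReal hbt] at hb
    exact lt_of_not_ge fun hle => absurd (ENNReal.ofReal_le_ofReal hle) (not_le.2 hb)
  obtain ⟨m, hm⟩ := eventually_atTop.1 (hglim.eventually_le_const hb')
  refine limsup_le_of_le (h := (eventually_gt_atTop (M.T (m + 1) ω)).mono fun t ht => ?_)
  have hex : ∃ n, t ≤ M.T (n + 1) ω := ⟨t, (Nat.le_succ t).trans (M.le_T ω hZ (t + 1))⟩
  classical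
  set n := Nat.find hex with hn
  have hn1 : t ≤ M.T (n + 1) ω := Nat.find_spec hex
  have hmn : m < n := by
    by_contra hmn
    have : M.T (n + 1) ω ≤ M.T (m + 1) ω := M.T_mono ω (by omega)
    omega
  have hn2 : M.T n ω < t := by
    have := Nat.find_min hex (m := n - 1) (by omega)
    rw [Nat.sub_add_cancel (by omega)] at this
    omega
  have hT0 : (0 : ℝ) < M.T n ω := by
    have := M.le_T ω hZ n
    exact_mod_cast (by omega : 0 < M.T n ω)
  refine (ENNReal.ofReal_le_ofReal ?_).trans (ENNReal.ofReal_toReal hbt).le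
  refine le_trans ?_ (hm n hmn.le)
  have hskip0 : 0 ≤ ∑ i ∈ Finset.range n, M.skipped S (i + 1) ω :=
    Finset.sum_nonneg fun i _ => skipped_nonneg _ _
  have hVsum : ∑ j ∈ Finset.Ico (S n ω + 1) (t + 1), M.V j ω ≤
      M.vMax * (K + ((M.T (n + 1) ω : ℝ) - M.T n ω)) := by
    have h1 := Finset.sum_le_card_nsmul (Finset.Ico (S n ω + 1) (t + 1)) (fun j => M.V j ω) M.vMax
      fun j _ => M.le_vMax _
    rw [nsmul_eq_mul, Nat.card_Ico, mul_comm] at h1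
    refine h1.trans (mul_le_mul_of_nonneg_left ?_ hv)
    have h2 := hω n
    have h3 := M.T_mono ω (Nat.le_succ n)
    simp only at h3
    rw [← Nat.cast_sub h3]
    have h4 := (hT n).2.2
    exact_mod_cast (by omega : t + 1 - (S n ω + 1) ≤ K + (M.T (n + 1) ω - M.T n ω))
  rw [sum_distortion_eq hZ hT (hS.1 ω) hn2 hn1, one_div_mul_eq_div]
  have hb0 : 0 ≤ ∑ j ∈ Finset.Ico (S n ω + 1) (t + 1), M.V j ω :=
    Finset.sum_nonneg fun j _ => M.V_nonneg _ _
  exact div_le_div₀ (by linarith) (by linarith) hT0 (by exact_mod_cast hn2.le)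

/-- The rates of the stationary policy `s`: the excess age is `a`, and the distortion is at most
`δ`, along almost every path on which a process with bounded ages eventually follows the policy,
whatever it does before. -/
def HasRates (M : Model P 𝒳) (K : ℕ) (s : List ℝ → ℕ) (a δ : ℝ) : Prop :=
  0 ≤ a ∧ 0 ≤ δ ∧ ∀ S, M.IsSelection S → ∀ L, (∀ᵐ ω ∂P, ∀ i, M.T i ω - S i ω < L) →
    ∀ᵐ ω ∂P, (∀ᶠ i in atTop, M.Follows K s S i ω) →
      limsup (fun t : ℕ => ENNReal.ofReal ((1 / (t : ℝ)) *
        ∑ j ∈ Finset.Icc 1 t, M.d (M.X j ω) (M.Y S t j ω))) atTop ≤ ENNReal.ofReal δ ∧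
      limsup (fun i : ℕ => ENNReal.ofReal ((1 / M.mu) * ((1 / (i : ℝ)) *
        ∑ j ∈ Finset.Icc 1 i, ((M.T j ω : ℝ) - S j ω) * M.Z (j + 1) ω))) atTop =
          ENNReal.ofReal a

/-- Every policy has rates, and for every `η` the constant of its evaluation is their weighted
sum. They are the constants of the evaluations for the two parts of the cost alone. -/
theorem exists_hasRates {K : ℕ} (hK : 0 < K) {s : List ℝ → ℕ} (hs : M.IsPolicy K s) :
    ∃ a δ : ℝ, M.HasRates K s a δ ∧
      ∀ η lam : ℝ, ∀ h : List ℝ → ℝ,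
        (∀ b, M.IsState K b → h b + lam = M.stepCost (1 / M.mu) η K h b (s b)) →
        lam = δ + η * a := by
  have hmu := M.mu_pos
  obtain ⟨hA, a, hA0, heA⟩ := M.exists_evaluation 0 1 hK hs
  obtain ⟨hV, c, hV0, heV⟩ := M.exists_evaluation 1 0 hK hs
  have hlimA := fun S (hS : M.IsSelection S) (L : ℕ) (hage : ∀ᵐ ω ∂P, ∀ i, M.T i ω - S i ω < L) =>
    hS.tendsto_cost hK hage hs le_rfl zero_le_one heA
  have hlimV := fun S (hS : M.IsSelection S) (L : ℕ) (hage : ∀ᵐ ω ∂P, ∀ i, M.T i ω - S i ω < L) =>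
    hS.tendsto_cost hK hage hs zero_le_one le_rfl heV
  simp only [zero_mul, zero_add, one_mul, add_zero] at hlimA hlimV
  obtain ⟨hR, hage⟩ := isRestrictedSelection_inducedSelection (M := M) hK hs
  have hfol : ∀ ω, ∀ᶠ i in atTop, M.Follows K s (M.inducedSelection K s) i ω :=
    fun ω => Eventually.of_forall fun i => follows_inducedSelection K s i ω
  have hnn : 0 ≤ a ∧ 0 ≤ c := by
    obtain ⟨ω, h1, h2, h3⟩ :=
      ((hlimA _ hR.1 K hage).and ((hlimV _ hR.1 K hage).and hR.1.le_T)).exists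
    refine ⟨ge_of_tendsto' (h1 (hfol ω)) fun n => div_nonneg
      (Finset.sum_nonneg fun i _ => ?_) (Nat.cast_nonneg _),
      ge_of_tendsto' (h2 (hfol ω)) fun n => div_nonneg
      (Finset.sum_nonneg fun i _ => skipped_nonneg _ _) (Nat.cast_nonneg _)⟩
    rw [← Nat.cast_sub (h3 i).2.1]
    positivity
  refine ⟨a, c / M.mu, ⟨hnn.1, div_nonneg hnn.2 hmu.le, fun S hS L hage => ?_⟩,
    fun η lam h he => ?_⟩
  rotate_left
  · have hlin : ∀ b, M.IsState K b →
        (1 / M.mu * hV b + η * hA b + (h [M.vMin])) + (1 / M.mu * c + η * a) =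
          M.stepCost (1 / M.mu) η K (fun b => 1 / M.mu * hV b + η * hA b + (h [M.vMin])) b
            (s b) := by
      intro b hb
      obtain ⟨C, hC⟩ := M.exists_growth_extend 1 K hV
      obtain ⟨D, hD⟩ := M.exists_growth_extend 0 K hA
      have hw := hb.isWord.drop (s b)
      have h1 := heV b hb
      have h2 := heA b hb
      have h3 : M.blockMean (fun w => extend (1 / M.mu) K
          (fun b => 1 / M.mu * hV b + η * hA b + (h [M.vMin])) (b.drop (s b) ++ w)) =
          h [M.vMin] + (1 / M.mu * M.blockMean (fun w => extend 1 K hV (b.drop (s b) ++ w)) +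
            η * M.blockMean (fun w => extend 0 K hA (b.drop (s b) ++ w))) := by
        have g1 := (hC.append hw).const_mul (1 / M.mu)
        have g2 := (hD.append hw).const_mul η
        rw [← blockMean_const_mul, ← blockMean_const_mul, ← blockMean_add g1 g2,
          ← blockMean_const_add (g1.add g2)]
        congr 1
        ext w
        simp only [extend]
        ring
      rw [stepCost] at h1 h2 ⊢
      rw [h3]
      linear_combination (1 / M.mu) * h1 + η * h2
    have := (M.evaluation_unique (1 / M.mu) η hK hs
      (h' := fun b => 1 / M.mu * hV b + η * hA b + (h [M.vMin])) (by simp [hV0, hA0]) he hlin).1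
    rw [this]
    ring
  · filter_upwards [hlimA S hS L hage, hlimV S hS L hage, hS.tendsto_age hage,
      hS.limsup_distortion_le hage] with ω h1 h2 h3 h4 hf
    refine ⟨h4 c (h2 hf), ?_⟩
    exact ((ENNReal.continuous_ofReal.tendsto a).comp (h3 a (h1 hf))).limsup_eq

end Model
end AgeDistortion

namespace AgeDistortion
namespace Model

variable {Ω : Type*} [MeasurableSpace Ω] {P : Measure Ω} {𝒳 : Type*} [MeasurableSpace 𝒳]
variable {M : Model P 𝒳} [Finite 𝒳] [MeasurableSingletonClass 𝒳] [IsProbabilityMeasure P]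

/-! ### Optimality of the output of policy iteration -/

theorem HasRates.inducedSelection {K : ℕ} (hK : 0 < K) {s : List ℝ → ℕ} (hs : M.IsPolicy K s)
    {a δ : ℝ} (hr : M.HasRates K s a δ) :
    M.distortion (M.inducedSelection K s) ≤ ENNReal.ofReal δ ∧
      M.excessAge (M.inducedSelection K s) = ENNReal.ofReal a := by
  obtain ⟨hR, hage⟩ := isRestrictedSelection_inducedSelection (M := M) hK hs
  have h := hr.2.2 _ hR.1 K hage
  have hf : ∀ ω, ∀ᶠ i in atTop, M.Follows K s (M.inducedSelection K s) i ω :=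
    fun ω => Eventually.of_forall fun i => follows_inducedSelection K s i ω
  constructor
  · calc M.distortion (M.inducedSelection K s) ≤ ∫⁻ _, ENNReal.ofReal δ ∂P :=
        lintegral_mono_ae (h.mono fun ω hω => (hω (hf ω)).1)
      _ = ENNReal.ofReal δ := by simp
  · calc M.excessAge (M.inducedSelection K s) = ∫⁻ _, ENNReal.ofReal a ∂P :=
        lintegral_congr_ae (h.mono fun ω hω => (hω (hf ω)).2)
      _ = ENNReal.ofReal a := by simp

/-- A policy whose evaluation solves the optimality equation is optimal, also for the untruncated
problem and for the weighted sum of distortion and excess age. -/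
theorem optimal_of_optimality {η : ℝ} (hη : 0 < η) {s : List ℝ → ℕ}
    (hs : M.IsPolicy (M.bufferSize η) s) {h : List ℝ → ℝ} {lam : ℝ}
    (he : ∀ b, M.IsState (M.bufferSize η) b →
      h b + lam = M.stepCost (1 / M.mu) η (M.bufferSize η) h b (s b))
    (hopt : ∀ b, M.IsState (M.bufferSize η) b → ∀ a ∈ M.actions b,
      h b + lam ≤ M.stepCost (1 / M.mu) η (M.bufferSize η) h b a) :
    M.IsRestrictedSelection (M.inducedSelection (M.bufferSize η) s) ∧
      M.avgCost η (M.inducedSelection (M.bufferSize η) s) = M.optCost η ∧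
      0 ≤ lam ∧ M.optCost η = ENNReal.ofReal lam ∧
      M.distortion (M.inducedSelection (M.bufferSize η) s) +
        ENNReal.ofReal η * M.excessAge (M.inducedSelection (M.bufferSize η) s) = M.optCost η := by
  have hK := M.bufferSize_pos hη
  have hKη := M.le_bufferSize hη
  have hR := (isRestrictedSelection_inducedSelection (M := M) hK hs).1
  obtain ⟨hlam, havg⟩ := avgCost_inducedSelection hη hK hs he
  have hJ : M.optCost η = ENNReal.ofReal lam :=
    le_antisymm ((iInf₂_le _ hR).trans_eq havg)
      (le_iInf₂ fun S hS => hS.le_avgCost hη hK hKη hopt)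
  refine ⟨hR, havg.trans hJ.symm, hlam, hJ, ?_⟩
  rw [hJ]
  refine le_antisymm ?_ (hR.1.le_distortion_add hη hK hKη hopt)
  obtain ⟨a, δ, hr, hlin⟩ := M.exists_hasRates hK hs
  obtain ⟨hD, hA⟩ := hr.inducedSelection hK hs
  rw [hA, hlin η lam h he, ENNReal.ofReal_add hr.2.1 (mul_nonneg hη.le hr.1),
    ENNReal.ofReal_mul hη.le]
  gcongr

/-- With a buffer of size one the selected packets are the most recent ones, so that the excess age
vanishes. -/
theorem HasRates.age_eq_zero {s : List ℝ → ℕ} (hs : M.IsPolicy 1 s) {a δ : ℝ}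
    (hr : M.HasRates 1 s a δ) : a = 0 := by
  obtain ⟨hR, hage⟩ := isRestrictedSelection_inducedSelection (M := M) one_pos hs
  have h1 := (hr.inducedSelection one_pos hs).2
  have h0 : M.excessAge (M.inducedSelection 1 s) = 0 := by
    have : ∀ᵐ ω ∂P, limsup (fun i : ℕ => ENNReal.ofReal ((1 / M.mu) * ((1 / (i : ℝ)) *
        ∑ j ∈ Finset.Icc 1 i, ((M.T j ω : ℝ) - M.inducedSelection 1 s j ω) * M.Z (j + 1) ω)))
          atTop = 0 := by
      filter_upwards [hage, hR.1.le_T] with ω hω hT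
      have e : ∀ j, (M.T j ω : ℝ) - M.inducedSelection 1 s j ω = 0 := fun j => by
        rw [← Nat.cast_sub (hT j).2.2, Nat.lt_one_iff.1 (hω j), Nat.cast_zero]
      simp [e]
    rw [excessAge, lintegral_congr_ae this, lintegral_zero]
  rw [h0] at h1
  exact le_antisymm (ENNReal.ofReal_eq_zero.1 h1.symm) hr.1

/-- The optimal policy for the weight `η`: the optimal cost is the weighted sum of its rates, and a
lower bound for the weighted sum of distortion and excess age of all selection processes. -/
theorem exists_optimal_rates (M : Model P 𝒳) {η : ℝ} (hη : 0 < η) :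
    ∃ s a δ, M.IsPolicy (M.bufferSize η) s ∧ M.HasRates (M.bufferSize η) s a δ ∧
      (M.optCost η).toReal = δ + η * a ∧
      ∀ S, M.IsSelection S → ENNReal.ofReal (M.optCost η).toReal ≤
        M.distortion S + ENNReal.ofReal η * M.excessAge S := by
  have hK := M.bufferSize_pos hη
  obtain ⟨s, h, lam, hpi, hties⟩ := M.exists_policyIteration η hK
  obtain ⟨n, hn⟩ := M.policyIteration_stops hK hpi hties
  have hopt := fun b hb a ha =>
    M.optimality_of_stopsAt (b := b) hpi hn hb (a := a) ha
  obtain ⟨-, -, hlam, hJ, -⟩ :=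
    optimal_of_optimality hη (hpi.isPolicy n) (hpi.2.1 n).2 hopt
  obtain ⟨a, δ, hr, hlin⟩ := M.exists_hasRates hK (hpi.isPolicy n)
  have e : (M.optCost η).toReal = lam n := by rw [hJ, ENNReal.toReal_ofReal hlam]
  refine ⟨s n, a, δ, hpi.isPolicy n, hr, e.trans (hlin η _ _ (hpi.2.1 n).2), fun S hS => ?_⟩
  rw [e]
  exact hS.le_distortion_add hη hK (M.le_bufferSize hη) hopt

/-! ### Random mixtures of two policies -/

/-- Nonnegative weights that are at most `ε` have partial sums in every interval of length `ε` up to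
their total. -/
theorem exists_subset_sum_mem {ι : Type*} (s : Finset ι) {w : ι → ℝ} {ε θ : ℝ}
    (hw : ∀ i ∈ s, w i ≤ ε) (hθ : 0 ≤ θ) (hs : θ ≤ ∑ i ∈ s, w i) (hε : 0 ≤ ε) :
    ∃ t ⊆ s, θ - ε ≤ ∑ i ∈ t, w i ∧ ∑ i ∈ t, w i ≤ θ := by
  classical
  induction s using Finset.induction_on with
  | empty => exact ⟨∅, subset_rfl, by simp at hs ⊢; linarith, by simpa using hθ⟩
  | insert i s hi ih =>
    by_cases h : θ ≤ ∑ i ∈ s, w i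
    · obtain ⟨t, ht, h1⟩ := ih (fun j hj => hw j (Finset.mem_insert_of_mem hj)) h
      exact ⟨t, ht.trans (Finset.subset_insert _ _), h1⟩
    · refine ⟨s, Finset.subset_insert _ _, ?_, (not_le.1 h).le⟩
      rw [Finset.sum_insert hi] at hs
      linarith [hw i (Finset.mem_insert_self _ _)]

/-- Events that depend on finitely many packets have probabilities that are dense in `[0, 1]`,
because long words of independent nondegenerate variables have small probabilities. -/
theorem exists_event_prob (M : Model P 𝒳) {θ ε : ℝ} (h0 : 0 ≤ θ) (h1 : θ ≤ 1) (hε : 0 < ε) :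
    ∃ (N : ℕ) (G : Set (List ℝ)), MeasurableSet {ω | M.segment 1 N ω ∈ G} ∧
      θ - ε ≤ P.real {ω | M.segment 1 N ω ∈ G} ∧ P.real {ω | M.segment 1 N ω ∈ G} ≤ θ := by
  classical
  -- the probability that a packet has minimal importance lies strictly between zero and one
  let f : ℕ → Ω → Bool := fun t ω => decide (M.V (t + 1) ω = M.vMin)
  have hg : Measurable fun x : 𝒳 => decide (M.v x = M.vMin) := Measurable.of_discrete
  have hfm : ∀ t, Measurable (f t) := fun t => hg.comp (M.measurable_X (t + 1) (by omega))
  have hfi : iIndepFun f P := M.indep_X.comp (fun _ x => decide (M.v x = M.vMin)) fun _ => hg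
  have hfd : ∀ t, IdentDistrib (f t) (f 0) P P := fun t => (M.ident_X (t + 1) (by omega)).comp hg
  have hlt : ∀ b, P.real {ω | f 0 ω = b} < 1 := by
    intro b
    have hpos : 0 < P.real {ω | f 0 ω = !b} := by
      obtain ⟨x, hx⟩ : ∃ x, decide (M.v x = M.vMin) = !b := by
        cases b
        · obtain ⟨x, hx⟩ := M.exists_v_eq_vMin
          exact ⟨x, by simpa using hx⟩
        · by_contra hcon
          push Not at hcon
          obtain ⟨x, y, hxy⟩ := M.nontrivial_values
          have hc : ∀ x, M.v x = M.vMin := fun x => by simpa using hcon x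
          exact hxy ((hc x).trans (hc y).symm)
      refine ENNReal.toReal_pos (ne_of_gt ((M.value_pos x).trans_le (measure_mono fun ω hω => ?_)))
        (measure_ne_top _ _)
      rw [← hx]
      have hω' : M.v (M.X 1 ω) = M.v x := hω
      simp only [Set.mem_ofPred_eq, f, V, zero_add, hω']
    have hm : MeasurableSet {ω | f 0 ω = b} := hfm 0 (measurableSet_singleton b)
    have hc := probReal_compl_eq_one_sub (μ := P) hm
    rw [show {ω | f 0 ω = b}ᶜ = {ω | f 0 ω = !b} by
      ext ω
      cases b <;> cases f 0 ω <;> simp] at hc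
    linarith
  obtain ⟨r, hr0, hr1, hr⟩ : ∃ r : ℝ, 0 ≤ r ∧ r < 1 ∧ ∀ b, P.real {ω | f 0 ω = b} ≤ r :=
    ⟨max (P.real {ω | f 0 ω = true}) (P.real {ω | f 0 ω = false}),
      measureReal_nonneg.trans (le_max_left _ _), max_lt (hlt _) (hlt _), fun b => by
        cases b
        · exact le_max_right _ _
        · exact le_max_left _ _⟩
  obtain ⟨N, hN⟩ := exists_pow_lt_of_lt_one hε hr1
  let F : Ω → Fin N → Bool := fun ω t => f t ω
  have hF : Measurable F := measurable_pi_iff.2 fun t => hfm t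
  have hatom : ∀ w : Fin N → Bool, P.real (F ⁻¹' {w}) ≤ ε := by
    intro w
    have e : P (F ⁻¹' {w}) = ∏ t : Fin N, P {ω | f t ω = w t} := by
      have := (hfi.precomp Fin.val_injective
        (g := fun t : Fin N => (t : ℕ))).measure_inter_preimage_eq_mul Finset.univ
          (sets := fun t => {w t}) fun t _ => measurableSet_singleton _
      rw [show F ⁻¹' {w} = ⋂ t ∈ Finset.univ, f (t : Fin N) ⁻¹' {w t} by
        ext ω
        simp [F, funext_iff]]
      exact this
    rw [measureReal_def, e, ENNReal.toReal_prod]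
    refine le_trans ?_ hN.le
    calc ∏ t : Fin N, (P {ω | f t ω = w t}).toReal ≤ ∏ _t : Fin N, r := by
          refine Finset.prod_le_prod (fun _ _ => ENNReal.toReal_nonneg) fun t _ => ?_
          have := (hfd t).measure_mem_eq (measurableSet_singleton (w t))
          exact (congrArg ENNReal.toReal this).trans_le (hr (w t))
      _ = r ^ N := by simp
  have hsum : ∀ t : Finset (Fin N → Bool), ∑ w ∈ t, P.real (F ⁻¹' {w}) = P.real (F ⁻¹' t) :=
    fun t => sum_measureReal_preimage_singleton t fun w _ => hF (measurableSet_singleton w)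
  obtain ⟨t, -, ht1, ht2⟩ := exists_subset_sum_mem Finset.univ (w := fun w => P.real (F ⁻¹' {w}))
    (fun w _ => hatom w) h0 (by rw [hsum]; simpa using h1) hε.le
  rw [hsum] at ht1 ht2
  have e : {ω | M.segment 1 N ω ∈ {l : List ℝ |
      (fun t : Fin N => decide (l[(t : ℕ)]? = some M.vMin)) ∈ t}} = F ⁻¹' t := by
    ext ω
    have : (fun t : Fin N => decide ((M.segment 1 N ω)[(t : ℕ)]? = some M.vMin)) = F ω := by
      funext i
      rw [M.segment_getElem? 1 N i ω (by omega)]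
      simp [F, f, add_comm]
    simp [this]
  refine ⟨N, {l | (fun t : Fin N => decide (l[(t : ℕ)]? = some M.vMin)) ∈ t}, ?_⟩
  rw [e]
  exact ⟨hF (Finset.measurableSet t), ht1, ht2⟩

/-- A selection process that follows one of two policies, depending on an event of the first
packets, has at most the corresponding convex combinations of their rates. -/
theorem exists_mixture {K₁ K₂ : ℕ} (hK₁ : 0 < K₁) (hK₂ : 0 < K₂) {s₁ s₂ : List ℝ → ℕ}
    (hs₁ : M.IsPolicy K₁ s₁) (hs₂ : M.IsPolicy K₂ s₂) {a₁ δ₁ a₂ δ₂ : ℝ}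
    (hr₁ : M.HasRates K₁ s₁ a₁ δ₁) (hr₂ : M.HasRates K₂ s₂ a₂ δ₂) {N : ℕ} {G : Set (List ℝ)}
    (hG : MeasurableSet {ω | M.segment 1 N ω ∈ G}) {p : ℝ}
    (hp : P.real {ω | M.segment 1 N ω ∈ G} = p) :
    ∃ S, M.IsSelection S ∧ M.distortion S ≤ ENNReal.ofReal (p * δ₁ + (1 - p) * δ₂) ∧
      M.excessAge S ≤ ENNReal.ofReal (p * a₁ + (1 - p) * a₂) := by
  classical
  let ρ : List ℕ → List ℝ → ℕ → ℕ := fun _ Vs q =>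
    if Vs.take N ∈ G then policyRule K₁ s₁ Vs q else policyRule K₂ s₂ Vs q
  have hρ : ∀ i ω, if (M.segment 1 (M.T (i + 1) ω) ω).take N ∈ G
      then M.Follows K₁ s₁ (M.ruleSelection ρ) i ω
      else M.Follows K₂ s₂ (M.ruleSelection ρ) i ω := by
    intro i ω
    split_ifs with h
    · rw [Follows, ← policyRule_segment, ruleSelection]
      exact if_pos h
    · rw [Follows, ← policyRule_segment, ruleSelection]
      exact if_neg h
  obtain ⟨hR, hage⟩ := isRestrictedSelection_ruleSelection (M := M) (ρ := ρ) (K := max K₁ K₂)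
    (lt_max_of_lt_left hK₁) fun i ω => by
      have := hρ i ω
      split_ifs at this
      · exact ⟨K₁, s₁, hK₁, le_max_left _ _, hs₁, this⟩
      · exact ⟨K₂, s₂, hK₂, le_max_right _ _, hs₂, this⟩
  have hev : ∀ᵐ ω ∂P, if M.segment 1 N ω ∈ G
      then ∀ᶠ i in atTop, M.Follows K₁ s₁ (M.ruleSelection ρ) i ω
      else ∀ᶠ i in atTop, M.Follows K₂ s₂ (M.ruleSelection ρ) i ω := by
    filter_upwards [M.ae_Z_pos] with ω hZ
    have e : ∀ i, N ≤ i → (M.segment 1 (M.T (i + 1) ω) ω).take N = M.segment 1 N ω := by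
      intro i hi
      have := M.le_T ω hZ (i + 1)
      rw [M.segment_append 1 N _ ω (by omega) (by omega)]
      exact List.take_left' (by rw [length_segment]; omega)
    split_ifs with h
    · filter_upwards [eventually_ge_atTop N] with i hi
      have := hρ i ω
      rwa [e i hi, if_pos h] at this
    · filter_upwards [eventually_ge_atTop N] with i hi
      have := hρ i ω
      rwa [e i hi, if_neg h] at this
  set A : Set Ω := {ω | M.segment 1 N ω ∈ G} with hA
  have hp0 : 0 ≤ p := hp ▸ measureReal_nonneg
  have hp1 : 0 ≤ 1 - p := sub_nonneg.2 (hp ▸ measureReal_le_one)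
  have hint : ∀ {x y : ℝ}, 0 ≤ x → 0 ≤ y → ∫⁻ ω, (if ω ∈ A then ENNReal.ofReal x
      else ENNReal.ofReal y) ∂P = ENNReal.ofReal (p * x + (1 - p) * y) := by
    intro x y hx hy
    have h1 : P A = ENNReal.ofReal p := by rw [← hp, ofReal_measureReal]
    have h2 : P Aᶜ = ENNReal.ofReal (1 - p) := by
      rw [← hp, ← probReal_compl_eq_one_sub hG, ofReal_measureReal]
    rw [← lintegral_add_compl _ hG, setLIntegral_congr_fun hG (g := fun _ => ENNReal.ofReal x)
      (fun ω hω => if_pos hω), setLIntegral_congr_fun hG.compl (g := fun _ => ENNReal.ofReal y)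
      (fun ω hω => if_neg hω), setLIntegral_const, setLIntegral_const, h1, h2,
      ← ENNReal.ofReal_mul hx, ← ENNReal.ofReal_mul hy,
      ← ENNReal.ofReal_add (mul_nonneg hx hp0) (mul_nonneg hy hp1)]
    congr 1
    ring
  refine ⟨M.ruleSelection ρ, hR.1, ?_, ?_⟩
  · rw [← hint hr₁.2.1 hr₂.2.1]
    refine lintegral_mono_ae ?_
    filter_upwards [hev, hr₁.2.2 _ hR.1 _ hage, hr₂.2.2 _ hR.1 _ hage] with ω h h1 h2
    by_cases hω : ω ∈ A
    · rw [if_pos hω]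
      exact (h1 (by rwa [if_pos (show M.segment 1 N ω ∈ G from hω)] at h)).1
    · rw [if_neg hω]
      exact (h2 (by rwa [if_neg (show M.segment 1 N ω ∉ G from hω)] at h)).1
  · rw [← hint hr₁.1 hr₂.1]
    refine lintegral_mono_ae ?_
    filter_upwards [hev, hr₁.2.2 _ hR.1 _ hage, hr₂.2.2 _ hR.1 _ hage] with ω h h1 h2
    by_cases hω : ω ∈ A
    · rw [if_pos hω]
      exact (h1 (by rwa [if_pos (show M.segment 1 N ω ∈ G from hω)] at h)).2.le
    · rw [if_neg hω]
      exact (h2 (by rwa [if_neg (show M.segment 1 N ω ∉ G from hω)] at h)).2.le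

end Model
end AgeDistortion

namespace AgeDistortion

/-! ### The frontier of the achievable region -/

/-- A set that lies above the supremum `f` of lines with negative slopes, and contains all points
strictly above it, over the nonnegative half-line. Convexity of `f` makes it continuous at positive
arguments. -/
theorem frontier_eq_of_isLUB {J f : ℝ → ℝ} {A : Set (ℝ × ℝ)}
    (hf : ∀ x, 0 ≤ x → IsLUB ((fun η => J η - η * x) '' Set.Ioi 0) (f x))
    (h1 : ∀ p ∈ A, 0 ≤ p.1 ∧ f p.1 ≤ p.2) (h2 : ∀ p : ℝ × ℝ, 0 ≤ p.1 → f p.1 < p.2 → p ∈ A) :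
    frontier A = {p | 0 ≤ p.1 ∧ p.2 = f p.1} ∪ {p | p.1 = 0 ∧ f 0 ≤ p.2} := by
  have hline : ∀ x, 0 ≤ x → ∀ η, 0 < η → J η - η * x ≤ f x := fun x hx η hη =>
    (hf x hx).1 ⟨η, hη, rfl⟩
  have hle : ∀ x, 0 ≤ x → ∀ y, (∀ η, 0 < η → J η - η * x ≤ y) → f x ≤ y := fun x hx y h =>
    (hf x hx).2 (by rintro _ ⟨η, hη, rfl⟩; exact h η hη)
  have hanti : ∀ x x', 0 ≤ x → x ≤ x' → f x' ≤ f x := fun x x' hx hxx =>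
    hle x' (hx.trans hxx) _ fun η hη => le_trans (by nlinarith) (hline x hx η hη)
  have hclosure : closure A = {p | 0 ≤ p.1 ∧ f p.1 ≤ p.2} := by
    refine subset_antisymm ?_ fun p hp => ?_
    · have e : {p : ℝ × ℝ | 0 ≤ p.1 ∧ f p.1 ≤ p.2} =
          {p | 0 ≤ p.1} ∩ ⋂ η : Set.Ioi (0 : ℝ), {p | J η - η * p.1 ≤ p.2} := by
        ext p
        simp only [Set.mem_ofPred_eq, Set.mem_inter_iff, Set.mem_iInter, Subtype.forall,
          Set.mem_Ioi]
        exact ⟨fun h => ⟨h.1, fun η hη => (hline _ h.1 η hη).trans h.2⟩,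
          fun h => ⟨h.1, hle _ h.1 _ h.2⟩⟩
      refine closure_minimal h1 ?_
      rw [e]
      exact (isClosed_le continuous_const continuous_fst).inter
        (isClosed_iInter fun η => isClosed_le (by fun_prop) continuous_snd)
    · have hlim : Tendsto (fun n : ℕ => (p.1, p.2 + 1 / ((n : ℝ) + 1))) atTop (nhds p) := by
        refine tendsto_const_nhds.prodMk_nhds ?_
        simpa using (tendsto_const_nhds (x := p.2)).add tendsto_one_div_add_atTop_nhds_zero_nat
      refine mem_closure_of_tendsto hlim (Eventually.of_forall fun n => h2 _ hp.1 ?_)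
      have : (0 : ℝ) < 1 / ((n : ℝ) + 1) := by positivity
      simp only
      linarith [hp.2]
  have hinterior : interior A = {p | 0 < p.1 ∧ f p.1 < p.2} := by
    ext p
    constructor
    · intro hp
      have hnhds := mem_interior_iff_mem_nhds.1 hp
      have hc : ContinuousAt (fun r : ℝ => (p.1 - r, p.2 - r)) 0 := by fun_prop
      have hc' : ContinuousAt (fun r : ℝ => (p.1, p.2 - r)) 0 := by fun_prop
      have e1 := hc.eventually (p := (· ∈ A)) (by simpa using hnhds)
      have e2 := hc'.eventually (p := (· ∈ A)) (by simpa using hnhds)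
      obtain ⟨r, ⟨hr1, hr2⟩, hr⟩ := (((e1.and e2).filter_mono nhdsWithin_le_nhds).and
        (self_mem_nhdsWithin (s := Set.Ioi (0 : ℝ)))).exists
      have hr' : 0 < r := hr
      have g1 := (h1 _ hr1).1
      have g2 := (h1 _ hr2).2
      simp only at g1 g2
      exact ⟨by linarith, by linarith⟩
    · rintro ⟨hx, hy⟩
      -- by convexity, `f` stays below `p.2` slightly to the left of `p.1`
      have hconv : ∀ t, 0 ≤ t → t ≤ 1 → f (t * p.1) ≤ (1 - t) * f 0 + t * f p.1 := by
        intro t ht0 ht1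
        refine hle _ (mul_nonneg ht0 hx.le) _ fun η hη => ?_
        have g1 := mul_le_mul_of_nonneg_left (hline 0 le_rfl η hη) (sub_nonneg.2 ht1)
        have g2 := mul_le_mul_of_nonneg_left (hline p.1 hx.le η hη) ht0
        linarith
      have hc : ContinuousAt (fun t : ℝ => (1 - t) * f 0 + t * f p.1) 1 := by fun_prop
      have ev := (hc.eventually (p := (· < p.2)) (by
        simpa using eventually_lt_nhds hy)).filter_mono (nhdsWithin_le_nhds (s := Set.Iio 1))
      obtain ⟨t, ⟨ht, ht0⟩, ht1⟩ := ((ev.and (nhdsWithin_le_nhds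
        (lt_mem_nhds (zero_lt_one' ℝ)))).and self_mem_nhdsWithin).exists
      have ht1' : t < 1 := ht1
      have ht0' : 0 < t := ht0
      have hopen : IsOpen (Set.Ioi (t * p.1) ×ˢ Set.Ioi (f (t * p.1))) :=
        isOpen_Ioi.prod isOpen_Ioi
      refine mem_interior.2 ⟨_, fun q hq => ?_, hopen, ?_, (hconv t ht0'.le ht1'.le).trans_lt ht⟩
      · have hq1 : t * p.1 < q.1 := hq.1
        have hq0 : 0 ≤ t * p.1 := mul_nonneg ht0'.le hx.le
        exact h2 q (hq0.trans hq1.le) ((hanti _ _ hq0 hq1.le).trans_lt hq.2)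
      · show t * p.1 < p.1
        nlinarith
  rw [frontier, hclosure, hinterior]
  ext p
  simp only [Set.mem_sdiff, Set.mem_ofPred_eq, Set.mem_union, not_and, not_lt]
  constructor
  · rintro ⟨⟨h3, h4⟩, h5⟩
    rcases h3.eq_or_lt with h6 | h6
    · exact Or.inr ⟨h6.symm, by rwa [← h6] at h4⟩
    · exact Or.inl ⟨h3, le_antisymm (h5 h6) h4⟩
  · rintro (⟨h3, h4⟩ | ⟨h3, h4⟩)
    · exact ⟨⟨h3, h4.ge⟩, fun _ => h4.le⟩
    · exact ⟨⟨h3.ge, by rwa [h3]⟩, fun h => absurd h3 h.ne'⟩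

namespace Model

variable {Ω : Type*} [MeasurableSpace Ω] {P : Measure Ω} {𝒳 : Type*} [MeasurableSpace 𝒳]
variable (M : Model P 𝒳) [Finite 𝒳] [MeasurableSingletonClass 𝒳] [IsProbabilityMeasure P]

/-! ### The achievable region lies above the lines, and is not smaller -/

theorem line_le_of_mem_achievable {x y : ℝ} (h : (x, y) ∈ M.achievable) {η : ℝ} (hη : 0 < η) :
    M.line η x ≤ y := by
  obtain ⟨hx, hy, S, hS, hA, hD⟩ := h
  obtain ⟨s, a, δ, -, -, -, hlow⟩ := M.exists_optimal_rates hη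
  have h1 : ENNReal.ofReal (M.optCost η).toReal ≤ ENNReal.ofReal (y + η * x) := by
    rw [ENNReal.ofReal_add hy (mul_nonneg hη.le hx), ENNReal.ofReal_mul hη.le]
    refine (hlow S hS).trans ?_
    gcongr
  have h2 := (ENNReal.ofReal_le_ofReal_iff (add_nonneg hy (mul_nonneg hη.le hx))).1 h1
  rw [line]
  linarith

/-- Selecting always the most recent packet achieves a finite distortion without excess age. -/
theorem exists_mem_achievable : ∃ y, ∀ x, 0 ≤ x → (x, y) ∈ M.achievable := by
  have hs := M.isPolicy_length 1
  obtain ⟨a, δ, hr, -⟩ := M.exists_hasRates one_pos hs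
  obtain ⟨hD, hA⟩ := hr.inducedSelection one_pos hs
  refine ⟨δ, fun x hx => ⟨hx, hr.2.1, _,
    (isRestrictedSelection_inducedSelection (M := M) one_pos hs).1.1, ?_, hD⟩⟩
  rw [hA, hr.age_eq_zero hs]
  exact ENNReal.ofReal_le_ofReal hx

/-- Points strictly above all lines are achievable: the optimal policies of two close weights, whose
excess ages lie on different sides of the prescribed one, are mixed. -/
theorem mem_achievable_of_line_le {x u y : ℝ} (hx : 0 ≤ x) (hy : 0 ≤ y)
    (hu : ∀ η, 0 < η → M.line η x ≤ u) (huy : u < y) : (x, y) ∈ M.achievable := by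
  have hex := fun η : ℝ => fun hη : 0 < η => M.exists_optimal_rates hη
  choose! s a δ hs hr hJ _ using hex
  have hle : ∀ η, 0 < η → δ η + η * a η ≤ u + η * x := fun η hη => by
    have := hu η hη
    rw [line, hJ η hη] at this
    linarith
  by_cases hL : ∃ η₀, 0 < η₀ ∧ x < a η₀
  · obtain ⟨η₀, hη₀, hx₀⟩ := hL
    -- for large weights the optimal policies have excess age zero
    have hlarge : ∀ η, 0 < η → 1 / M.mu * (M.vMax - M.vMin) ≤ η → a η ≤ x := by
      intro η hη h
      have hb : M.bufferSize η = 1 := by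
        refine le_antisymm (Nat.ceil_le.2 ?_) (M.bufferSize_pos hη)
        rw [← mul_div_assoc, Nat.cast_one]
        exact (div_le_one hη).2 h
      have h1 := hs η hη
      have h2 := hr η hη
      rw [hb] at h1 h2
      rwa [h2.age_eq_zero h1]
    set ε : ℝ := (y - u) / (2 * (x + 1)) with hε
    have hε0 : 0 < ε := div_pos (by linarith) (by linarith)
    have hxε : x * ε ≤ (y - u) / 2 := by
      rw [hε, mul_div_assoc', div_le_div_iff₀ (by linarith) two_pos]
      nlinarith
    have hpos : ∀ k : ℕ, 0 < η₀ + k * ε := fun k => by positivity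
    have hfind : ∃ k : ℕ, a (η₀ + k * ε) ≤ x := by
      obtain ⟨k, hk⟩ := exists_nat_ge (1 / M.mu * (M.vMax - M.vMin) / ε)
      refine ⟨k, hlarge _ (hpos k) ?_⟩
      rw [div_le_iff₀ hε0] at hk
      linarith
    classical
    obtain ⟨k, hk1, hk2⟩ : ∃ k : ℕ, x < a (η₀ + k * ε) ∧ a (η₀ + (k + 1 : ℕ) * ε) ≤ x := by
      have h0 : Nat.find hfind ≠ 0 := by
        intro h0
        have := Nat.find_spec hfind
        rw [h0] at this
        simp at this
        linarith
      refine ⟨Nat.find hfind - 1, not_le.1 (Nat.find_min hfind (by omega)), ?_⟩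
      rw [Nat.sub_add_cancel (Nat.pos_of_ne_zero h0)]
      exact Nat.find_spec hfind
    set η₁ := η₀ + k * ε with hη₁
    set η₂ := η₀ + (k + 1 : ℕ) * ε with hη₂
    have p1 : 0 < η₁ := hpos k
    have p2 : 0 < η₂ := hpos (k + 1)
    have hstep : η₂ = η₁ + ε := by
      rw [hη₁, hη₂]
      push_cast
      ring
    have hδ₂ := (hr η₂ p2).2.1
    have hδ₁ := (hr η₁ p1).2.1
    have ha₂ := (hr η₂ p2).1
    have hden : 0 < a η₁ - a η₂ := by linarith
    set θ := (x - a η₂) / (a η₁ - a η₂) with hθ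
    have hθ0 : 0 ≤ θ := div_nonneg (by linarith) hden.le
    have hθ1 : θ ≤ 1 := (div_le_one hden).2 (by linarith)
    have hθx : θ * (a η₁ - a η₂) = x - a η₂ := div_mul_cancel₀ _ hden.ne'
    set ε' := (y - u) / (2 * (δ η₂ + 1)) with hε'
    have hε'0 : 0 < ε' := div_pos (by linarith) (by linarith)
    have hδε : ε' * δ η₂ ≤ (y - u) / 2 := by
      rw [hε', div_mul_eq_mul_div, div_le_div_iff₀ (by linarith) two_pos]
      nlinarith
    obtain ⟨N, G, hG, hp1, hp2⟩ := M.exists_event_prob hθ0 hθ1 hε'0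
    obtain ⟨S, hS, hD, hA⟩ := exists_mixture (M.bufferSize_pos p1) (M.bufferSize_pos p2)
      (hs η₁ p1) (hs η₂ p2) (hr η₁ p1) (hr η₂ p2) hG rfl
    set p := P.real {ω | M.segment 1 N ω ∈ G} with hp
    refine ⟨hx, hy, S, hS, hA.trans (ENNReal.ofReal_le_ofReal ?_),
      hD.trans (ENNReal.ofReal_le_ofReal ?_)⟩
    · nlinarith [mul_le_mul_of_nonneg_right hp2 hden.le]
    · have g1 := mul_le_mul_of_nonneg_left (hle η₁ p1) hθ0
      have g2 := mul_le_mul_of_nonneg_left (hle η₂ p2) (sub_nonneg.2 hθ1)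
      have g3 : (θ - p) * δ η₂ ≤ ε' * δ η₂ :=
        mul_le_mul_of_nonneg_right (by linarith) hδ₂
      have g4 : 0 ≤ (θ - p) * δ η₁ := mul_nonneg (by linarith) hδ₁
      have g5 : (1 - θ) * (x - a η₂) * ε ≤ x * ε := by
        refine mul_le_mul_of_nonneg_right ?_ hε0.le
        nlinarith [mul_nonneg hθ0 (sub_nonneg.2 hk2)]
      have g6 : θ * (u + η₁ * x) + (1 - θ) * (u + η₂ * x) - θ * (η₁ * a η₁) -
          (1 - θ) * (η₂ * a η₂) = u + (1 - θ) * (x - a η₂) * ε := by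
        clear_value p ε' θ η₂ η₁ ε
        linear_combination (-η₁) * hθx + (1 - θ) * (x - a η₂) * hstep
      nlinarith
  · push Not at hL
    set η := (y - u) / (x + 1) with hη
    have hη0 : 0 < η := div_pos (by linarith) (by linarith)
    have hηx : η * x ≤ y - u := by
      rw [hη, div_mul_eq_mul_div, div_le_iff₀ (by linarith)]
      nlinarith
    obtain ⟨hD, hA⟩ := (hr η hη0).inducedSelection (M.bufferSize_pos hη0) (hs η hη0)
    refine ⟨hx, hy, _, (isRestrictedSelection_inducedSelection (M := M) (M.bufferSize_pos hη0)
      (hs η hη0)).1.1, hA.le.trans (ENNReal.ofReal_le_ofReal (hL η hη0)),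
      hD.trans (ENNReal.ofReal_le_ofReal ?_)⟩
    have := hle η hη0
    have := mul_nonneg hη0.le (hr η hη0).1
    linarith

/-- The supremum of the lines is nonnegative, because `J*(η) ≥ 0` and `η` may be small. -/
theorem nonneg_of_line_le {x u : ℝ} (hx : 0 ≤ x) (hu : ∀ η, 0 < η → M.line η x ≤ u) : 0 ≤ u := by
  refine le_of_forall_pos_le_add fun ε hε => ?_
  have h1 := hu (ε / (x + 1)) (by positivity)
  have h2 : ε / (x + 1) * x ≤ ε := by
    rw [div_mul_eq_mul_div, div_le_iff₀ (by linarith)]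
    nlinarith
  have h3 : (0 : ℝ) ≤ (M.optCost (ε / (x + 1))).toReal := ENNReal.toReal_nonneg
  rw [line] at h1
  linarith

end Model

end AgeDistortion

end

theorem corollary1 {Ω : Type*} [MeasurableSpace Ω] (P : Measure Ω) [IsProbabilityMeasure P]
    {𝒳 : Type*} [Finite 𝒳] [MeasurableSpace 𝒳] [MeasurableSingletonClass 𝒳]
    (M : AgeDistortion.Model P 𝒳) :
    (∀ η : ℝ, 0 < η →
      -- every policy evaluation has exactly one solution
      (∀ s, M.IsPolicy (M.bufferSize η) s →
        ∃ h lam, M.IsEvaluation η (M.bufferSize η) s h lam ∧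
          ∀ h' lam', M.IsEvaluation η (M.bufferSize η) s h' lam' →
            lam' = lam ∧ ∀ b, M.IsState (M.bufferSize η) b → h' b = h b) ∧
      -- policy iteration can be run, and it terminates
      (∃ s h lam, M.IsPolicyIteration η (M.bufferSize η) s h lam ∧
        M.ConsistentTies (M.bufferSize η) s h) ∧
      (∀ s h lam, M.IsPolicyIteration η (M.bufferSize η) s h lam →
        M.ConsistentTies (M.bufferSize η) s h → ∃ n, M.StopsAt (M.bufferSize η) s n) ∧
      -- its output is an optimal policy and the optimal cost
      (∀ s h lam, M.IsPolicyIteration η (M.bufferSize η) s h lam →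
        ∀ n, M.StopsAt (M.bufferSize η) s n →
          M.IsRestrictedSelection (M.inducedSelection (M.bufferSize η) (s n)) ∧
          M.avgCost η (M.inducedSelection (M.bufferSize η) (s n)) = M.optCost η ∧
          0 ≤ lam n ∧ M.optCost η = ENNReal.ofReal (lam n) ∧
          M.distortion (M.inducedSelection (M.bufferSize η) (s n)) +
            ENNReal.ofReal η * M.excessAge (M.inducedSelection (M.bufferSize η) (s n)) =
              M.optCost η)) ∧
    -- the least upper bound of the lines is the boundary of the achievable region
    ∃ f : ℝ → ℝ,
      (∀ x, 0 ≤ x → IsLUB ((fun η => M.line η x) '' Set.Ioi 0) (f x)) ∧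
      (∀ x, 0 ≤ x → IsGLB {y | (x, y) ∈ M.achievable} (f x)) ∧
      frontier M.achievable =
        {p | 0 ≤ p.1 ∧ p.2 = f p.1} ∪ {p | p.1 = 0 ∧ f 0 ≤ p.2} := by
  refine ⟨fun η hη => ⟨fun s hs => M.exists_isEvaluation η (M.bufferSize_pos hη) hs,
    M.exists_policyIteration η (M.bufferSize_pos hη),
    fun s h lam hpi hties => M.policyIteration_stops (M.bufferSize_pos hη) hpi hties,
    fun s h lam hpi n hn => AgeDistortion.Model.optimal_of_optimality hη (hpi.isPolicy n)
      (hpi.2.1 n).2 fun b hb a ha => M.optimality_of_stopsAt hpi hn hb ha⟩, ?_⟩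
  obtain ⟨y₀, hy₀⟩ := M.exists_mem_achievable
  have hlub : ∀ x, 0 ≤ x → IsLUB ((fun η => M.line η x) '' Set.Ioi 0)
      (sSup ((fun η => M.line η x) '' Set.Ioi 0)) := fun x hx =>
    isLUB_csSup ⟨_, 1, Set.mem_Ioi.2 one_pos, rfl⟩ ⟨y₀, by
      rintro _ ⟨η, hη, rfl⟩
      exact M.line_le_of_mem_achievable (hy₀ x hx) hη⟩
  have hline : ∀ x, 0 ≤ x → ∀ η, 0 < η →
      M.line η x ≤ sSup ((fun η => M.line η x) '' Set.Ioi 0) :=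
    fun x hx η hη => (hlub x hx).1 ⟨η, hη, rfl⟩
  have hlow : ∀ x y, (x, y) ∈ M.achievable → sSup ((fun η => M.line η x) '' Set.Ioi 0) ≤ y :=
    fun x y h => (hlub x h.1).2 (by
      rintro _ ⟨η, hη, rfl⟩
      exact M.line_le_of_mem_achievable h hη)
  have hach : ∀ x y, 0 ≤ x → sSup ((fun η => M.line η x) '' Set.Ioi 0) < y →
      (x, y) ∈ M.achievable := fun x y hx hy =>
    M.mem_achievable_of_line_le hx ((M.nonneg_of_line_le hx (hline x hx)).trans hy.le)
      (hline x hx) hy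
  refine ⟨fun x => sSup ((fun η => M.line η x) '' Set.Ioi 0), hlub, fun x hx =>
    ⟨fun y hy => hlow x y hy, fun z hz => le_of_forall_gt_imp_ge_of_dense fun y hy =>
      hz (hach x y hx hy)⟩, ?_⟩
  exact AgeDistortion.frontier_eq_of_isLUB (J := fun η => (M.optCost η).toReal) hlub
    (fun p hp => ⟨hp.1, hlow _ _ hp⟩) fun p => hach p.1 p.2
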